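/- Let $\phi,\theta:\mathbb R\to\mathbb R$ be such that $\phi\in AC_{\rm loc}(\mathbb R)\cap L^\infty(\mathbb R)\cap L^1(\mathbb R)$, $\phi'\in L^\infty(\mathbb R)$, $\theta\in AC_{\rm loc}(\mathbb R)\cap L^\infty(\mathbb R)$, $\theta'\in L^\infty(\mathbb R)\cap L^1(\mathbb R)$, $\lim_{t\to\infty}\theta(t)=1$ and $\lim_{t\to-\infty}\theta(t)=0$. In $L^2(\mathbb R)$ let $A_-=-i\,d/dx$ with domain $W^{1,2}(\mathbb R)$, and for $n\in\mathbb N=\{1,2,\dots\}$ let $\chi_n(\nu)=n(\nu^2+n^2)^{-1/2}$, $\nu\in\mathbb R$. In $L^2(\mathbb R^2;dt\,dx)=L^2(\mathbb R;dt;L^2(\mathbb R;dx))$ a family $T(t)$, $t\in\mathbb R$, of operators in $L^2(\mathbb R;dx)$ generates the operator $(\boldsymbol Tf)(t)=T(t)f(t)$ on its maximal domain. Let $\boldsymbol A_-$, $\boldsymbol B$, $\boldsymbol B_n$, $\boldsymbol B_n'$ be generated in this way by the families $A_-$, $\theta(t)\phi$, $\theta(t)\chi_n(A_-)\phi\chi_n(A_-)$,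 $\theta'(t)\chi_n(A_-)\phi\chi_n(A_-)$, respectively ($\phi$ acting by multiplication). Put $$\boldsymbol D_{\boldsymbol A}=\frac{d}{dt}+\boldsymbol A_-+\boldsymbol B,\quad \operatorname{dom}(\boldsymbol D_{\boldsymbol A})=W^{1,2}(\mathbb R^2),\qquad \boldsymbol H_1=\boldsymbol D_{\boldsymbol A}^*\boldsymbol D_{\boldsymbol A},\quad \boldsymbol H_2=\boldsymbol D_{\boldsymbol A}\boldsymbol D_{\boldsymbol A}^*,$$ and, with $\boldsymbol H_0=-\frac{d^2}{dt^2}+\boldsymbol A_-^2=-\Delta$, $\operatorname{dom}(\boldsymbol H_0)=W^{2,2}(\mathbb R^2)$, $$\boldsymbol H_{j,n}=\boldsymbol H_0+\boldsymbol B_n\boldsymbol A_-+\boldsymbol A_-\boldsymbol B_n+\boldsymbol B_n^2+(-1)^j\boldsymbol B_n',\quad \operatorname{dom}(\boldsymbol H_{j,n})=W^{2,2}(\mathbb R^2),\qquad j=1,2,\ n\in\mathbb N.$$ Theorem. Let $z\in\mathbb C\setminus[0,\infty)$. Then $z$ belongs to the resolvent sets of $\boldsymbol H_1,\boldsymbol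 H_2$ and of $\boldsymbol H_{1,n},\boldsymbol H_{2,n}$ for every $n\in\mathbb N$, the differences $(\boldsymbol H_2-z\boldsymbol I)^{-1}-(\boldsymbol H_1-z\boldsymbol I)^{-1}$ and $(\boldsymbol H_{2,n}-z\boldsymbol I)^{-1}-(\boldsymbol H_{1,n}-z\boldsymbol I)^{-1}$, $n\in\mathbb N$, are trace class, and $$\lim_{n\to\infty}\Big\|\big[(\boldsymbol H_{2,n}-z\boldsymbol I)^{-1}-(\boldsymbol H_{1,n}-z\boldsymbol I)^{-1}\big]-\big[(\boldsymbol H_2-z\boldsymbol I)^{-1}-(\boldsymbol H_1-z\boldsymbol I)^{-1}\big]\Big\|_{\mathcal B_1(L^2(\mathbb R^2))}=0,$$ where $\|\cdot\|_{\mathcal B_1}$ is the trace norm. -/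

import Mathlib

open MeasureTheory Filter Topology
open scoped ENNReal FourierTransform LineDeriv

noncomputable section

namespace DiracModel

/-! ### Unbounded operators in a Hilbert space -/

section Operators

variable {H : Type*} [NormedAddCommGroup H] [InnerProductSpace ℂ H]

/-- The product `S T` of two unbounded operators, with its natural (maximal) domain
`{u ∈ dom T | T u ∈ dom S}`. (The sum of `LinearPMap`s in Mathlib is defined on the intersection
of the domains.) -/
def pcomp (S T : H →ₗ.[ℂ] H) : H →ₗ.[ℂ] H :=
  S.comp (T.domRestrict ((S.domain.comap T.toFun).map T.domain.subtype)) (by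
    rintro ⟨u, hu, hu'⟩
    obtain ⟨⟨v, hv⟩, hvS, rfl⟩ := hu
    exact hvS)

theorem mem_graph_pcomp (S T : H →ₗ.[ℂ] H) (u w : H) :
    (u, w) ∈ (pcomp S T).graph ↔ ∃ v, (u, v) ∈ T.graph ∧ (v, w) ∈ S.graph := by
  constructor
  · intro h
    obtain ⟨⟨y, hy, hyT⟩, h1, h2⟩ := LinearPMap.mem_graph_iff (f := pcomp S T) |>.1 h
    obtain ⟨⟨v, hv⟩, hvS, hvy⟩ := hy
    have hvy' : v = y := hvy
    subst hvy'
    have h1' : v = u := h1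
    subst h1'
    refine ⟨T ⟨v, hv⟩, LinearPMap.mem_graph T ⟨v, hv⟩, ?_⟩
    have h3 : S ⟨T ⟨v, hv⟩, hvS⟩ = w := h2
    rw [← h3]
    exact LinearPMap.mem_graph S ⟨_, hvS⟩
  · rintro ⟨v, h1, h2⟩
    obtain ⟨⟨y, hy⟩, rfl, rfl⟩ := (LinearPMap.mem_graph_iff T).1 h1
    obtain ⟨⟨x, hx⟩, hxy, rfl⟩ := (LinearPMap.mem_graph_iff S).1 h2
    have hxy' : x = T ⟨y, hy⟩ := hxy
    subst hxy'
    rw [LinearPMap.mem_graph_iff]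
    exact ⟨⟨y, ⟨⟨y, hy⟩, hx, rfl⟩, hy⟩, rfl, rfl⟩

/-- `R` is a bounded two-sided inverse of `T - z I : dom T → H`. -/
def IsResolventAt (T : H →ₗ.[ℂ] H) (z : ℂ) (R : H →L[ℂ] H) : Prop :=
  (∀ f : H, ∃ u : T.domain, (u : H) = R f ∧ T u - z • (u : H) = f) ∧
    ∀ u : T.domain, R (T u - z • (u : H)) = u

theorem IsResolventAt.unique {T : H →ₗ.[ℂ] H} {z : ℂ} {R R' : H →L[ℂ] H}
    (h : IsResolventAt T z R) (h' : IsResolventAt T z R') : R = R' := by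
  ext f
  obtain ⟨u, hu, huf⟩ := h'.1 f
  rw [← hu, ← h.2 u, huf]

/-- The resolvent set `ρ(T)` of an unbounded operator. -/
def resolventSet (T : H →ₗ.[ℂ] H) : Set ℂ := {z | ∃ R : H →L[ℂ] H, IsResolventAt T z R}

open Classical in
/-- The resolvent `(T - z I)⁻¹` as a bounded operator, for `z ∈ ρ(T)` (and `0` otherwise). -/
def resolvent (T : H →ₗ.[ℂ] H) (z : ℂ) : H →L[ℂ] H :=
  if h : ∃ R : H →L[ℂ] H, IsResolventAt T z R then h.choose else 0

/-- The trace norm `‖T‖₁ = tr |T|`, `|T| = (T* T)^{1/2}`, with values in `[0, ∞]`. The trace of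
the nonnegative operator `|T|` is the supremum of `∑ ⟨e, |T| e⟩` over finite orthonormal sets; it
is the sum of the singular values of `T` when `T` is compact. -/
def traceNorm [CompleteSpace H] (T : H →L[ℂ] H) : ℝ≥0∞ :=
  ⨆ (s : Finset H) (_ : Orthonormal ℂ (fun e : s => (e : H))),
    ∑ e ∈ s, ENNReal.ofReal (RCLike.re (inner ℂ e (CFC.abs T e)))

/-- `T` belongs to the trace class `𝓑₁(H)`. -/
def IsTraceClass [CompleteSpace H] (T : H →L[ℂ] H) : Prop := traceNorm T < ∞

end Operators

/-! ### Operators in `L²(ℝ; E)` -/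

/-- `L²(ℝ; E)` with respect to Lebesgue measure. -/
abbrev L2 (E : Type*) [NormedAddCommGroup E] : Type _ := Lp E 2 (volume : Measure ℝ)

section FunctionOperators

variable (E : Type*) [NormedAddCommGroup E] [InnerProductSpace ℂ E] [CompleteSpace E]

/-- Pairs `(g, h)` in `L²(ℝ; E)` such that `h` is the distributional derivative of `g`. -/
def derivGraph : Submodule ℂ (L2 E × L2 E) where
  carrier := {p | ∂_{(1 : ℝ)} (Lp.toTemperedDistributionCLM E volume 2 p.1) =
    Lp.toTemperedDistributionCLM E volume 2 p.2}
  add_mem' := by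
    intro p q hp hq
    simp only [Set.mem_ofPred_eq, Prod.fst_add, Prod.snd_add, map_add, LineDeriv.lineDerivOp_add]
      at hp hq ⊢
    rw [hp, hq]
  zero_mem' := by
    simp only [Set.mem_ofPred_eq, Prod.fst_zero, Prod.snd_zero, map_zero,
      LineDeriv.lineDerivOp_zero]
  smul_mem' := by
    intro c p hp
    simp only [Set.mem_ofPred_eq, Prod.smul_fst, Prod.smul_snd, map_smul,
      LineDeriv.lineDerivOp_smul] at hp ⊢
    rw [hp]

/-- The derivative in `L²(ℝ; E)` with domain `W^{1,2}(ℝ; E)`. -/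
def derivOp : L2 E →ₗ.[ℂ] L2 E := (derivGraph E).toLinearPMap

variable {E}

theorem mem_graph_derivOp (g h : L2 E) : (g, h) ∈ (derivOp E).graph ↔
    ∂_{(1 : ℝ)} (Lp.toTemperedDistributionCLM E volume 2 g) =
      Lp.toTemperedDistributionCLM E volume 2 h := by
  rw [derivOp, Submodule.toLinearPMap_graph_eq]
  · rfl
  · rintro ⟨x, y⟩ hx (rfl : x = 0)
    have hy : Lp.toTemperedDistributionCLM E volume 2 y = 0 := by
      have hx' : ∂_{(1 : ℝ)} (Lp.toTemperedDistributionCLM E volume 2 (0 : L2 E)) =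
        Lp.toTemperedDistributionCLM E volume 2 y := hx
      rw [← hx', map_zero, LineDeriv.lineDerivOp_zero]
    have := Lp.ker_toTemperedDistributionCLM_eq_bot (F := E) (μ := (volume : Measure ℝ)) (p := 2)
    exact (LinearMap.ker_eq_bot'.1 this) y hy

/-- The graph of the operator in `L²(ℝ; E)` generated by a family `T(t)`, `t ∈ ℝ`, of operators
in `E`: the pairs `(g, h)` with `g(t) ∈ dom T(t)` and `h(t) = T(t) g(t)` for a.e. `t`. -/
def fiberGraph (T : ℝ → E →ₗ.[ℂ] E) : Submodule ℂ (L2 E × L2 E) where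
  carrier := {p | ∀ᵐ t : ℝ, (p.1 t, p.2 t) ∈ (T t).graph}
  add_mem' := by
    intro p q hp hq
    have hp' : ∀ᵐ t : ℝ, (p.1 t, p.2 t) ∈ (T t).graph := hp
    have hq' : ∀ᵐ t : ℝ, (q.1 t, q.2 t) ∈ (T t).graph := hq
    change ∀ᵐ t : ℝ, ((p.1 + q.1 : L2 E) t, (p.2 + q.2 : L2 E) t) ∈ (T t).graph
    filter_upwards [hp', hq', Lp.coeFn_add p.1 q.1, Lp.coeFn_add p.2 q.2] with t h1 h2 h3 h4
    rw [h3, h4]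
    exact (T t).graph.add_mem h1 h2
  zero_mem' := by
    change ∀ᵐ t : ℝ, ((0 : L2 E) t, (0 : L2 E) t) ∈ (T t).graph
    filter_upwards [Lp.coeFn_zero E 2 (volume : Measure ℝ)] with t h
    rw [h]
    exact (T t).graph.zero_mem
  smul_mem' := by
    intro c p hp
    have hp' : ∀ᵐ t : ℝ, (p.1 t, p.2 t) ∈ (T t).graph := hp
    change ∀ᵐ t : ℝ, ((c • p.1 : L2 E) t, (c • p.2 : L2 E) t) ∈ (T t).graph
    filter_upwards [hp', Lp.coeFn_smul c p.1, Lp.coeFn_smul c p.2] with t h1 h3 h4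
    rw [h3, h4]
    exact (T t).graph.smul_mem c h1

/-- The operator `𝑻` in `L²(ℝ; E)` generated by a family `T(t)` of operators in `E`:
`(𝑻 g)(t) = T(t) g(t)` for a.e. `t`, on its maximal domain. -/
def fiberOp (T : ℝ → E →ₗ.[ℂ] E) : L2 E →ₗ.[ℂ] L2 E := (fiberGraph T).toLinearPMap

theorem mem_graph_fiberOp (T : ℝ → E →ₗ.[ℂ] E) (g h : L2 E) :
    (g, h) ∈ (fiberOp T).graph ↔ ∀ᵐ t : ℝ, (g t, h t) ∈ (T t).graph := by
  rw [fiberOp, Submodule.toLinearPMap_graph_eq]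
  · rfl
  · rintro ⟨x, y⟩ hx (rfl : x = 0)
    have hx' : ∀ᵐ t : ℝ, ((0 : L2 E) t, y t) ∈ (T t).graph := hx
    change y = 0
    rw [Lp.eq_zero_iff_ae_eq_zero]
    filter_upwards [hx', Lp.coeFn_zero E 2 (volume : Measure ℝ)] with t h1 h2
    exact (T t).graph_fst_eq_zero_snd h1 (by rw [h2]; rfl)

/-- The maximal operator of multiplication by the scalar function `m` in `L²(ℝ; E)`. -/
def mulOp (m : ℝ → ℂ) : L2 E →ₗ.[ℂ] L2 E :=
  fiberOp fun t => (m t • (LinearMap.id : E →ₗ[ℂ] E)).toPMap ⊤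

theorem mem_graph_mulOp (m : ℝ → ℂ) (g h : L2 E) :
    (g, h) ∈ (mulOp m : L2 E →ₗ.[ℂ] L2 E).graph ↔ ∀ᵐ t : ℝ, h t = m t • g t := by
  rw [mulOp, mem_graph_fiberOp]
  refine eventually_congr (Eventually.of_forall fun t => ?_)
  rw [LinearPMap.mem_graph_iff]
  constructor
  · rintro ⟨y, h1, h2⟩
    have h1' : (y : E) = g t := h1
    have h2' : m t • (y : E) = h t := h2
    rw [← h2', h1']
  · intro h1
    exact ⟨⟨g t, trivial⟩, rfl, h1.symm⟩

end FunctionOperators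

/-! ### The operators in `L²(ℝ; dx)` -/

/-- `A₋ = -i d/dx` in `L²(ℝ)`, with domain `W^{1,2}(ℝ)`. -/
def Aminus : L2 ℂ →ₗ.[ℂ] L2 ℂ := (-Complex.I) • derivOp ℂ

/-- The function `f(A₋)` of the self-adjoint operator `A₋ = -i d/dx`: since the Fourier transform
`(𝓕 u)(ξ) = ∫ exp(-2π i ξ x) u(x) dx` turns `A₋` into multiplication by `2πξ`, this is
`𝓕⁻¹ f(2πξ) 𝓕`. -/
def funAminus (f : ℝ → ℝ) : L2 ℂ →ₗ.[ℂ] L2 ℂ :=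
  pcomp ((Lp.fourierTransformₗᵢ ℝ ℂ).symm.toLinearEquiv.toLinearMap.toPMap ⊤)
    (pcomp (mulOp fun ξ => (f (2 * Real.pi * ξ) : ℂ))
      ((Lp.fourierTransformₗᵢ ℝ ℂ).toLinearEquiv.toLinearMap.toPMap ⊤))

/-- `χ_n(ν) = n / (ν² + n²)^{1/2}`. -/
def chi (n : ℕ) (ν : ℝ) : ℝ := n / Real.sqrt (ν ^ 2 + (n : ℝ) ^ 2)

/-- Multiplication by `φ` in `L²(ℝ)`. -/
def Bplus (φ : ℝ → ℝ) : L2 ℂ →ₗ.[ℂ] L2 ℂ := mulOp fun x => (φ x : ℂ)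

/-- `χ_n(A₋) φ χ_n(A₋)`. -/
def BplusN (φ : ℝ → ℝ) (n : ℕ) : L2 ℂ →ₗ.[ℂ] L2 ℂ :=
  pcomp (funAminus (chi n)) (pcomp (Bplus φ) (funAminus (chi n)))

/-! ### The operators in `L²(ℝ²; dt dx) = L²(ℝ; dt; L²(ℝ; dx))` -/

/-- The Hilbert space `L²(ℝ; dt; L²(ℝ; dx))`, that is, `L²(ℝ²; dt dx)`. -/
abbrev Space : Type := L2 (L2 ℂ)

/-- `d/dt`, with domain `W^{1,2}(ℝ; dt; L²(ℝ; dx))`. -/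
def ddt : Space →ₗ.[ℂ] Space := derivOp (L2 ℂ)

/-- The constant fiber operator `𝑨₋` generated by `A₋`. -/
def boldAminus : Space →ₗ.[ℂ] Space := fiberOp fun _ => Aminus

/-- The operator generated by the family `η(t) T`, `t ∈ ℝ`. -/
def boldFamily (η : ℝ → ℝ) (T : L2 ℂ →ₗ.[ℂ] L2 ℂ) : Space →ₗ.[ℂ] Space :=
  fiberOp fun t => (η t : ℂ) • T

/-- `𝑨 = 𝑨₋ + 𝑩`, where `𝑩` is generated by `B(t) = θ(t) φ`. -/
def boldA (φ θ : ℝ → ℝ) : Space →ₗ.[ℂ] Space := boldAminus + boldFamily θ (Bplus φ)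

/-- `𝑫_𝑨 = d/dt + 𝑨`, with domain `dom (d/dt) ∩ dom 𝑨₋ = W^{1,2}(ℝ²)`. -/
def DA (φ θ : ℝ → ℝ) : Space →ₗ.[ℂ] Space := ddt + boldA φ θ

/-- `𝑯₁ = 𝑫_𝑨* 𝑫_𝑨`. -/
def H1 (φ θ : ℝ → ℝ) : Space →ₗ.[ℂ] Space := pcomp (DA φ θ).adjoint (DA φ θ)

/-- `𝑯₂ = 𝑫_𝑨 𝑫_𝑨*`. -/
def H2 (φ θ : ℝ → ℝ) : Space →ₗ.[ℂ] Space := pcomp (DA φ θ) (DA φ θ).adjoint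

/-- `𝑯₀ = -d²/dt² + 𝑨₋² = -Δ`, with domain `W^{2,2}(ℝ²)`. -/
def H0 : Space →ₗ.[ℂ] Space := -(pcomp ddt ddt) + pcomp boldAminus boldAminus

/-- `𝑩_n`, generated by the family `B_n(t) = θ(t) χ_n(A₋) φ χ_n(A₋)`. -/
def boldBn (φ θ : ℝ → ℝ) (n : ℕ) : Space →ₗ.[ℂ] Space := boldFamily θ (BplusN φ n)

/-- `𝑩_n'`, generated by the family `B_n'(t) = θ'(t) χ_n(A₋) φ χ_n(A₋)`. -/
def boldBn' (φ θ : ℝ → ℝ) (n : ℕ) : Space →ₗ.[ℂ] Space := boldFamily (deriv θ) (BplusN φ n)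

/-- The part `𝑯₀ + 𝑩_n 𝑨₋ + 𝑨₋ 𝑩_n + 𝑩_n²` that is common to `𝑯_{1,n}` and `𝑯_{2,n}`. -/
def HnCommon (φ θ : ℝ → ℝ) (n : ℕ) : Space →ₗ.[ℂ] Space :=
  H0 + pcomp (boldBn φ θ n) boldAminus + pcomp boldAminus (boldBn φ θ n) +
    pcomp (boldBn φ θ n) (boldBn φ θ n)

/-- `𝑯_{1,n} = 𝑯₀ + 𝑩_n 𝑨₋ + 𝑨₋ 𝑩_n + 𝑩_n² - 𝑩_n'`. -/
def H1n (φ θ : ℝ → ℝ) (n : ℕ) : Space →ₗ.[ℂ] Space := HnCommon φ θ n - boldBn' φ θ n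

/-- `𝑯_{2,n} = 𝑯₀ + 𝑩_n 𝑨₋ + 𝑨₋ 𝑩_n + 𝑩_n² + 𝑩_n'`. -/
def H2n (φ θ : ℝ → ℝ) (n : ℕ) : Space →ₗ.[ℂ] Space := HnCommon φ θ n + boldBn' φ θ n

/-- The standing hypothesis on the real-valued functions `φ` and `θ`. -/
structure Admissible (φ θ : ℝ → ℝ) : Prop where
  phi_ac : ∀ a b : ℝ, AbsolutelyContinuousOnInterval φ a b
  phi_bdd : MemLp φ ∞ volume
  phi_int : MemLp φ 1 volume
  phi_deriv_bdd : MemLp (deriv φ) ∞ volume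
  theta_ac : ∀ a b : ℝ, AbsolutelyContinuousOnInterval θ a b
  theta_bdd : MemLp θ ∞ volume
  theta_deriv_bdd : MemLp (deriv θ) ∞ volume
  theta_deriv_int : MemLp (deriv θ) 1 volume
  theta_top : Tendsto θ atTop (𝓝 1)
  theta_bot : Tendsto θ atBot (𝓝 0)

end DiracModel

end

/-!
The operators `𝑯_j` and `𝑯_{j,n}` are all nonnegative, and all of them have, on `W^{2,2}(ℝ²)`, the
form `𝑯₀ + 𝑩 𝑨₋ + 𝑨₋ 𝑩 + 𝑩² ± 𝑩'` with a bounded operator `𝑩` generated by `θ(t) m φ m`, where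
`m` is a contraction that commutes with `𝑨₋`: `m = 1` for `𝑯_j` and `m = χ_n(A₋)` for `𝑯_{j,n}`
(`isSchroedinger_H1`, `isSchroedinger_H2`, `isSchroedinger_H1n`, `isSchroedinger_H2n`). For `𝑯_j`,
nonnegativity is clear from the factorized form; for `𝑯_{j,n}` the quadratic form is the square
`‖(±d/dt + 𝑨₋ + 𝑩_n) u‖²` (`inner_schroedinger`).

With `S = (𝑯₀ + e²)⁻¹` one has `(T + e²) S = 1 + K` for each of these operators `T`, and `‖K‖ ≤ 1/2`
for a large `e` that does not depend on the cutoff `m` (`norm_relPert_le`). As `T ≥ 0`, the bounded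
operator `Q = (T - z) S = 1 + K - (z + e²) S` is invertible for `z ∉ [0, ∞)`, the resolvent of `T`
is `S Q⁻¹`, and the norm of `Q⁻¹` is bounded uniformly in `m` (`NonnegForm.exists_resolvent`). No
knowledge of the self-adjointness of `T` is needed for this.

By the second resolvent identity and `S Q(z)⁻¹ = (Q(z̄)⁻¹)* S`, the difference of the resolvents is
`-2 (Q₁(z̄)⁻¹)* S 𝑩' S Q₂(z)⁻¹`. The operator `S` is the product of the Fourier multiplier
`(1 + τ²)^{-1/2} (1 + ξ²)^{-1/2}` and a bounded multiplier, and `𝑩'` is generated by the family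
`θ'(t) m φ m` with `θ'` and `φ` in `L¹`. So `S 𝑩' S` contains the operator
`W = |θ'|^{1/2} |φ|^{1/2} (1 + τ²)^{-1/2} (1 + ξ²)^{-1/2}` twice, and `W` is Hilbert–Schmidt, being
the tensor product of two operators `v(x) w(-i d/dx)` in `L²(ℝ)` with `v, w ∈ L²`
(`hsq_tensor_lt_top`, `hsq_mulL_conjF_lt_top`). Hence the difference of the resolvents is
`(W L)* V (W M)` with bounded `L`, `M`, `V`, which is trace class (`resolvent_sub_eq`,
`traceNorm_star_mul_le`).

In this representation `W` and `V` do not depend on the cutoff. The adjoints of the factors `L_n`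
and `M_n` are bounded and converge strongly, because `χ_n(A₋) → 1` strongly
(`strongTendsto_star_linkOp_mul`). Dominated convergence of Hilbert–Schmidt norms then gives the
convergence in the trace norm (`tendsto_traceNorm`).
-/

noncomputable section

namespace DiracModel

/-! ### Decomposable operators in `L²(ℝ; E)` -/

section Decomposable

variable {E : Type*} [NormedAddCommGroup E] [InnerProductSpace ℂ E] [CompleteSpace E]

open Classical in
/-- The decomposable bounded operator `f ↦ (t ↦ Λ(t) f(t))` in `L²(ℝ; E)` defined by an essentially
bounded, strongly measurable family `Λ` of bounded operators (and `0` for other families). -/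
def fib (Λ : ℝ → E →L[ℂ] E) : L2 E →L[ℂ] L2 E :=
  if h : MemLp Λ ∞ volume then
    ((ContinuousLinearMap.id ℂ (E →L[ℂ] E)).holderL volume ∞ 2 2) (h.toLp Λ) else 0

theorem fib_coe {Λ : ℝ → E →L[ℂ] E} (h : MemLp Λ ∞ volume) (f : L2 E) :
    ∀ᵐ t : ℝ, fib Λ f t = Λ t (f t) := by
  rw [fib, dif_pos h]
  filter_upwards [ContinuousLinearMap.coeFn_holder (r := 2)
    (ContinuousLinearMap.id ℂ (E →L[ℂ] E)) (h.toLp Λ) f, h.coeFn_toLp] with t h1 h2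
  change (ContinuousLinearMap.holder 2 (ContinuousLinearMap.id ℂ (E →L[ℂ] E)) (h.toLp Λ) f) t = _
  rw [h1, h2]
  rfl

theorem fib_eq_of_ae {Λ : ℝ → E →L[ℂ] E} (h : MemLp Λ ∞ volume) {f g : L2 E}
    (hg : ∀ᵐ t : ℝ, g t = Λ t (f t)) : fib Λ f = g := by
  refine Lp.ext ?_
  filter_upwards [fib_coe h f, hg] with t h1 h2
  rw [h1, h2]

theorem memLp_comp {Λ Λ' : ℝ → E →L[ℂ] E} (h : MemLp Λ ∞ volume) (h' : MemLp Λ' ∞ volume) :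
    MemLp (fun t => Λ t * Λ' t) ∞ volume :=
  (ContinuousLinearMap.mul ℂ (E →L[ℂ] E)).memLp_of_bilin (r := ∞) h h'

theorem fib_mul {Λ Λ' : ℝ → E →L[ℂ] E} (h : MemLp Λ ∞ volume) (h' : MemLp Λ' ∞ volume) :
    fib Λ * fib Λ' = fib fun t => Λ t * Λ' t := by
  ext1 f
  refine (fib_eq_of_ae (memLp_comp h h') ?_).symm
  filter_upwards [fib_coe h (fib Λ' f), fib_coe h' f] with t h1 h2
  change fib Λ (fib Λ' f) t = _
  rw [h1, h2]
  rfl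

theorem fib_add {Λ Λ' : ℝ → E →L[ℂ] E} (h : MemLp Λ ∞ volume) (h' : MemLp Λ' ∞ volume) :
    fib Λ + fib Λ' = fib fun t => Λ t + Λ' t := by
  ext1 f
  refine (fib_eq_of_ae (h.add h') ?_).symm
  filter_upwards [fib_coe h f, fib_coe h' f, Lp.coeFn_add (fib Λ f) (fib Λ' f)] with t h1 h2 h3
  change (fib Λ f + fib Λ' f) t = _
  rw [h3, Pi.add_apply, h1, h2]
  rfl

theorem fib_smul (c : ℂ) {Λ : ℝ → E →L[ℂ] E} (h : MemLp Λ ∞ volume) :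
    c • fib Λ = fib fun t => c • Λ t := by
  ext1 f
  refine (fib_eq_of_ae (h.const_smul c) ?_).symm
  filter_upwards [fib_coe h f, Lp.coeFn_smul c (fib Λ f)] with t h1 h3
  change (c • fib Λ f) t = _
  rw [h3, Pi.smul_apply, h1]
  rfl

theorem fib_one : fib (fun _ => (1 : E →L[ℂ] E)) = 1 := by
  ext1 f
  exact fib_eq_of_ae (memLp_top_const _) (Eventually.of_forall fun t => rfl)

theorem norm_fib_le {Λ : ℝ → E →L[ℂ] E} {C : ℝ} (hC : 0 ≤ C) (h : ∀ᵐ t : ℝ, ‖Λ t‖ ≤ C) :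
    ‖fib Λ‖ ≤ C := by
  by_cases hΛ : MemLp Λ ∞ volume
  · refine ContinuousLinearMap.opNorm_le_bound _ hC fun f => ?_
    refine Lp.norm_le_mul_norm_of_ae_le_mul ?_
    filter_upwards [fib_coe hΛ f, h] with t h1 h2
    rw [h1]
    exact (Λ t).le_of_opNorm_le h2 _
  · rw [fib, dif_neg hΛ, norm_zero]
    exact hC

theorem memLp_adjoint {Λ : ℝ → E →L[ℂ] E} (h : MemLp Λ ∞ volume) :
    MemLp (fun t => star (Λ t)) ∞ volume := by
  refine h.congr_norm (continuous_star.comp_aestronglyMeasurable h.1) ?_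
  exact Eventually.of_forall fun t => (norm_star (Λ t)).symm

theorem star_fib {Λ : ℝ → E →L[ℂ] E} (h : MemLp Λ ∞ volume) :
    star (fib Λ) = fib fun t => star (Λ t) := by
  symm
  rw [ContinuousLinearMap.star_eq_adjoint, ContinuousLinearMap.eq_adjoint_iff]
  intro f g
  rw [L2.inner_def, L2.inner_def]
  refine integral_congr_ae ?_
  filter_upwards [fib_coe (memLp_adjoint h) f, fib_coe h g] with t h1 h2
  rw [h1, h2, ContinuousLinearMap.star_eq_adjoint, ContinuousLinearMap.adjoint_inner_left]

omit [CompleteSpace E] in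
theorem norm_sq_eq_integral (f : L2 E) : ‖f‖ ^ 2 = ∫ t, ‖f t‖ ^ 2 := by
  have h := L2.inner_def (𝕜 := ℂ) f f
  have h2 : (fun t => inner ℂ (f t) (f t)) = fun t => ((‖f t‖ ^ 2 : ℝ) : ℂ) := by
    funext t
    rw [inner_self_eq_norm_sq_to_K]
    norm_cast
  rw [h2, integral_complex_ofReal, inner_self_eq_norm_sq_to_K] at h
  have h3 : ((‖f‖ ^ 2 : ℝ) : ℂ) = ((∫ t, ‖f t‖ ^ 2 : ℝ) : ℂ) := by
    push_cast
    exact h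
  exact Complex.ofReal_injective h3

omit [InnerProductSpace ℂ E] [CompleteSpace E] in
theorem integrable_norm_sq (f : L2 E) : Integrable fun t => ‖f t‖ ^ 2 :=
  (Lp.memLp f).integrable_norm_pow two_ne_zero

/-- Dominated convergence for decomposable operators. -/
theorem tendsto_fib {Λ : ℕ → ℝ → E →L[ℂ] E} {Λ' : ℝ → E →L[ℂ] E} {C : ℝ}
    (h : ∀ n, MemLp (Λ n) ∞ volume) (h' : MemLp Λ' ∞ volume)
    (hC : ∀ n, ∀ᵐ t : ℝ, ‖Λ n t‖ ≤ C) (hC' : ∀ᵐ t : ℝ, ‖Λ' t‖ ≤ C)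
    (ht : ∀ᵐ t : ℝ, ∀ e, Tendsto (fun n => Λ n t e) atTop (𝓝 (Λ' t e))) (f : L2 E) :
    Tendsto (fun n => fib (Λ n) f) atTop (𝓝 (fib Λ' f)) := by
  rw [tendsto_iff_norm_sub_tendsto_zero]
  have key : Tendsto (fun n => ‖fib (Λ n) f - fib Λ' f‖ ^ 2) atTop (𝓝 0) := by
    simp_rw [norm_sq_eq_integral]
    rw [show (0 : ℝ) = ∫ t : ℝ, (0 : ℝ) by simp]
    refine tendsto_integral_of_dominated_convergence (fun t => (2 * C) ^ 2 * ‖f t‖ ^ 2)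
      (fun n => (integrable_norm_sq _).1) ((integrable_norm_sq f).const_mul _) (fun n => ?_) ?_
    · filter_upwards [fib_coe (h n) f, fib_coe h' f, Lp.coeFn_sub (fib (Λ n) f) (fib Λ' f),
        hC n, hC'] with t h1 h2 h3 h4 h5
      rw [Real.norm_of_nonneg (by positivity), h3, Pi.sub_apply, h1, h2, ← mul_pow]
      refine pow_le_pow_left₀ (norm_nonneg _) ?_ 2
      calc ‖Λ n t (f t) - Λ' t (f t)‖ ≤ ‖Λ n t (f t)‖ + ‖Λ' t (f t)‖ := norm_sub_le _ _
        _ ≤ C * ‖f t‖ + C * ‖f t‖ :=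
          add_le_add ((Λ n t).le_of_opNorm_le h4 _) ((Λ' t).le_of_opNorm_le h5 _)
        _ = 2 * C * ‖f t‖ := by ring
    · have hall : ∀ᵐ t : ℝ, ∀ n, (fib (Λ n) f - fib Λ' f) t = Λ n t (f t) - Λ' t (f t) := by
        rw [ae_all_iff]
        intro n
        filter_upwards [fib_coe (h n) f, fib_coe h' f, Lp.coeFn_sub (fib (Λ n) f) (fib Λ' f)]
          with t h1 h2 h3
        rw [h3, Pi.sub_apply, h1, h2]
      filter_upwards [hall, ht] with t h1 h2
      simp_rw [h1]
      have h3 := (tendsto_iff_norm_sub_tendsto_zero.1 (h2 (f t))).pow 2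
      simpa using h3
  have h2 := key.sqrt
  simpa using h2

/-- Multiplication by a bounded measurable scalar function in `L²(ℝ; E)`. -/
def mulL (m : ℝ → ℂ) : L2 E →L[ℂ] L2 E := fib fun t => m t • (1 : E →L[ℂ] E)

theorem memLp_smul_one {m : ℝ → ℂ} (hm : MemLp m ∞ volume) (T : E →L[ℂ] E) :
    MemLp (fun t => m t • T) ∞ volume :=
  (ContinuousLinearMap.lsmul ℂ ℂ (E := E →L[ℂ] E)).memLp_of_bilin (r := ∞) hm (memLp_top_const T)

theorem mulL_coe {m : ℝ → ℂ} (hm : MemLp m ∞ volume) (f : L2 E) :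
    ∀ᵐ t : ℝ, mulL m f t = m t • f t := fib_coe (memLp_smul_one hm _) f

theorem mulL_eq_of_ae {m : ℝ → ℂ} (hm : MemLp m ∞ volume) {f g : L2 E}
    (hg : ∀ᵐ t : ℝ, g t = m t • f t) : mulL m f = g := fib_eq_of_ae (memLp_smul_one hm _) hg

theorem memLp_mul_top {m m' : ℝ → ℂ} (hm : MemLp m ∞ volume) (hm' : MemLp m' ∞ volume) :
    MemLp (fun t => m t * m' t) ∞ volume := hm'.mul (r := ∞) hm

theorem mulL_mul {m m' : ℝ → ℂ} (hm : MemLp m ∞ volume) (hm' : MemLp m' ∞ volume) :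
    (mulL m : L2 E →L[ℂ] L2 E) * mulL m' = mulL fun t => m t * m' t := by
  rw [mulL, mulL, fib_mul (memLp_smul_one hm _) (memLp_smul_one hm' _), mulL]
  simp [smul_smul, mul_comm]

theorem mulL_add {m m' : ℝ → ℂ} (hm : MemLp m ∞ volume) (hm' : MemLp m' ∞ volume) :
    (mulL m : L2 E →L[ℂ] L2 E) + mulL m' = mulL fun t => m t + m' t := by
  rw [mulL, mulL, fib_add (memLp_smul_one hm _) (memLp_smul_one hm' _), mulL]
  simp [add_smul]

theorem mulL_smul (c : ℂ) {m : ℝ → ℂ} (hm : MemLp m ∞ volume) :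
    c • (mulL m : L2 E →L[ℂ] L2 E) = mulL fun t => c * m t := by
  rw [mulL, fib_smul c (memLp_smul_one hm _), mulL]
  simp [smul_smul]

theorem mulL_one : (mulL (fun _ => 1) : L2 E →L[ℂ] L2 E) = 1 := by
  rw [mulL]
  simp only [one_smul]
  exact fib_one

theorem star_mulL {m : ℝ → ℂ} (hm : MemLp m ∞ volume) :
    star (mulL m : L2 E →L[ℂ] L2 E) = mulL fun t => star (m t) := by
  rw [mulL, star_fib (memLp_smul_one hm _), mulL]
  simp

theorem norm_mulL_le {m : ℝ → ℂ} {C : ℝ} (hC : 0 ≤ C) (h : ∀ᵐ t : ℝ, ‖m t‖ ≤ C) :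
    ‖(mulL m : L2 E →L[ℂ] L2 E)‖ ≤ C := by
  refine norm_fib_le hC ?_
  filter_upwards [h] with t ht
  refine (norm_smul_le _ _).trans ?_
  calc ‖m t‖ * ‖(1 : E →L[ℂ] E)‖ ≤ ‖m t‖ * 1 :=
        mul_le_mul_of_nonneg_left ContinuousLinearMap.norm_id_le (norm_nonneg _)
    _ ≤ C := by rwa [mul_one]

theorem tendsto_mulL {m : ℕ → ℝ → ℂ} {m' : ℝ → ℂ} {C : ℝ}
    (h : ∀ n, MemLp (m n) ∞ volume) (h' : MemLp m' ∞ volume)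
    (hC : ∀ n t, ‖m n t‖ ≤ C) (hC' : ∀ t, ‖m' t‖ ≤ C)
    (ht : ∀ t, Tendsto (fun n => m n t) atTop (𝓝 (m' t))) (f : L2 E) :
    Tendsto (fun n => mulL (m n) f) atTop (𝓝 (mulL m' f)) := by
  have hb : ∀ (c : ℂ), ‖c‖ ≤ C → ‖c • (1 : E →L[ℂ] E)‖ ≤ C := fun c hc =>
    (norm_smul_le _ _).trans ((mul_le_mul_of_nonneg_left ContinuousLinearMap.norm_id_le
      (norm_nonneg _)).trans (by rwa [mul_one]))
  refine tendsto_fib (fun n => memLp_smul_one (h n) _) (memLp_smul_one h' _)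
    (fun n => Eventually.of_forall fun t => hb _ (hC n t))
    (Eventually.of_forall fun t => hb _ (hC' t)) (Eventually.of_forall fun t e => ?_) f
  exact (ht t).smul_const e

/-- The operator in `L²(ℝ; E)` with the constant fiber `T`. -/
def constL (T : E →L[ℂ] E) : L2 E →L[ℂ] L2 E := fib fun _ => T

theorem constL_coe (T : E →L[ℂ] E) (f : L2 E) : ∀ᵐ t : ℝ, constL T f t = T (f t) :=
  fib_coe (memLp_top_const T) f

theorem constL_mul (T T' : E →L[ℂ] E) : constL T * constL T' = constL (T * T') :=
  fib_mul (memLp_top_const T) (memLp_top_const T')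

theorem star_constL (T : E →L[ℂ] E) : star (constL T) = constL (star T) :=
  star_fib (memLp_top_const T)

theorem norm_constL_le (T : E →L[ℂ] E) : ‖constL T‖ ≤ ‖T‖ :=
  norm_fib_le (norm_nonneg T) (Eventually.of_forall fun _ => le_rfl)

theorem tendsto_constL {T : ℕ → E →L[ℂ] E} {T' : E →L[ℂ] E} {C : ℝ} (hC : ∀ n, ‖T n‖ ≤ C)
    (hC' : ‖T'‖ ≤ C) (ht : ∀ e, Tendsto (fun n => T n e) atTop (𝓝 (T' e))) (f : L2 E) :
    Tendsto (fun n => constL (T n) f) atTop (𝓝 (constL T' f)) :=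
  tendsto_fib (fun n => memLp_top_const (T n)) (memLp_top_const T')
    (fun n => Eventually.of_forall fun _ => hC n) (Eventually.of_forall fun _ => hC')
    (Eventually.of_forall fun _ => ht) f

/-- Scalar multiplications commute with constant fiber operators. -/
theorem mulL_commute_constL {m : ℝ → ℂ} (hm : MemLp m ∞ volume) (T : E →L[ℂ] E) :
    Commute (mulL m) (constL T) := by
  rw [Commute, SemiconjBy, mulL, constL, fib_mul (memLp_smul_one hm _) (memLp_top_const T),
    fib_mul (memLp_top_const T) (memLp_smul_one hm _)]
  simp

end Decomposable

/-! ### The Fourier transform in `L²(ℝ; E)` and the derivative -/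

section FourierSide

variable {E : Type*} [NormedAddCommGroup E] [InnerProductSpace ℂ E] [CompleteSpace E]

/-- The operator `𝓕⁻¹ T 𝓕`. -/
def conjF (T : L2 E →L[ℂ] L2 E) : L2 E →L[ℂ] L2 E :=
  ((Lp.fourierTransformₗᵢ ℝ E).symm : L2 E →L[ℂ] L2 E) * T *
    ((Lp.fourierTransformₗᵢ ℝ E) : L2 E →L[ℂ] L2 E)

theorem conjF_apply (T : L2 E →L[ℂ] L2 E) (f : L2 E) :
    conjF T f = (Lp.fourierTransformₗᵢ ℝ E).symm (T (Lp.fourierTransformₗᵢ ℝ E f)) := rfl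

theorem fourier_conjF (T : L2 E →L[ℂ] L2 E) (f : L2 E) :
    Lp.fourierTransformₗᵢ ℝ E (conjF T f) = T (Lp.fourierTransformₗᵢ ℝ E f) := by
  rw [conjF_apply, LinearIsometryEquiv.apply_symm_apply]

theorem conjF_mul (T T' : L2 E →L[ℂ] L2 E) : conjF T * conjF T' = conjF (T * T') := by
  ext1 f
  change conjF T (conjF T' f) = conjF (T * T') f
  rw [conjF_apply T, fourier_conjF]
  rfl

theorem conjF_add (T T' : L2 E →L[ℂ] L2 E) : conjF T + conjF T' = conjF (T + T') := by
  ext1 f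
  simp [conjF_apply]

theorem conjF_sub (T T' : L2 E →L[ℂ] L2 E) : conjF T - conjF T' = conjF (T - T') := by
  ext1 f
  simp [conjF_apply]

theorem conjF_smul (c : ℂ) (T : L2 E →L[ℂ] L2 E) : c • conjF T = conjF (c • T) := by
  ext1 f
  simp [conjF_apply]

theorem conjF_one : conjF (1 : L2 E →L[ℂ] L2 E) = 1 := by
  ext1 f
  simp [conjF_apply]

theorem star_conjF (T : L2 E →L[ℂ] L2 E) : star (conjF T) = conjF (star T) := by
  rw [ContinuousLinearMap.star_eq_adjoint (conjF T)]
  symm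
  rw [ContinuousLinearMap.eq_adjoint_iff]
  intro f g
  rw [← LinearIsometryEquiv.inner_map_map (Lp.fourierTransformₗᵢ ℝ E), fourier_conjF,
    ← LinearIsometryEquiv.inner_map_map (Lp.fourierTransformₗᵢ ℝ E) f, fourier_conjF,
    ContinuousLinearMap.star_eq_adjoint, ContinuousLinearMap.adjoint_inner_left]

theorem norm_conjF_le (T : L2 E →L[ℂ] L2 E) : ‖conjF T‖ ≤ ‖T‖ := by
  refine ContinuousLinearMap.opNorm_le_bound _ (norm_nonneg _) fun f => ?_
  rw [conjF_apply, LinearIsometryEquiv.norm_map]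
  refine (T.le_opNorm _).trans ?_
  rw [LinearIsometryEquiv.norm_map]

theorem tendsto_conjF {T : ℕ → L2 E →L[ℂ] L2 E} {T' : L2 E →L[ℂ] L2 E}
    (h : ∀ f, Tendsto (fun n => T n f) atTop (𝓝 (T' f))) (f : L2 E) :
    Tendsto (fun n => conjF (T n) f) atTop (𝓝 (conjF T' f)) :=
  ((Lp.fourierTransformₗᵢ ℝ E).symm.continuous.tendsto _).comp (h _)

/-- The Fourier transform acts in the variable of the base only, so that it commutes with operators
of the fiber. -/
theorem fourier_compLpL {E' : Type*} [NormedAddCommGroup E'] [InnerProductSpace ℂ E']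
    [CompleteSpace E'] (T : E →L[ℂ] E') (f : L2 E) :
    Lp.fourierTransformₗᵢ ℝ E' (T.compLpL 2 volume f) =
      T.compLpL 2 volume (Lp.fourierTransformₗᵢ ℝ E f) := by
  refine DenseRange.induction_on (p := fun f : L2 E =>
    Lp.fourierTransformₗᵢ ℝ E' (T.compLpL 2 volume f) =
      T.compLpL 2 volume (Lp.fourierTransformₗᵢ ℝ E f))
    (SchwartzMap.denseRange_toLpCLM (E := ℝ) (F := E) (p := 2) ENNReal.ofNat_ne_top) f ?_ ?_
  · exact isClosed_eq (by fun_prop) (by fun_prop)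
  · intro f
    have h1 : ∀ g : SchwartzMap ℝ E, T.compLpL 2 volume (g.toLp 2) =
        (g.postcompCLM T).toLp 2 := by
      intro g
      refine Lp.ext ?_
      filter_upwards [T.coeFn_compLpL (g.toLp 2), g.coeFn_toLp 2 volume,
        (g.postcompCLM T).coeFn_toLp 2 volume] with t h1 h2 h3
      rw [h1, h2, h3]
      rfl
    have h2 : ∀ g : SchwartzMap ℝ E, Lp.fourierTransformₗᵢ ℝ E (g.toLp 2) = (𝓕 g).toLp 2 :=
      fun g => SchwartzMap.toLp_fourier_eq g
    have h3 : ∀ g : SchwartzMap ℝ E', Lp.fourierTransformₗᵢ ℝ E' (g.toLp 2) = (𝓕 g).toLp 2 :=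
      fun g => SchwartzMap.toLp_fourier_eq g
    rw [SchwartzMap.toLpCLM_apply, h1, h2, h3, h1]
    congr 1
    ext x
    rw [SchwartzMap.postcompCLM_apply, SchwartzMap.fourier_coe, SchwartzMap.fourier_coe]
    rw [Real.fourier_eq, Real.fourier_eq, ← ContinuousLinearMap.integral_comp_comm]
    · refine integral_congr_ae (Eventually.of_forall fun v => ?_)
      simp [Circle.smul_def, SchwartzMap.postcompCLM_apply]
    · exact (Real.fourierIntegral_convergent_iff x).2 f.integrable

theorem constL_eq_compLpL (T : E →L[ℂ] E) : constL T = T.compLpL 2 volume := by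
  ext1 f
  exact fib_eq_of_ae (memLp_top_const T) (T.coeFn_compLpL f)

theorem fourier_constL (T : E →L[ℂ] E) (f : L2 E) :
    Lp.fourierTransformₗᵢ ℝ E (constL T f) = constL T (Lp.fourierTransformₗᵢ ℝ E f) := by
  rw [constL_eq_compLpL, fourier_compLpL]

theorem conjF_constL (T : E →L[ℂ] E) : conjF (constL T) = constL T := by
  ext1 f
  rw [conjF_apply, ← fourier_constL, LinearIsometryEquiv.symm_apply_apply]

/-- The Fourier transform turns the derivative into multiplication by `2πiτ`. -/
theorem mem_graph_derivOp_iff_fourier (g h : L2 E) : (g, h) ∈ (derivOp E).graph ↔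
    ∀ᵐ τ : ℝ, Lp.fourierTransformₗᵢ ℝ E h τ =
      (2 * Real.pi * Complex.I * τ) • Lp.fourierTransformₗᵢ ℝ E g τ := by
  rw [mem_graph_derivOp]
  have hinj : ∀ S T : TemperedDistribution ℝ E, 𝓕 S = 𝓕 T ↔ S = T := fun S T =>
    ⟨fun h => by
      have h1 := congrArg (fun R : TemperedDistribution ℝ E => (𝓕⁻ R : TemperedDistribution ℝ E)) h
      simpa using h1, fun h => by rw [h]⟩
  rw [← hinj, TemperedDistribution.fourier_lineDerivOp_eq]
  change (2 * Real.pi * Complex.I) • TemperedDistribution.smulLeftCLM E (inner ℝ · 1)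
    (𝓕 (g : TemperedDistribution ℝ E)) = 𝓕 (h : TemperedDistribution ℝ E) ↔ _
  rw [Lp.fourier_toTemperedDistribution_eq, Lp.fourier_toTemperedDistribution_eq]
  change (2 * Real.pi * Complex.I) • TemperedDistribution.smulLeftCLM E (inner ℝ · 1)
    ((Lp.fourierTransformₗᵢ ℝ E g : L2 E) : TemperedDistribution ℝ E) =
    ((Lp.fourierTransformₗᵢ ℝ E h : L2 E) : TemperedDistribution ℝ E) ↔ _
  generalize Lp.fourierTransformₗᵢ ℝ E g = u
  generalize Lp.fourierTransformₗᵢ ℝ E h = v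
  have htg : (fun x : ℝ => ((inner ℝ x 1 : ℝ) : ℂ)).HasTemperateGrowth := by fun_prop
  have key : ∀ ψ : SchwartzMap ℝ ℂ, ((2 * Real.pi * Complex.I) •
      TemperedDistribution.smulLeftCLM E (inner ℝ · 1) (u : TemperedDistribution ℝ E)) ψ =
      ∫ x : ℝ, ψ x • ((2 * Real.pi * Complex.I * x) • u x) := by
    intro ψ
    change (2 * Real.pi * Complex.I) • (TemperedDistribution.smulLeftCLM E _ _ ψ) = _
    rw [TemperedDistribution.smulLeftCLM_apply_apply, Lp.toTemperedDistribution_apply,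
      ← integral_smul]
    refine integral_congr_ae (Eventually.of_forall fun x => ?_)
    dsimp only
    rw [SchwartzMap.smulLeftCLM_apply_apply htg, smul_smul, smul_smul]
    congr 1
    simp
    ring
  constructor
  · intro H
    have : ∀ᵐ x : ℝ, v x - (2 * Real.pi * Complex.I * x) • u x = 0 := by
      have hu : LocallyIntegrable (fun x : ℝ => (2 * Real.pi * Complex.I * x) • u x) volume :=
        ((Lp.memLp u).locallyIntegrable (by norm_num)).continuous_smul (by fun_prop)
      have hv : LocallyIntegrable v volume := (Lp.memLp v).locallyIntegrable (by norm_num)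
      refine ae_eq_zero_of_integral_contDiff_smul_eq_zero (hv.sub hu) ?_
      intro g g_smooth g_cpt
      have hg₁ : HasCompactSupport (Complex.ofRealCLM ∘ g) := g_cpt.comp_left rfl
      have hg₂ : ContDiff ℝ (⊤ : ℕ∞) (Complex.ofRealCLM ∘ g) :=
        Complex.ofRealCLM.contDiff.comp g_smooth
      have h1 := DFunLike.congr_fun H (hg₁.toSchwartzMap hg₂)
      rw [key, Lp.toTemperedDistribution_apply] at h1
      have hi : ∀ w : ℝ → E, LocallyIntegrable w volume → Integrable (fun x => g x • w x) volume :=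
        fun w hw => hw.integrable_smul_left_of_hasCompactSupport g_smooth.continuous g_cpt
      have hc : ∀ w : ℝ → E, ∫ x, (hg₁.toSchwartzMap hg₂) x • w x = ∫ x, g x • w x := fun w => by
        simp
      rw [hc, hc] at h1
      calc ∫ x, g x • (v x - (2 * Real.pi * Complex.I * x) • u x)
          = ∫ x, g x • v x - g x • ((2 * Real.pi * Complex.I * x) • u x) := by
            simp_rw [smul_sub]
        _ = (∫ x, g x • v x) - ∫ x, g x • ((2 * Real.pi * Complex.I * x) • u x) :=
            integral_sub (hi _ hv) (hi _ hu)
        _ = 0 := sub_eq_zero.2 h1.symm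
    filter_upwards [this] with x hx
    exact sub_eq_zero.1 hx
  · intro H
    ext ψ
    rw [key, Lp.toTemperedDistribution_apply]
    refine integral_congr_ae ?_
    filter_upwards [H] with x hx
    rw [hx]

/-- The derivative is skew-symmetric. -/
theorem inner_derivOp {g h u v : L2 E} (hg : (g, h) ∈ (derivOp E).graph)
    (hu : (u, v) ∈ (derivOp E).graph) : inner ℂ g v = -inner ℂ h u := by
  rw [← LinearIsometryEquiv.inner_map_map (Lp.fourierTransformₗᵢ ℝ E) g,
    ← LinearIsometryEquiv.inner_map_map (Lp.fourierTransformₗᵢ ℝ E) h, L2.inner_def, L2.inner_def,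
    ← integral_neg]
  refine integral_congr_ae ?_
  filter_upwards [(mem_graph_derivOp_iff_fourier g h).1 hg,
    (mem_graph_derivOp_iff_fourier u v).1 hu] with t h1 h2
  rw [h1, h2, inner_smul_left, inner_smul_right]
  simp [map_ofNat]

theorem one_add_two_pi_I_ne_zero (τ : ℝ) : (1 + 2 * Real.pi * Complex.I * τ : ℂ) ≠ 0 := by
  intro h
  have := congrArg Complex.re h
  simp at this

theorem memLp_top_of_continuous {F : Type*} [NormedAddCommGroup F] {m : ℝ → F} {C : ℝ}
    (hm : Continuous m) (hC : ∀ t, ‖m t‖ ≤ C) : MemLp m ∞ volume :=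
  memLp_top_of_bound hm.aestronglyMeasurable C (Eventually.of_forall hC)

theorem continuous_resolvent_symbol :
    Continuous fun τ : ℝ => (1 + 2 * Real.pi * Complex.I * τ : ℂ)⁻¹ :=
  Continuous.inv₀ (by fun_prop) one_add_two_pi_I_ne_zero

theorem norm_resolvent_symbol_le (τ : ℝ) : ‖(1 + 2 * Real.pi * Complex.I * τ : ℂ)⁻¹‖ ≤ 1 := by
  rw [norm_inv]
  refine inv_le_one_of_one_le₀ ?_
  have := Complex.abs_re_le_norm (1 + 2 * Real.pi * Complex.I * τ : ℂ)
  simpa using this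

theorem memLp_resolvent_symbol :
    MemLp (fun τ : ℝ => (1 + 2 * Real.pi * Complex.I * τ : ℂ)⁻¹) ∞ volume :=
  memLp_top_of_continuous continuous_resolvent_symbol norm_resolvent_symbol_le

variable (E) in
/-- The bounded operator `(1 + d/dt)⁻¹` in `L²(ℝ; E)`. -/
def derivRes : L2 E →L[ℂ] L2 E := conjF (mulL fun τ => (1 + 2 * Real.pi * Complex.I * τ)⁻¹)

/-- The graph of the derivative in terms of the bounded operator `(1 + d/dt)⁻¹`. -/
theorem mem_graph_derivOp_iff (g h : L2 E) :
    (g, h) ∈ (derivOp E).graph ↔ derivRes E (g + h) = g := by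
  rw [mem_graph_derivOp_iff_fourier, ← (Lp.fourierTransformₗᵢ ℝ E).injective.eq_iff, derivRes,
    fourier_conjF, map_add]
  generalize Lp.fourierTransformₗᵢ ℝ E g = u
  generalize Lp.fourierTransformₗᵢ ℝ E h = v
  constructor
  · intro H
    refine mulL_eq_of_ae memLp_resolvent_symbol ?_
    filter_upwards [H, Lp.coeFn_add u v] with t h1 h2
    have h3 : u t + (2 * Real.pi * Complex.I * t : ℂ) • u t =
        (1 + 2 * Real.pi * Complex.I * t : ℂ) • u t := by rw [add_smul, one_smul]
    rw [h2, Pi.add_apply, h1, h3, smul_smul, inv_mul_cancel₀ (one_add_two_pi_I_ne_zero t), one_smul]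
  · intro H
    filter_upwards [mulL_coe memLp_resolvent_symbol (u + v), Lp.coeFn_add u v] with t h1 h2
    rw [H, h2, Pi.add_apply] at h1
    have h3 : (1 + 2 * Real.pi * Complex.I * t : ℂ) • u t = u t + v t := by
      conv_lhs => rw [h1, smul_smul, mul_inv_cancel₀ (one_add_two_pi_I_ne_zero t), one_smul]
    rw [add_smul, one_smul] at h3
    exact (add_left_cancel h3).symm

theorem inner_mulL_left {m : ℝ → ℝ} (hm : MemLp (fun t => (m t : ℂ)) ∞ volume) (f g : L2 E) :
    inner ℂ (mulL (fun t => (m t : ℂ)) f) g = inner ℂ f (mulL (fun t => (m t : ℂ)) g) := by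
  rw [← ContinuousLinearMap.adjoint_inner_left, ← ContinuousLinearMap.star_eq_adjoint, star_mulL hm]
  simp

end FourierSide

/-! ### The product rule -/

section ProductRule

theorem exists_ae_bound {F : Type*} [NormedAddCommGroup F] {m : ℝ → F} (hm : MemLp m ∞ volume) :
    ∃ C : ℝ, 0 ≤ C ∧ ∀ᵐ t : ℝ, ‖m t‖ ≤ C := by
  refine ⟨(eLpNorm m ∞ volume).toReal, ENNReal.toReal_nonneg, ?_⟩
  have h := ae_le_eLpNormEssSup (f := m) (μ := volume)
  rw [← eLpNorm_exponent_top] at h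
  filter_upwards [h] with t ht
  have h2 := ENNReal.toReal_mono hm.2.ne ht
  simpa using h2

theorem continuous_of_absolutelyContinuous {η : ℝ → ℝ}
    (hac : ∀ a b : ℝ, AbsolutelyContinuousOnInterval η a b) : Continuous η := by
  rw [continuous_iff_continuousAt]
  intro x
  have h := (hac (x - 1) (x + 1)).continuousOn
  refine h.continuousAt ?_
  rw [Set.uIcc_of_le (by linarith)]
  exact Icc_mem_nhds (by linarith) (by linarith)

theorem norm_le_of_continuous_of_ae {η : ℝ → ℝ} {C : ℝ} (hη : Continuous η)
    (hC : ∀ᵐ t : ℝ, ‖η t‖ ≤ C) (t : ℝ) : ‖η t‖ ≤ C := by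
  by_contra hlt
  push Not at hlt
  have ho : IsOpen {s : ℝ | C < ‖η s‖} := isOpen_lt continuous_const hη.norm
  have h0 : volume {s : ℝ | C < ‖η s‖} = 0 := by
    rw [ae_iff] at hC
    simpa using hC
  rw [ho.measure_eq_zero_iff volume] at h0
  exact (Set.eq_empty_iff_forall_notMem.1 h0 t) hlt

theorem memLp_ofReal {η : ℝ → ℝ} (h : MemLp η ∞ volume) : MemLp (fun t => (η t : ℂ)) ∞ volume :=
  h.ofReal

/-- Integration by parts: the integral of `(η k)'` vanishes if `k` is `C¹` and decays at
infinity. -/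
theorem integral_deriv_mul_eq_zero {η : ℝ → ℝ}
    (hac : ∀ a b : ℝ, AbsolutelyContinuousOnInterval η a b) (hb : MemLp η ∞ volume)
    (hd : MemLp (deriv η) ∞ volume) {k k' : ℝ → ℝ} (hk : ∀ t, HasDerivAt k (k' t) t)
    (hk'c : Continuous k') (hki : Integrable k) (hk'i : Integrable k')
    (htop : Tendsto k atTop (𝓝 0)) (hbot : Tendsto k atBot (𝓝 0)) :
    ∫ t, (deriv η t * k t + η t * k' t) = 0 := by
  obtain ⟨C, hC0, hC⟩ := exists_ae_bound hb
  obtain ⟨C', -, hC'⟩ := exists_ae_bound hd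
  have hcont := continuous_of_absolutelyContinuous hac
  have hbd := norm_le_of_continuous_of_ae hcont hC
  have hderiv : deriv k = k' := funext fun t => (hk t).deriv
  have hk1 : ContDiff ℝ 1 k := by
    rw [contDiff_one_iff_deriv, hderiv]
    exact ⟨fun t => (hk t).differentiableAt, hk'c⟩
  have hint : Integrable fun t => deriv η t * k t + η t * k' t :=
    (hki.bdd_mul hd.1 hC').add (hk'i.bdd_mul hcont.aestronglyMeasurable hC)
  have h1 := intervalIntegral_tendsto_integral (μ := volume) hint tendsto_neg_atTop_atBot
    (tendsto_id (α := ℝ) (x := atTop))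
  have h2 : ∀ R : ℝ, ∫ t in -R..id R, (deriv η t * k t + η t * k' t) =
      η R * k R - η (-R) * k (-R) := by
    intro R
    have := (hac (-R) R).integral_deriv_mul_eq_sub
      (hk1.contDiffOn.absolutelyContinuousOnInterval (a := -R) (b := R))
    rwa [hderiv] at this
  simp_rw [h2] at h1
  refine tendsto_nhds_unique h1 ?_
  have hz : ∀ {u : ℝ → ℝ}, Tendsto (fun R => k (u R)) atTop (𝓝 0) →
      Tendsto (fun R => η (u R) * k (u R)) atTop (𝓝 0) := by
    intro u hu
    refine squeeze_zero_norm (a := fun R => C * ‖k (u R)‖) (fun R => ?_) ?_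
    · rw [norm_mul]
      exact mul_le_mul_of_nonneg_right (hbd _) (norm_nonneg _)
    · simpa using hu.norm.const_mul C
  simpa using (hz (u := id) htop).sub (hz (u := fun R => -R) (hbot.comp tendsto_neg_atTop_atBot))

variable {E : Type*} [NormedAddCommGroup E] [InnerProductSpace ℂ E] [CompleteSpace E]

omit [CompleteSpace E] in
theorem hasDerivAt_schwartz (K : SchwartzMap ℝ E) (t : ℝ) :
    HasDerivAt K ((∂_{(1 : ℝ)} K : SchwartzMap ℝ E) t) t := by
  rw [SchwartzMap.lineDerivOp_apply_eq_fderiv]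
  exact (K.differentiableAt (x := t)).hasFDerivAt.hasDerivAt

theorem integral_deriv_smul_schwartz {η : ℝ → ℝ}
    (hac : ∀ a b : ℝ, AbsolutelyContinuousOnInterval η a b) (hb : MemLp η ∞ volume)
    (hd : MemLp (deriv η) ∞ volume) (K : SchwartzMap ℝ E) :
    ∫ t, (deriv η t • K t + η t • (∂_{(1 : ℝ)} K : SchwartzMap ℝ E) t) = 0 := by
  obtain ⟨C, hC0, hC⟩ := exists_ae_bound hb
  obtain ⟨C', -, hC'⟩ := exists_ae_bound hd
  have hint : Integrable fun t => deriv η t • K t + η t • (∂_{(1 : ℝ)} K : SchwartzMap ℝ E) t :=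
    (K.integrable.bdd_smul (𝕜 := ℝ) (φ := deriv η) _ hd.1 hC').add
      ((∂_{(1 : ℝ)} K : SchwartzMap ℝ E).integrable.bdd_smul (𝕜 := ℝ) (φ := η) _ hb.1 hC)
  rw [SeparatingDual.eq_zero_iff_forall_dual_eq_zero (R := ℝ)]
  intro L
  rw [← L.integral_comp_comm hint]
  have hz : Tendsto (fun t => L (K t)) (cocompact ℝ) (𝓝 0) := by
    have := (L.continuous.tendsto 0).comp (K.toZeroAtInfty.zero_at_infty')
    simpa [Function.comp_def] using this
  have h := integral_deriv_mul_eq_zero hac hb hd (k := fun t => L (K t))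
    (k' := fun t => L ((∂_{(1 : ℝ)} K : SchwartzMap ℝ E) t))
    (fun t => L.hasFDerivAt.comp_hasDerivAt t (hasDerivAt_schwartz K t))
    (L.continuous.comp (SchwartzMap.continuous _)) (L.integrable_comp K.integrable)
    (L.integrable_comp (SchwartzMap.integrable _))
    (hz.mono_left atTop_le_cocompact) (hz.mono_left atBot_le_cocompact)
  rw [← h]
  simp

/-- The product rule for `η f` with a Schwartz function `f`. -/
theorem schwartz_mem_graph_derivOp {η : ℝ → ℝ}
    (hac : ∀ a b : ℝ, AbsolutelyContinuousOnInterval η a b) (hb : MemLp η ∞ volume)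
    (hd : MemLp (deriv η) ∞ volume) (f : SchwartzMap ℝ E) :
    (mulL (fun t => (η t : ℂ)) (f.toLp 2), mulL (fun t => ((deriv η t : ℝ) : ℂ)) (f.toLp 2) +
      mulL (fun t => (η t : ℂ)) ((∂_{(1 : ℝ)} f : SchwartzMap ℝ E).toLp 2)) ∈
        (derivOp E).graph := by
  rw [mem_graph_derivOp]
  ext ψ
  rw [TemperedDistribution.lineDerivOp_apply_apply, Lp.toTemperedDistributionCLM_apply,
    Lp.toTemperedDistributionCLM_apply]
  rw [map_neg, Lp.toTemperedDistribution_apply, Lp.toTemperedDistribution_apply, ← integral_neg,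
    ← sub_eq_zero]
  have hψ : (ψ : ℝ → ℂ).HasTemperateGrowth := ψ.hasTemperateGrowth
  have hK := integral_deriv_smul_schwartz hac hb hd (SchwartzMap.smulLeftCLM E ψ f)
  have hK' : ∀ t, (∂_{(1 : ℝ)} (SchwartzMap.smulLeftCLM E ψ f) : SchwartzMap ℝ E) t =
      ψ t • (∂_{(1 : ℝ)} f : SchwartzMap ℝ E) t + (∂_{(1 : ℝ)} ψ : SchwartzMap ℝ ℂ) t • f t := by
    intro t
    have h1 := (hasDerivAt_schwartz ψ t).smul (hasDerivAt_schwartz f t)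
    have h2 := hasDerivAt_schwartz (SchwartzMap.smulLeftCLM E ψ f) t
    refine h2.unique ?_
    convert h1 using 1
    funext s
    exact SchwartzMap.smulLeftCLM_apply_apply hψ f s
  have hiL : ∀ (ρ : SchwartzMap ℝ ℂ) (w : L2 E), Integrable fun t => ρ t • w t := fun ρ w =>
    memLp_one_iff_integrable.1 ((Lp.memLp w).smul (r := 1) (ρ.memLp 2 volume))
  refine (integral_sub (hiL _ _).neg (hiL _ _)).symm.trans ?_
  rw [← neg_eq_zero, ← integral_neg, ← hK]
  refine integral_congr_ae ?_
  filter_upwards [mulL_coe (memLp_ofReal hb) (f.toLp 2),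
    mulL_coe (memLp_ofReal hd) (f.toLp 2),
    mulL_coe (memLp_ofReal hb) ((∂_{(1 : ℝ)} f : SchwartzMap ℝ E).toLp 2),
    Lp.coeFn_add (mulL (fun t => ((deriv η t : ℝ) : ℂ)) (f.toLp 2))
      (mulL (fun t => (η t : ℂ)) ((∂_{(1 : ℝ)} f : SchwartzMap ℝ E).toLp 2)),
    f.coeFn_toLp 2 volume, (∂_{(1 : ℝ)} f : SchwartzMap ℝ E).coeFn_toLp 2 volume]
    with t h1 h2 h3 h4 h5 h6
  rw [Pi.neg_apply, h4, Pi.add_apply, h1, h2, h3, h5, h6, hK',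
    SchwartzMap.smulLeftCLM_apply_apply hψ]
  simp only [← Complex.coe_smul, smul_add, smul_smul]
  module

/-- The tempered distribution of `w ∈ L²(ℝ; E)` in terms of inner products with Schwartz
functions. -/
theorem inner_toTemperedDistribution (e : E) (w : L2 E) (ψ : SchwartzMap ℝ ℂ) :
    inner ℂ e ((w : TemperedDistribution ℝ E) ψ) =
      inner ℂ ((ψ.postcompCLM (𝕜 := ℝ) (((ContinuousLinearMap.toSpanSingleton ℂ e).restrictScalars
        ℝ).comp (Complex.conjCLE : ℂ →L[ℝ] ℂ))).toLp 2 : L2 E) w := by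
  have hi : Integrable fun t => ψ t • w t :=
    memLp_one_iff_integrable.1 ((Lp.memLp w).smul (r := 1) (ψ.memLp 2 volume))
  rw [Lp.toTemperedDistribution_apply, ← integral_inner hi, L2.inner_def]
  refine integral_congr_ae ?_
  filter_upwards [(ψ.postcompCLM (𝕜 := ℝ) (((ContinuousLinearMap.toSpanSingleton ℂ
    e).restrictScalars ℝ).comp (Complex.conjCLE : ℂ →L[ℝ] ℂ))).coeFn_toLp 2 volume] with t h
  rw [h, SchwartzMap.postcompCLM_apply]
  simp [inner_smul_left, inner_smul_right]

/-- The product rule for a bounded, locally absolutely continuous function `η` with bounded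
derivative: multiplication by `η` preserves `W^{1,2}(ℝ; E)`. It is obtained from the product rule
for Schwartz functions by duality, as the derivative is skew-symmetric. -/
theorem mul_mem_graph_derivOp {η : ℝ → ℝ}
    (hac : ∀ a b : ℝ, AbsolutelyContinuousOnInterval η a b) (hb : MemLp η ∞ volume)
    (hd : MemLp (deriv η) ∞ volume) {g h : L2 E} (hg : (g, h) ∈ (derivOp E).graph) :
    (mulL (fun t => (η t : ℂ)) g, mulL (fun t => ((deriv η t : ℝ) : ℂ)) g +
      mulL (fun t => (η t : ℂ)) h) ∈ (derivOp E).graph := by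
  rw [mem_graph_derivOp]
  ext ψ
  rw [TemperedDistribution.lineDerivOp_apply_apply, Lp.toTemperedDistributionCLM_apply,
    Lp.toTemperedDistributionCLM_apply]
  refine ext_inner_left ℂ fun e => ?_
  set L : ℂ →L[ℝ] E := ((ContinuousLinearMap.toSpanSingleton ℂ e).restrictScalars ℝ).comp
    (Complex.conjCLE : ℂ →L[ℝ] ℂ) with hL
  rw [map_neg, inner_neg_right, inner_toTemperedDistribution, inner_toTemperedDistribution, ← hL]
  have hder : (∂_{(1 : ℝ)} ψ : SchwartzMap ℝ ℂ).postcompCLM (𝕜 := ℝ) L =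
      ∂_{(1 : ℝ)} (ψ.postcompCLM (𝕜 := ℝ) L) := by
    ext t
    refine HasDerivAt.unique ?_ (hasDerivAt_schwartz (ψ.postcompCLM (𝕜 := ℝ) L) t)
    exact L.hasFDerivAt.comp_hasDerivAt t (hasDerivAt_schwartz ψ t)
  have h1 := inner_derivOp (schwartz_mem_graph_derivOp hac hb hd (ψ.postcompCLM (𝕜 := ℝ) L)) hg
  rw [hder, inner_add_right, ← inner_mulL_left (memLp_ofReal hb),
    ← inner_mulL_left (memLp_ofReal hd), ← inner_mulL_left (memLp_ofReal hb), h1, inner_add_left]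
  ring

end ProductRule

/-! ### Resolvents of nonnegative operators -/

section AbstractResolvent

variable {H : Type*} [NormedAddCommGroup H] [InnerProductSpace ℂ H]

/-- The quadratic form of `T` takes values in `[0, ∞)`. -/
def NonnegForm (T : H →ₗ.[ℂ] H) : Prop :=
  ∀ u w, (u, w) ∈ T.graph → ∃ r : ℝ, 0 ≤ r ∧ inner ℂ u w = (r : ℂ)

/-- The numerical range of a nonnegative operator bounds `T - z` below by the distance of `z` from
`[0, ∞)`. -/
theorem NonnegForm.le_norm {T : H →ₗ.[ℂ] H} (hT : NonnegForm T) {z : ℂ} {d : ℝ}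
    (hd : ∀ r : ℝ, 0 ≤ r → d ≤ ‖(r : ℂ) - z‖) {u w : H} (h : (u, w) ∈ T.graph) :
    d * ‖u‖ ≤ ‖w - z • u‖ := by
  rcases eq_or_ne u 0 with rfl | hu
  · simp
  obtain ⟨r, hr, hrw⟩ := hT u w h
  have hu' : 0 < ‖u‖ := norm_pos_iff.2 hu
  have h1 : inner ℂ u (w - z • u) = ((‖u‖ ^ 2 : ℝ) : ℂ) * (((r / ‖u‖ ^ 2 : ℝ) : ℂ) - z) := by
    have h0 : (‖u‖ : ℂ) ≠ 0 := by exact_mod_cast hu'.ne'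
    rw [inner_sub_right, inner_smul_right, hrw, inner_self_eq_norm_sq_to_K]
    push_cast
    field_simp
    rfl
  have h2 : ‖u‖ ^ 2 * d ≤ ‖u‖ * ‖w - z • u‖ := by
    calc ‖u‖ ^ 2 * d ≤ ‖u‖ ^ 2 * ‖((r / ‖u‖ ^ 2 : ℝ) : ℂ) - z‖ :=
          mul_le_mul_of_nonneg_left (hd _ (by positivity)) (by positivity)
      _ = ‖inner ℂ u (w - z • u)‖ := by
          rw [h1, norm_mul, Complex.norm_real, Real.norm_of_nonneg (by positivity)]
      _ ≤ ‖u‖ * ‖w - z • u‖ := norm_inner_le_norm _ _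
  nlinarith

variable [CompleteSpace H]

theorem exists_inverse_one_add {K : H →L[ℂ] H} (hK : ‖K‖ ≤ 1 / 2) :
    ∃ M : H →L[ℂ] H, (1 + K) * M = 1 ∧ M * (1 + K) = 1 ∧ ‖M‖ ≤ 2 := by
  have hu : IsUnit (1 + K) := by
    have := isUnit_one_sub_of_norm_lt_one (x := -K) (by rw [norm_neg]; linarith)
    rwa [sub_neg_eq_add] at this
  obtain ⟨M, hM1, hM2⟩ := isUnit_iff_exists.1 hu
  refine ⟨M, hM1, hM2, ?_⟩
  have h1 : M = 1 - K * M := by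
    rw [← hM1]
    noncomm_ring
  have h2 : ‖M‖ ≤ 1 + 1 / 2 * ‖M‖ := by
    calc ‖M‖ = ‖1 - K * M‖ := by rw [← h1]
      _ ≤ ‖(1 : H →L[ℂ] H)‖ + ‖K * M‖ := norm_sub_le _ _
      _ ≤ 1 + 1 / 2 * ‖M‖ := add_le_add ContinuousLinearMap.norm_id_le
          ((norm_mul_le _ _).trans (mul_le_mul_of_nonneg_right hK (norm_nonneg _)))
  linarith

open scoped ComplexOrder in
/-- If `R` is positive with `‖R‖ ≤ 1/e` then `1 - (z + e) R` is invertible for `z ∉ [0, ∞)`, by the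
spectral mapping `λ ↦ 1/(λ + e)`. -/
theorem isUnit_one_sub_smul {R : H →L[ℂ] H} {e : ℝ} (he : 0 < e) (hR : 0 ≤ R)
    (hRn : ‖R‖ ≤ 1 / e) {z : ℂ} (hz : ∀ r : ℝ, 0 ≤ r → z ≠ r) :
    IsUnit (1 - (z + e) • R) := by
  rcases eq_or_ne (z + e) 0 with h0 | h0
  · rw [h0, zero_smul, sub_zero]
    exact isUnit_one
  have hns : (z + e)⁻¹ ∉ spectrum ℂ R := by
    intro hmem
    have h1 : 0 ≤ (z + e)⁻¹ := spectrum_nonneg_of_nonneg hR hmem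
    have h2 : ‖(z + e)⁻¹‖ ≤ 1 / e :=
      (spectrum.norm_le_norm_mul_of_mem hmem).trans
        ((mul_le_of_le_one_right (norm_nonneg _) ContinuousLinearMap.norm_id_le).trans hRn)
    obtain ⟨hre, him⟩ := Complex.nonneg_iff.1 h1
    set x : ℝ := ((z + e)⁻¹).re with hx
    have hxe : (z + e)⁻¹ = (x : ℂ) := Complex.ext rfl (by simpa using him.symm)
    rw [hxe, Complex.norm_real, Real.norm_of_nonneg hre] at h2
    have hx0 : x ≠ 0 := fun h => by
      rw [h] at hxe
      exact inv_ne_zero h0 (by simpa using hxe)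
    have hxp : 0 < x := lt_of_le_of_ne hre hx0.symm
    have hz' : z = ((x⁻¹ - e : ℝ) : ℂ) := by
      have : z + e = ((x⁻¹ : ℝ) : ℂ) := by rw [← inv_inv (z + e), hxe]; push_cast; rfl
      push_cast
      rw [← Complex.ofReal_inv, ← this]
      ring
    refine hz (x⁻¹ - e) ?_ hz'
    rw [sub_nonneg, ← one_div, le_div_iff₀ hxp]
    rw [le_div_iff₀ he] at h2
    linarith
  rw [spectrum.notMem_iff] at hns
  have h3 : 1 - (z + e) • R = (z + e) • (algebraMap ℂ (H →L[ℂ] H) (z + e)⁻¹ - R) := by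
    rw [smul_sub, Algebra.algebraMap_eq_smul_one, smul_smul, mul_inv_cancel₀ h0, one_smul]
  rw [h3]
  rw [← algebraMap_smul (H →L[ℂ] H) (z + (e : ℂ)), smul_eq_mul]
  exact ((Units.mk0 _ h0).isUnit.map (algebraMap ℂ (H →L[ℂ] H))).mul hns

/-- A nonnegative operator `T` with `(T + e) S = 1 + K`, where `‖K‖ ≤ 1/2`, has the resolvent `S G`
at `z ∉ [0, ∞)`, where `G = (1 + K - (z + e) S)⁻¹` is bounded in terms of `z` and `e`. -/
theorem NonnegForm.exists_resolvent {T : H →ₗ.[ℂ] H} (hT : NonnegForm T) {S K : H →L[ℂ] H}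
    {e : ℝ} (he : 0 < e) (hK : ‖K‖ ≤ 1 / 2)
    (hS : ∀ f, (S f, f + K f - (e : ℂ) • S f) ∈ T.graph) {z : ℂ} {d : ℝ} (hd : 0 < d)
    (hdz : ∀ r : ℝ, 0 ≤ r → d ≤ ‖(r : ℂ) - z‖) :
    ∃ G : H →L[ℂ] H, IsResolventAt T z (S * G) ∧ (1 + K - (z + e) • S) * G = 1 ∧
      G * (1 + K - (z + e) • S) = 1 ∧ ‖G‖ ≤ 2 * (1 + ‖z + e‖ / d) := by
  obtain ⟨M, hM1, hM2, hMn⟩ := exists_inverse_one_add hK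
  -- `R` turns out to be `(T + e)⁻¹`
  set R := S * M with hR
  have hz : ∀ r : ℝ, 0 ≤ r → z ≠ r := by
    rintro r hr rfl
    have := hdz r hr
    rw [sub_self, norm_zero] at this
    linarith
  have hRg : ∀ f, (R f, f - (e : ℂ) • R f) ∈ T.graph := by
    intro f
    have h1 := hS (M f)
    have h2 : M f + K (M f) = f := DFunLike.congr_fun hM1 f
    rwa [h2] at h1
  have hRn : ‖R‖ ≤ 1 / e := by
    refine ContinuousLinearMap.opNorm_le_bound _ (by positivity) fun f => ?_
    have h1 := hT.le_norm (z := -e) (d := e) (fun r hr => by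
      rw [sub_neg_eq_add, ← Complex.ofReal_add, Complex.norm_real,
        Real.norm_of_nonneg (by positivity)]
      linarith) (hRg f)
    have h2 : f - (e : ℂ) • R f - -(e : ℂ) • R f = f := by module
    rw [h2] at h1
    rw [one_div, inv_mul_eq_div, le_div_iff₀ he]
    linarith
  have hRp : 0 ≤ R := by
    rw [ContinuousLinearMap.nonneg_iff_isPositive, ContinuousLinearMap.isPositive_iff_complex]
    intro f
    obtain ⟨r, hr, hrf⟩ := hT _ _ (hRg f)
    have h1 : inner ℂ (R f) f = ((r + e * ‖R f‖ ^ 2 : ℝ) : ℂ) := by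
      rw [inner_sub_right, inner_smul_right, inner_self_eq_norm_sq_to_K, sub_eq_iff_eq_add] at hrf
      rw [hrf]
      push_cast
      rfl
    rw [h1]
    rw [RCLike.re_eq_complex_re, Complex.ofReal_re]
    exact ⟨rfl, by positivity⟩
  obtain ⟨N, hN1, hN2⟩ := isUnit_iff_exists.1 (isUnit_one_sub_smul he hRp hRn hz)
  have hQ : 1 + K - (z + e) • S = (1 - (z + e) • R) * (1 + K) := by
    have : S = R * (1 + K) := by rw [hR, mul_assoc, hM2, mul_one]
    rw [sub_mul, one_mul, smul_mul_assoc, ← this]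
  have hG1 : (1 + K - (z + e) • S) * (M * N) = 1 := by
    rw [hQ, mul_assoc, ← mul_assoc (1 + K) M N, hM1, one_mul, hN1]
  have hG2 : M * N * (1 + K - (z + e) • S) = 1 := by
    rw [hQ, mul_assoc, ← mul_assoc N, hN2, one_mul, hM2]
  have hgr : ∀ f, ((S * (M * N)) f, f + z • (S * (M * N)) f) ∈ T.graph := by
    intro f
    have h1 := hS ((M * N) f)
    have h2 : (M * N) f + K ((M * N) f) - (z + e) • S ((M * N) f) = f := DFunLike.congr_fun hG1 f
    have h3 : (M * N) f + K ((M * N) f) - (e : ℂ) • S ((M * N) f) =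
        f + z • S ((M * N) f) := by
      linear_combination (norm := module) h2
    rwa [h3] at h1
  refine ⟨M * N, ⟨fun f => ?_, fun u => ?_⟩, hG1, hG2, ?_⟩
  · obtain ⟨u, hu1, hu2⟩ := (LinearPMap.mem_graph_iff T).1 (hgr f)
    exact ⟨u, hu1, by rw [hu2, hu1]; exact add_sub_cancel_right _ _⟩
  · have h1 := T.graph.sub_mem (hgr (T u - z • (u : H))) (T.mem_graph u)
    have h2 := hT.le_norm hdz h1
    have h3 : T u - z • (u : H) + z • (S * (M * N)) (T u - z • (u : H)) - T u -
        z • ((S * (M * N)) (T u - z • (u : H)) - (u : H)) = 0 := by module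
    rw [h3, norm_zero] at h2
    have h4 : ‖(S * (M * N)) (T u - z • (u : H)) - (u : H)‖ ≤ 0 := by
      by_contra hlt
      push Not at hlt
      nlinarith
    exact sub_eq_zero.1 (norm_le_zero_iff.1 h4)
  · have hSG : ‖S * (M * N)‖ ≤ 1 / d := by
      refine ContinuousLinearMap.opNorm_le_bound _ (by positivity) fun f => ?_
      have h1 := hT.le_norm hdz (hgr f)
      rw [add_sub_cancel_right] at h1
      rw [one_div, inv_mul_eq_div, le_div_iff₀ hd]
      linarith
    have h1 : M * N = M * (1 + (z + e) • (S * (M * N))) := by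
      have h2 : (1 + K) * (M * N) = 1 + (z + e) • (S * (M * N)) := by
        rw [sub_mul, smul_mul_assoc, sub_eq_iff_eq_add] at hG1
        exact hG1
      rw [← h2, ← mul_assoc, hM2, one_mul]
    rw [h1]
    refine (norm_mul_le _ _).trans (mul_le_mul hMn ?_ (norm_nonneg _) (by norm_num))
    refine (norm_add_le _ _).trans (add_le_add ContinuousLinearMap.norm_id_le ?_)
    refine (norm_smul_le _ _).trans ?_
    rw [div_eq_mul_one_div]
    exact mul_le_mul_of_nonneg_left hSG (norm_nonneg _)

/-- `S K` is self-adjoint if `(T + e) S = 1 + K` for a nonnegative `T` and `S` is self-adjoint. -/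
theorem NonnegForm.star_mul_eq {T : H →ₗ.[ℂ] H} (hT : NonnegForm T) {S K : H →L[ℂ] H}
    {e : ℝ} (hS : ∀ f, (S f, f + K f - (e : ℂ) • S f) ∈ T.graph) (hSs : star S = S) :
    star K * S = S * K := by
  have hSa : ContinuousLinearMap.adjoint S = S := hSs
  have hsa : IsSelfAdjoint (S * (1 + K - (e : ℂ) • S)) := by
    rw [ContinuousLinearMap.isSelfAdjoint_iff_isSymmetric,
      LinearMap.isSymmetric_iff_inner_map_self_real]
    intro f
    obtain ⟨r, -, hr⟩ := hT _ _ (hS f)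
    have h1 : inner ℂ ((S * (1 + K - (e : ℂ) • S)) f) f = (r : ℂ) := by
      have h2 : inner ℂ f ((S * (1 + K - (e : ℂ) • S)) f) = (r : ℂ) := by
        rw [← hr, ← hSa, ContinuousLinearMap.adjoint_inner_left, hSa]
        rfl
      rw [← inner_conj_symm, h2, Complex.conj_ofReal]
    change starRingEnd ℂ (inner ℂ ((S * (1 + K - (e : ℂ) • S)) f) f) =
      inner ℂ ((S * (1 + K - (e : ℂ) • S)) f) f
    rw [h1, Complex.conj_ofReal]
  have h3 := hsa.star_eq
  simp only [star_mul, star_sub, star_add, star_smul, hSs, mul_sub, mul_add, mul_one,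
    mul_smul_comm] at h3
  have h4 : star (e : ℂ) = e := Complex.conj_ofReal e
  rw [h4] at h3
  exact add_left_cancel (sub_left_injective h3)

/-- If `S G` is the resolvent at `z` and `S G'` is the resolvent at `z̄`, then `(S G')* = S G`. -/
theorem star_inverse_mul {S K G G' : H →L[ℂ] H} {c : ℂ} (hSK : star K * S = S * K)
    (hSs : star S = S) (hG : (1 + K - c • S) * G = 1)
    (hG' : (1 + K - star c • S) * G' = 1) : star G' * S = S * G := by
  have h1 : star G' * (1 + star K - c • S) = 1 := by
    have := congrArg star hG'
    simpa [hSs] using this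
  have h2 : (1 + star K - c • S) * S = S * (1 + K - c • S) := by
    simp only [sub_mul, add_mul, one_mul, hSK, smul_mul_assoc, mul_sub, mul_add, mul_one,
      mul_smul_comm]
  calc star G' * S = star G' * (S * ((1 + K - c • S) * G)) := by rw [hG, mul_one]
    _ = star G' * ((1 + star K - c • S) * S) * G := by rw [h2]; simp only [mul_assoc]
    _ = S * G := by rw [← mul_assoc, h1, one_mul]

/-- Strong convergence of adjoints passes to the inverses of a bounded sequence. -/
theorem tendsto_star_inverse {Q G : ℕ → H →L[ℂ] H} {Q' G' : H →L[ℂ] H} {C : ℝ}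
    (hG : ∀ n, Q n * G n = 1) (hG' : G' * Q' = 1) (hC : ∀ n, ‖G n‖ ≤ C)
    (hQ : ∀ f, Tendsto (fun n => star (Q n) f) atTop (𝓝 (star Q' f))) (f : H) :
    Tendsto (fun n => star (G n) f) atTop (𝓝 (star G' f)) := by
  have h1 : ∀ n, star (G n) f - star G' f =
      star (G n) (star Q' (star G' f) - star (Q n) (star G' f)) := by
    intro n
    have h2 : star (G n) * star (Q n) = 1 := by rw [← star_mul, hG, star_one]
    have h3 : star Q' * star G' = 1 := by rw [← star_mul, hG', star_one]
    have h4 : star Q' (star G' f) = f := DFunLike.congr_fun h3 f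
    have h5 : star (G n) (star (Q n) (star G' f)) = star G' f := DFunLike.congr_fun h2 _
    rw [map_sub, h4, h5]
  rw [tendsto_iff_norm_sub_tendsto_zero]
  have h6 : Tendsto (fun n => C * ‖star (Q n) (star G' f) - star Q' (star G' f)‖) atTop (𝓝 0) := by
    simpa using ((tendsto_iff_norm_sub_tendsto_zero.1 (hQ (star G' f))).const_mul C)
  refine squeeze_zero (fun _ => norm_nonneg _) (fun n => ?_) h6
  rw [h1, norm_sub_rev (star (Q n) (star G' f))]
  exact (star (G n)).le_of_opNorm_le ((norm_star _).le.trans (hC n)) _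

omit [CompleteSpace H] in
theorem tendsto_mul_of_strong {A B : ℕ → H →L[ℂ] H} {A' B' : H →L[ℂ] H} {C : ℝ}
    (hA : ∀ f, Tendsto (fun n => A n f) atTop (𝓝 (A' f)))
    (hB : ∀ f, Tendsto (fun n => B n f) atTop (𝓝 (B' f))) (hC : ∀ n, ‖A n‖ ≤ C) (f : H) :
    Tendsto (fun n => (A n * B n) f) atTop (𝓝 ((A' * B') f)) := by
  have h1 : ∀ n, (A n * B n) f = A n (B n f - B' f) + A n (B' f) := by
    intro n
    rw [map_sub, sub_add_cancel]
    rfl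
  simp_rw [h1]
  have h2 : Tendsto (fun n => A n (B n f - B' f)) atTop (𝓝 0) := by
    refine squeeze_zero_norm (a := fun n => C * ‖B n f - B' f‖) (fun n => ?_) ?_
    · exact (A n).le_of_opNorm_le (hC n) _
    · simpa using ((tendsto_iff_norm_sub_tendsto_zero.1 (hB f)).const_mul C)
  simpa using h2.add (hA (B' f))

end AbstractResolvent

/-! ### Hilbert–Schmidt operators and the trace norm -/

section TraceNorm

variable {H : Type*} [NormedAddCommGroup H] [InnerProductSpace ℂ H]

/-- The square of the Hilbert–Schmidt norm, with values in `[0, ∞]`. -/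
def hsq (T : H →L[ℂ] H) : ℝ≥0∞ :=
  ⨆ (s : Finset H) (_ : Orthonormal ℂ (fun e : s => (e : H))), ∑ e ∈ s, ENNReal.ofReal (‖T e‖ ^ 2)

variable [CompleteSpace H]

omit [CompleteSpace H] in
theorem tsum_norm_sq_hilbertBasis {ι : Type*} (b : HilbertBasis ι ℂ H) (x : H) :
    ∑' i, ENNReal.ofReal (‖inner ℂ (b i) x‖ ^ 2) = ENNReal.ofReal (‖x‖ ^ 2) := by
  have h : HasSum (fun i => ‖inner ℂ (b i) x‖ ^ 2) (‖x‖ ^ 2) := by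
    have h1 := b.hasSum_inner_mul_inner x x
    have h2 : ∀ i, inner ℂ x (b i) * inner ℂ (b i) x = ((‖inner ℂ (b i) x‖ ^ 2 : ℝ) : ℂ) := by
      intro i
      rw [← inner_conj_symm, RCLike.conj_mul]
      norm_cast
    simp_rw [h2] at h1
    rw [inner_self_eq_norm_sq_to_K] at h1
    have h3 : HasSum (fun i => ((‖inner ℂ (b i) x‖ ^ 2 : ℝ) : ℂ)) ((‖x‖ ^ 2 : ℝ) : ℂ) := by
      rw [Complex.ofReal_pow ‖x‖]
      exact h1
    exact Complex.hasSum_ofReal.1 h3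
  rw [← ENNReal.ofReal_tsum_of_nonneg (fun _ => by positivity) h.summable, h.tsum_eq]

theorem tsum_hilbertBasis_adjoint {ι κ : Type*} (b : HilbertBasis ι ℂ H) (c : HilbertBasis κ ℂ H)
    (T : H →L[ℂ] H) : ∑' i, ENNReal.ofReal (‖T (b i)‖ ^ 2) =
      ∑' j, ENNReal.ofReal (‖star T (c j)‖ ^ 2) := by
  simp_rw [← tsum_norm_sq_hilbertBasis c (T _), ← tsum_norm_sq_hilbertBasis b (star T _)]
  rw [ENNReal.tsum_comm]
  refine tsum_congr fun j => tsum_congr fun i => ?_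
  rw [ContinuousLinearMap.star_eq_adjoint, ← inner_conj_symm,
    ← ContinuousLinearMap.adjoint_inner_right, RCLike.norm_conj]

/-- The Hilbert–Schmidt norm can be computed in any Hilbert basis. -/
theorem hsq_eq_tsum {ι : Type*} (b : HilbertBasis ι ℂ H) (T : H →L[ℂ] H) :
    hsq T = ∑' i, ENNReal.ofReal (‖T (b i)‖ ^ 2) := by
  classical
  apply le_antisymm
  · refine iSup₂_le fun s hs => ?_
    have hs' : Orthonormal ℂ (Subtype.val : ↥(s : Set H) → H) := hs
    obtain ⟨w, c, hsw, hc⟩ := hs'.exists_hilbertBasis_extension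
    rw [tsum_hilbertBasis_adjoint b c, ← tsum_hilbertBasis_adjoint c c, hc,
      ← Finset.sum_coe_sort s]
    let f : s → w := fun e => ⟨e, hsw e.2⟩
    have hf : Function.Injective f := fun x y hxy => by
      have := congrArg (fun z : w => (z : H)) hxy
      exact Subtype.ext this
    rw [← tsum_fintype (L := .unconditional _)]
    exact ENNReal.tsum_comp_le_tsum_of_injective hf fun e : w => ENNReal.ofReal (‖T e‖ ^ 2)
  · rw [ENNReal.tsum_eq_iSup_sum]
    refine iSup_le fun t => ?_
    have hinj : Function.Injective b := b.orthonormal.linearIndependent.injective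
    refine le_trans (le_of_eq ?_) (le_iSup₂_of_le (t.image b) ?_ le_rfl)
    · rw [Finset.sum_image fun i _ j _ h => hinj h]
    · have h1 := b.orthonormal.toSubtypeRange
      refine h1.comp (fun e : (t.image b : Finset H) => ⟨e, ?_⟩) ?_
      · obtain ⟨i, -, hi⟩ := Finset.mem_image.1 e.2
        exact ⟨i, hi⟩
      · intro x y hxy
        exact Subtype.ext (congrArg (fun z : Set.range b => (z : H)) hxy)

theorem hsq_star (T : H →L[ℂ] H) : hsq (star T) = hsq T := by
  obtain ⟨w, b, -⟩ := exists_hilbertBasis ℂ H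
  rw [hsq_eq_tsum b, hsq_eq_tsum b, tsum_hilbertBasis_adjoint b b T]

omit [CompleteSpace H] in
theorem hsq_mul_le_left (L T : H →L[ℂ] H) : hsq (L * T) ≤ ENNReal.ofReal (‖L‖ ^ 2) * hsq T := by
  refine iSup₂_le fun s hs => ?_
  calc ∑ e ∈ s, ENNReal.ofReal (‖(L * T) e‖ ^ 2)
      ≤ ∑ e ∈ s, ENNReal.ofReal (‖L‖ ^ 2) * ENNReal.ofReal (‖T e‖ ^ 2) := by
        refine Finset.sum_le_sum fun e _ => ?_
        rw [← ENNReal.ofReal_mul (by positivity), ← mul_pow]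
        exact ENNReal.ofReal_le_ofReal (pow_le_pow_left₀ (norm_nonneg _) (L.le_opNorm _) 2)
    _ = ENNReal.ofReal (‖L‖ ^ 2) * ∑ e ∈ s, ENNReal.ofReal (‖T e‖ ^ 2) := by
        rw [Finset.mul_sum]
    _ ≤ _ := by
        gcongr
        exact le_iSup₂_of_le s hs le_rfl

theorem hsq_mul_le_right (T R : H →L[ℂ] H) : hsq (T * R) ≤ ENNReal.ofReal (‖R‖ ^ 2) * hsq T := by
  rw [← hsq_star, star_mul, ← hsq_star T, ← norm_star R]
  exact hsq_mul_le_left _ _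

/-- The Hilbert–Schmidt norm (`0` for operators that are not Hilbert–Schmidt). -/
def hsn (T : H →L[ℂ] H) : ℝ := Real.sqrt (hsq T).toReal

omit [CompleteSpace H] in
theorem hsn_nonneg (T : H →L[ℂ] H) : 0 ≤ hsn T := Real.sqrt_nonneg _

omit [CompleteSpace H] in
theorem sum_norm_sq_le_hsn {T : H →L[ℂ] H} (hT : hsq T < ∞) {s : Finset H}
    (hs : Orthonormal ℂ (fun e : s => (e : H))) : ∑ e ∈ s, ‖T e‖ ^ 2 ≤ hsn T ^ 2 := by
  rw [hsn, Real.sq_sqrt ENNReal.toReal_nonneg]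
  have h1 : ∑ e ∈ s, ENNReal.ofReal (‖T e‖ ^ 2) ≤ hsq T := le_iSup₂_of_le s hs le_rfl
  rw [← ENNReal.ofReal_sum_of_nonneg fun _ _ => by positivity] at h1
  exact (ENNReal.ofReal_le_iff_le_toReal hT.ne).1 h1

theorem hsq_mul_lt_top {T : H →L[ℂ] H} (hT : hsq T < ∞) (R : H →L[ℂ] H) : hsq (T * R) < ∞ :=
  (hsq_mul_le_right T R).trans_lt (ENNReal.mul_lt_top ENNReal.ofReal_lt_top hT)

theorem hsn_mul_le {T : H →L[ℂ] H} (hT : hsq T < ∞) (R : H →L[ℂ] H) {C : ℝ} (hC : ‖R‖ ≤ C) :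
    hsn (T * R) ≤ C * hsn T := by
  have hC0 : 0 ≤ C := (norm_nonneg R).trans hC
  rw [hsn, hsn, ← Real.sqrt_sq hC0, ← Real.sqrt_mul (by positivity)]
  refine Real.sqrt_le_sqrt ?_
  have h1 : hsq (T * R) ≤ ENNReal.ofReal (C ^ 2) * hsq T :=
    (hsq_mul_le_right T R).trans (by gcongr)
  have h2 := ENNReal.toReal_mono (ENNReal.mul_lt_top ENNReal.ofReal_lt_top hT).ne h1
  rwa [ENNReal.toReal_mul, ENNReal.toReal_ofReal (by positivity)] at h2

open scoped ComplexOrder in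
/-- Variational bound for the trace norm. The contractions `T (|T| + ε)⁻¹` replace the partial
isometry of the polar decomposition of `T`. -/
theorem traceNorm_le_of_forall {T : H →L[ℂ] H} {c : ℝ}
    (h : ∀ (U : H →L[ℂ] H) (s : Finset H), ‖U‖ ≤ 1 → Orthonormal ℂ (fun e : s => (e : H)) →
      ∑ e ∈ s, RCLike.re (inner ℂ (U e) (T e)) ≤ c) : traceNorm T ≤ ENNReal.ofReal c := by
  refine iSup₂_le fun s hs => ?_
  set P := CFC.abs T with hP
  have hP0 : 0 ≤ P := CFC.abs_nonneg T
  have hPp : P.IsPositive := (ContinuousLinearMap.nonneg_iff_isPositive P).1 hP0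
  have hPs : star P = P := hPp.isSelfAdjoint.star_eq
  have hPT : P * P = star T * T := CFC.abs_mul_abs T
  have hPT' : ∀ x y, inner ℂ (P x) (P y) = inner ℂ (T x) (T y) := by
    intro x y
    have h1 : ContinuousLinearMap.adjoint P = P := hPs
    rw [← ContinuousLinearMap.adjoint_inner_right, h1, ← ContinuousLinearMap.adjoint_inner_right,
      ← ContinuousLinearMap.star_eq_adjoint]
    exact congrArg (inner ℂ x) (DFunLike.congr_fun hPT y)
  have hnonneg : ∀ x, 0 ≤ RCLike.re (inner ℂ x (P x)) := fun x => by
    have := hPp.re_inner_nonneg_right x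
    exact this
  rw [← ENNReal.ofReal_sum_of_nonneg fun e _ => hnonneg e]
  refine ENNReal.ofReal_le_ofReal ?_
  -- `M = (P + ε)⁻¹`, and `⟨e, P e⟩ = ⟨T M e, T e⟩ + ε ⟨M e, P e⟩`
  have key : ∀ ε : ℝ, 0 < ε → ∑ e ∈ s, RCLike.re (inner ℂ e (P e)) ≤ c + ε * s.card := by
    intro ε hε
    have hu : IsUnit (P + algebraMap ℂ (H →L[ℂ] H) ε) := by
      have h1 : (-(ε : ℂ)) ∉ spectrum ℂ P := fun hmem => by
        have h2 : 0 ≤ -(ε : ℂ) := spectrum_nonneg_of_nonneg hP0 hmem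
        have h3 := (Complex.nonneg_iff.1 h2).1
        simp at h3
        linarith
      rw [spectrum.notMem_iff, ← IsUnit.neg_iff] at h1
      convert h1 using 1
      rw [map_neg]
      abel
    obtain ⟨M, hM1, hM2⟩ := isUnit_iff_exists.1 hu
    have hMx : ∀ x, P (M x) + (ε : ℂ) • M x = x := by
      intro x
      have h1 := DFunLike.congr_fun hM1 x
      rwa [Algebra.algebraMap_eq_smul_one] at h1
    have hMx' : ∀ x, M (P x) + (ε : ℂ) • M x = x := by
      intro x
      have h1 : M (P x + (ε : ℂ) • x) = x := by
        have h2 := DFunLike.congr_fun hM2 x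
        rwa [Algebra.algebraMap_eq_smul_one] at h2
      rwa [map_add, map_smul] at h1
    have hcomm : ∀ x, M (P x) = P (M x) := fun x =>
      add_right_cancel ((hMx' x).trans (hMx x).symm)
    have hPM : ∀ x, ‖P (M x)‖ ≤ ‖x‖ := by
      intro x
      have h1 : ‖x‖ ^ 2 = ‖P (M x)‖ ^ 2 + 2 * (ε * RCLike.re (inner ℂ (M x) (P (M x)))) +
          ‖(ε : ℂ) • M x‖ ^ 2 := by
        conv_lhs => rw [← hMx x]
        rw [norm_add_sq (𝕜 := ℂ), inner_smul_right, RCLike.re_eq_complex_re, Complex.re_ofReal_mul,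
          ← inner_conj_symm, Complex.conj_re]
      have h2 := mul_nonneg hε.le (hnonneg (M x))
      have h3 : ‖P (M x)‖ ^ 2 ≤ ‖x‖ ^ 2 := by
        rw [h1]
        nlinarith [sq_nonneg ‖(ε : ℂ) • M x‖]
      exact (pow_le_pow_iff_left₀ (norm_nonneg _) (norm_nonneg _) two_ne_zero).1 h3
    have hTM : ‖T * M‖ ≤ 1 := by
      refine ContinuousLinearMap.opNorm_le_bound _ zero_le_one fun x => ?_
      rw [one_mul]
      refine le_trans (le_of_eq ?_) (hPM x)
      have h1 := hPT' (M x) (M x)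
      rw [inner_self_eq_norm_sq_to_K, inner_self_eq_norm_sq_to_K] at h1
      have h2 : ‖P (M x)‖ ^ 2 = ‖T (M x)‖ ^ 2 := by
        have h3 : ((‖P (M x)‖ ^ 2 : ℝ) : ℂ) = ((‖T (M x)‖ ^ 2 : ℝ) : ℂ) := by
          push_cast
          exact h1
        exact Complex.ofReal_injective h3
      exact ((pow_left_inj₀ (norm_nonneg _) (norm_nonneg _) two_ne_zero).1 h2).symm
    have hbound := h (T * M) s hTM hs
    have hterm : ∀ e ∈ s, RCLike.re (inner ℂ e (P e)) ≤
        RCLike.re (inner ℂ ((T * M) e) (T e)) + ε := by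
      intro e he
      have hn : ‖e‖ = 1 := hs.1 ⟨e, he⟩
      have h1 : inner ℂ ((T * M) e) (T e) = inner ℂ (P (M e)) (P e) := (hPT' (M e) e).symm
      have h2 : inner ℂ e (P e) = inner ℂ (P (M e)) (P e) + (ε : ℂ) * inner ℂ (M e) (P e) := by
        conv_lhs => rw [← hMx e]
        rw [inner_add_left, inner_smul_left, Complex.conj_ofReal]
        rw [hMx e]
      have h3 : inner ℂ (M e) (P e) = inner ℂ (P (M e)) e := by
        have h4 : ContinuousLinearMap.adjoint P = P := hPs
        rw [← ContinuousLinearMap.adjoint_inner_left, h4]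
      have h5 : (inner ℂ (M e) (P e)).re ≤ 1 := by
        rw [h3]
        refine (Complex.re_le_norm _).trans ((norm_inner_le_norm _ _).trans ?_)
        have := hPM e
        rw [hn] at this ⊢
        linarith
      rw [h1, h2, map_add]
      simp only [RCLike.re_eq_complex_re, Complex.re_ofReal_mul]
      nlinarith
    calc ∑ e ∈ s, RCLike.re (inner ℂ e (P e))
        ≤ ∑ e ∈ s, (RCLike.re (inner ℂ ((T * M) e) (T e)) + ε) := Finset.sum_le_sum hterm
      _ = ∑ e ∈ s, RCLike.re (inner ℂ ((T * M) e) (T e)) + ε * s.card := by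
        rw [Finset.sum_add_distrib, Finset.sum_const, nsmul_eq_mul]
        ring
      _ ≤ c + ε * s.card := by linarith
  refine le_of_forall_pos_le_add fun δ hδ => ?_
  have h1 := key (δ / (s.card + 1)) (by positivity)
  have h2 : δ / (s.card + 1) * s.card ≤ δ := by
    rw [div_mul_eq_mul_div, div_le_iff₀ (by positivity)]
    nlinarith
  linarith

/-- The Cauchy–Schwarz inequality for the trace pairing of `A U` and `V B`. -/
theorem re_sum_inner_le {A B V U : H →L[ℂ] H} (hA : hsq A < ∞) (hB : hsq B < ∞)
    (hU : ‖U‖ ≤ 1) {s : Finset H} (hs : Orthonormal ℂ (fun e : s => (e : H))) :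
    ∑ e ∈ s, RCLike.re (inner ℂ (U e) ((star A * V * B) e)) ≤ ‖V‖ * (hsn A * hsn B) := by
  have h1 : ∀ e ∈ s, RCLike.re (inner ℂ (U e) ((star A * V * B) e)) ≤
      ‖V‖ * (‖(A * U) e‖ * ‖B e‖) := by
    intro e _
    have h2 : inner ℂ (U e) ((star A * V * B) e) = inner ℂ ((A * U) e) (V (B e)) := by
      rw [ContinuousLinearMap.star_eq_adjoint]
      exact ContinuousLinearMap.adjoint_inner_right A (U e) (V (B e))
    rw [h2]
    refine (RCLike.re_le_norm _).trans ((norm_inner_le_norm _ _).trans ?_)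
    have := mul_le_mul_of_nonneg_left (V.le_opNorm (B e)) (norm_nonneg ((A * U) e))
    linarith
  refine (Finset.sum_le_sum h1).trans ?_
  rw [← Finset.mul_sum]
  refine mul_le_mul_of_nonneg_left ?_ (norm_nonneg V)
  refine (Real.sum_mul_le_sqrt_mul_sqrt s _ _).trans ?_
  refine mul_le_mul ?_ ?_ (Real.sqrt_nonneg _) (hsn_nonneg A)
  · rw [← Real.sqrt_sq (hsn_nonneg A)]
    refine Real.sqrt_le_sqrt ((sum_norm_sq_le_hsn (hsq_mul_lt_top hA U) hs).trans ?_)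
    have := hsn_mul_le hA U hU
    rw [one_mul] at this
    exact pow_le_pow_left₀ (hsn_nonneg _) this 2
  · rw [← Real.sqrt_sq (hsn_nonneg B)]
    exact Real.sqrt_le_sqrt (sum_norm_sq_le_hsn hB hs)

theorem traceNorm_star_mul_le {A B V : H →L[ℂ] H} (hA : hsq A < ∞) (hB : hsq B < ∞) :
    traceNorm (star A * V * B) ≤ ENNReal.ofReal (‖V‖ * (hsn A * hsn B)) :=
  traceNorm_le_of_forall fun _ _ hU hs => re_sum_inner_le hA hB hU hs

theorem traceNorm_add_star_mul_le {A B A' B' V : H →L[ℂ] H} (hA : hsq A < ∞) (hB : hsq B < ∞)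
    (hA' : hsq A' < ∞) (hB' : hsq B' < ∞) :
    traceNorm (star A * V * B + star A' * V * B') ≤
      ENNReal.ofReal (‖V‖ * (hsn A * hsn B + hsn A' * hsn B')) := by
  refine traceNorm_le_of_forall fun U s hU hs => ?_
  rw [mul_add]
  refine le_trans (le_of_eq ?_) (add_le_add (re_sum_inner_le (V := V) hA hB hU hs)
    (re_sum_inner_le (V := V) hA' hB' hU hs))
  rw [← Finset.sum_add_distrib]
  refine Finset.sum_congr rfl fun e _ => ?_
  rw [add_apply, inner_add_right, map_add]

/-- If `W` is Hilbert–Schmidt and `Xₙ* → 0` strongly, boundedly, then `W Xₙ → 0` in the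
Hilbert–Schmidt norm: dominated convergence for `∑ ‖Xₙ* W* bᵢ‖²`. -/
theorem tendsto_hsn_mul {W : H →L[ℂ] H} (hW : hsq W < ∞) {X : ℕ → H →L[ℂ] H} {C : ℝ}
    (hC : ∀ n, ‖X n‖ ≤ C) (hX : ∀ f, Tendsto (fun n => star (X n) f) atTop (𝓝 0)) :
    Tendsto (fun n => hsn (W * X n)) atTop (𝓝 0) := by
  obtain ⟨w, b, -⟩ := exists_hilbertBasis ℂ H
  have hsum : Summable fun i => ‖star W (b i)‖ ^ 2 := by
    rw [← hsq_star, hsq_eq_tsum b] at hW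
    have := ENNReal.summable_toReal hW.ne
    simpa [ENNReal.toReal_ofReal] using this
  have h1 : ∀ n, (hsq (W * X n)).toReal = ∑' i, ‖star (X n) (star W (b i))‖ ^ 2 := by
    intro n
    rw [← hsq_star, star_mul, hsq_eq_tsum b, ENNReal.tsum_toReal_eq fun _ => ENNReal.ofReal_ne_top]
    refine tsum_congr fun i => ?_
    rw [ENNReal.toReal_ofReal (by positivity)]
    rfl
  have h2 : Tendsto (fun n => (hsq (W * X n)).toReal) atTop (𝓝 0) := by
    simp_rw [h1]
    rw [← tsum_zero (α := ℝ) (β := w)]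
    refine tendsto_tsum_of_dominated_convergence
      (bound := fun i => C ^ 2 * ‖star W (b i)‖ ^ 2) (hsum.mul_left _) (fun i => ?_)
      (Eventually.of_forall fun n i => ?_)
    · simpa using (hX (star W (b i))).norm.pow 2
    · rw [Real.norm_of_nonneg (by positivity), ← mul_pow]
      exact pow_le_pow_left₀ (norm_nonneg _)
        ((star (X n)).le_of_opNorm_le ((norm_star _).le.trans (hC n)) _) 2
  simpa [hsn] using h2.sqrt

/-- Trace norm convergence of `Lₙ* J Mₙ` for a trace class operator `J = W* V W`, if `Lₙ*` and `Mₙ*`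
converge strongly. -/
theorem tendsto_traceNorm {W V : H →L[ℂ] H} (hW : hsq W < ∞) {L M : ℕ → H →L[ℂ] H}
    {L' M' : H →L[ℂ] H} {C : ℝ} (hL : ∀ n, ‖L n‖ ≤ C) (hL' : ‖L'‖ ≤ C) (hM : ∀ n, ‖M n‖ ≤ C)
    (hM' : ‖M'‖ ≤ C) (hLt : ∀ f, Tendsto (fun n => star (L n) f) atTop (𝓝 (star L' f)))
    (hMt : ∀ f, Tendsto (fun n => star (M n) f) atTop (𝓝 (star M' f))) :
    Tendsto (fun n => traceNorm (star (W * L n) * V * (W * M n) - star (W * L') * V * (W * M')))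
      atTop (𝓝 0) := by
  have hdiff : ∀ n, star (W * L n) * V * (W * M n) - star (W * L') * V * (W * M') =
      star (W * (L n - L')) * V * (W * M n) + star (W * L') * V * (W * (M n - M')) := by
    intro n
    rw [mul_sub W, mul_sub W, star_sub]
    noncomm_ring
  have hz : ∀ {X : ℕ → H →L[ℂ] H} {X' : H →L[ℂ] H}, (∀ n, ‖X n‖ ≤ C) → ‖X'‖ ≤ C →
      (∀ f, Tendsto (fun n => star (X n) f) atTop (𝓝 (star X' f))) →
      Tendsto (fun n => hsn (W * (X n - X'))) atTop (𝓝 0) := by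
    intro X X' h1 h2 h3
    refine tendsto_hsn_mul hW (C := C + C)
      (fun n => (norm_sub_le _ _).trans (add_le_add (h1 n) h2)) fun f => ?_
    have h4 := (h3 f).sub_const (star X' f)
    rw [sub_self] at h4
    simpa [star_sub] using h4
  have h1 := hz hL hL' hLt
  have h2 := hz hM hM' hMt
  have h3 : Tendsto (fun n => ENNReal.ofReal (‖V‖ * (hsn (W * (L n - L')) * (C * hsn W) +
      hsn (W * L') * hsn (W * (M n - M'))))) atTop (𝓝 0) := by
    have := ENNReal.tendsto_ofReal (((h1.mul_const (C * hsn W)).add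
      (h2.const_mul (hsn (W * L')))).const_mul ‖V‖)
    simpa using this
  refine tendsto_of_tendsto_of_tendsto_of_le_of_le tendsto_const_nhds h3 (fun _ => zero_le)
    fun n => ?_
  rw [hdiff]
  refine (traceNorm_add_star_mul_le (hsq_mul_lt_top hW _) (hsq_mul_lt_top hW _)
    (hsq_mul_lt_top hW _) (hsq_mul_lt_top hW _)).trans (ENNReal.ofReal_le_ofReal ?_)
  refine mul_le_mul_of_nonneg_left ?_ (norm_nonneg V)
  gcongr
  · exact hsn_nonneg _
  · exact hsn_mul_le hW _ (hM n)

end TraceNorm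

/-! ### Hilbert–Schmidt operators in `L²(ℝ; E)` -/

section Tensor

variable {E : Type*} [NormedAddCommGroup E] [InnerProductSpace ℂ E] [CompleteSpace E]

/-- The elementary tensor `t ↦ e(t) x` in `L²(ℝ; E)`. -/
def tens (e : L2 ℂ) (x : E) : L2 E := (ContinuousLinearMap.toSpanSingleton ℂ x).compLpL 2 volume e

omit [CompleteSpace E] in
theorem tens_coe (e : L2 ℂ) (x : E) : ∀ᵐ t : ℝ, tens e x t = e t • x := by
  filter_upwards [(ContinuousLinearMap.toSpanSingleton ℂ x).coeFn_compLpL (p := 2) e] with t h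
  exact h

omit [CompleteSpace E] in
theorem inner_tens (e : L2 ℂ) (x : E) (f : L2 E) :
    inner ℂ (tens e x) f = inner ℂ e ((innerSL ℂ x).compLpL 2 volume f) := by
  rw [L2.inner_def, L2.inner_def]
  refine integral_congr_ae ?_
  filter_upwards [tens_coe e x, (innerSL ℂ x).coeFn_compLpL (p := 2) f] with t h1 h2
  rw [h1, h2, inner_smul_left]
  simp [mul_comm]

omit [CompleteSpace E] in
theorem inner_tens_tens (e e' : L2 ℂ) (x x' : E) :
    inner ℂ (tens e x) (tens e' x') = inner ℂ e e' * inner ℂ x x' := by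
  rw [inner_tens, mul_comm, ← inner_smul_right]
  congr 1
  refine Lp.ext ?_
  filter_upwards [(innerSL ℂ x).coeFn_compLpL (p := 2) (tens e' x'), tens_coe e' x',
    Lp.coeFn_smul (inner ℂ x x') e'] with t h1 h2 h3
  rw [h1, h2, h3]
  simp [mul_comm]

omit [CompleteSpace E] in
theorem norm_tens (e : L2 ℂ) (x : E) : ‖tens e x‖ = ‖e‖ * ‖x‖ := by
  have h := inner_tens_tens e e x x
  simp only [inner_self_eq_norm_sq_to_K] at h
  have h2 : ‖tens e x‖ ^ 2 = (‖e‖ * ‖x‖) ^ 2 := by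
    have h3 : ((‖tens e x‖ ^ 2 : ℝ) : ℂ) = (((‖e‖ * ‖x‖) ^ 2 : ℝ) : ℂ) := by
      rw [mul_pow]
      push_cast
      exact h
    exact Complex.ofReal_injective h3
  exact (pow_left_inj₀ (norm_nonneg _) (by positivity) two_ne_zero).1 h2

omit [CompleteSpace E] in
theorem tens_add (e : L2 ℂ) (x y : E) : tens e (x + y) = tens e x + tens e y := by
  refine Lp.ext ?_
  filter_upwards [tens_coe e (x + y), tens_coe e x, tens_coe e y,
    Lp.coeFn_add (tens e x) (tens e y)] with t h1 h2 h3 h4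
  rw [h1, h4, Pi.add_apply, h2, h3, smul_add]

omit [CompleteSpace E] in
theorem tens_smul (e : L2 ℂ) (c : ℂ) (x : E) : tens e (c • x) = c • tens e x := by
  refine Lp.ext ?_
  filter_upwards [tens_coe e (c • x), tens_coe e x, Lp.coeFn_smul c (tens e x)] with t h1 h2 h3
  rw [h1, h3, Pi.smul_apply, h2, smul_comm]

theorem eq_zero_of_inner_hilbertBasis {H ι : Type*} [NormedAddCommGroup H] [InnerProductSpace ℂ H]
    (b : HilbertBasis ι ℂ H) {x : H} (h : ∀ i, inner ℂ (b i) x = 0) : x = 0 := by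
  have h1 := b.hasSum_repr x
  simp only [b.repr_apply_apply, h, zero_smul] at h1
  exact h1.unique hasSum_zero

/-- Products of Hilbert bases form a Hilbert basis of `L²(ℝ; E)`. -/
theorem exists_hilbertBasis_tens {ι κ : Type*} (b : HilbertBasis ι ℂ (L2 ℂ))
    (c : HilbertBasis κ ℂ E) :
    ∃ B : HilbertBasis (ι × κ) ℂ (L2 E), ∀ p, B p = tens (b p.1) (c p.2) := by
  classical
  have horth : Orthonormal ℂ fun p : ι × κ => tens (b p.1) (c p.2) := by
    rw [orthonormal_iff_ite]
    rintro ⟨i, j⟩ ⟨i', j'⟩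
    rw [inner_tens_tens, orthonormal_iff_ite.1 b.orthonormal, orthonormal_iff_ite.1 c.orthonormal]
    by_cases h1 : i = i' <;> by_cases h2 : j = j' <;> simp [h1, h2]
  refine ⟨HilbertBasis.mkOfOrthogonalEqBot horth ?_, fun p => by
    rw [HilbertBasis.coe_mkOfOrthogonalEqBot]⟩
  rw [Submodule.eq_bot_iff]
  intro f hf
  have hperp : ∀ i j, inner ℂ (tens (b i) (c j)) f = 0 := fun i j =>
    (Submodule.mem_orthogonal _ _).1 hf _ (Submodule.subset_span ⟨(i, j), rfl⟩)
  have hj : ∀ j, (innerSL ℂ (c j)).compLpL 2 volume f = 0 := by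
    intro j
    refine eq_zero_of_inner_hilbertBasis b fun i => ?_
    rw [← inner_tens, hperp]
  have he : ∀ (e : L2 ℂ) (x : E), inner ℂ (tens e x) f = 0 := by
    intro e x
    let Te : E →ₗ[ℂ] L2 E := ⟨⟨tens e, tens_add e⟩, tens_smul e⟩
    let TL : E →L[ℂ] L2 E := Te.mkContinuous ‖e‖ fun x => (norm_tens e x).le
    have h1 := (c.hasSum_repr x).mapL TL
    have h2 := h1.mapL (innerSL ℂ f)
    have h3 : ∀ j, innerSL ℂ f (TL (c.repr x j • c j)) = 0 := by
      intro j
      have h4 : inner ℂ f (tens e (c j)) = 0 := by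
        rw [← inner_conj_symm, inner_tens, hj, inner_zero_right, map_zero]
      rw [map_smul, map_smul]
      exact (congrArg _ h4).trans (smul_zero _)
    simp only [h3] at h2
    have h5 : inner ℂ f (tens e x) = 0 := h2.unique hasSum_zero
    rw [← inner_conj_symm, h5, map_zero]
  have hx : ∀ x : E, ∀ᵐ t : ℝ, inner ℂ x (f t) = 0 := by
    intro x
    have h0 : (innerSL ℂ x).compLpL 2 volume f = 0 := by
      refine ext_inner_left ℂ fun e => ?_
      rw [← inner_tens, he, inner_zero_right]
    filter_upwards [(innerSL ℂ x).coeFn_compLpL (p := 2) f, Lp.coeFn_zero ℂ 2 (volume : Measure ℝ)]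
      with t h1 h2
    rw [h0, h2] at h1
    exact h1.symm
  -- `f` takes its values in a separable subspace, so that the null sets of `hx` can be combined
  obtain ⟨s, hs, hfs⟩ := (Lp.aestronglyMeasurable f).isSeparable_ae_range
  refine (Lp.eq_zero_iff_ae_eq_zero).2 (ae_eq_zero_of_forall_dual_of_isSeparable ℂ hs
    (fun L => ?_) hfs)
  filter_upwards [hx ((InnerProductSpace.toDual ℂ E).symm L)] with t ht
  rw [InnerProductSpace.toDual_symm_apply] at ht
  exact ht

theorem mulL_tens {m : ℝ → ℂ} (hm : MemLp m ∞ volume) (e : L2 ℂ) (x : E) :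
    mulL m (tens e x) = tens (mulL m e) x := by
  refine mulL_eq_of_ae hm ?_
  filter_upwards [tens_coe e x, tens_coe (mulL m e) x, mulL_coe hm e] with t h1 h2 h3
  rw [h2, h1, h3, smul_assoc]

theorem conjF_mulL_tens {m : ℝ → ℂ} (hm : MemLp m ∞ volume) (e : L2 ℂ) (x : E) :
    conjF (mulL m) (tens e x) = tens (conjF (mulL m) e) x := by
  rw [← (Lp.fourierTransformₗᵢ ℝ E).injective.eq_iff, fourier_conjF]
  have h : ∀ e : L2 ℂ, Lp.fourierTransformₗᵢ ℝ E (tens e x) =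
      tens (Lp.fourierTransformₗᵢ ℝ ℂ e) x := fun e => fourier_compLpL _ e
  rw [h, h, fourier_conjF, mulL_tens hm]

theorem constL_tens (T : E →L[ℂ] E) (e : L2 ℂ) (x : E) :
    constL T (tens e x) = tens e (T x) := by
  refine fib_eq_of_ae (memLp_top_const T) ?_
  filter_upwards [tens_coe e x, tens_coe e (T x)] with t h1 h2
  rw [h2, h1, map_smul]

/-- The tensor product of two Hilbert–Schmidt operators is Hilbert–Schmidt, since its squared norm
is the product of theirs. -/
theorem hsq_tensor_lt_top {v m : ℝ → ℂ} (hv : MemLp v ∞ volume) (hm : MemLp m ∞ volume)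
    {T : E →L[ℂ] E} (h1 : hsq (mulL v * conjF (mulL m) : L2 ℂ →L[ℂ] L2 ℂ) < ∞) (h2 : hsq T < ∞) :
    hsq (mulL v * conjF (mulL m) * constL T : L2 E →L[ℂ] L2 E) < ∞ := by
  obtain ⟨w, b, -⟩ := exists_hilbertBasis ℂ (L2 ℂ)
  obtain ⟨w', c, -⟩ := exists_hilbertBasis ℂ E
  obtain ⟨B, hB⟩ := exists_hilbertBasis_tens b c
  have h3 : ∀ p, (mulL v * conjF (mulL m) * constL T : L2 E →L[ℂ] L2 E) (B p) =
      tens ((mulL v * conjF (mulL m) : L2 ℂ →L[ℂ] L2 ℂ) (b p.1)) (T (c p.2)) := by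
    intro p
    change mulL v (conjF (mulL m) (constL T (B p))) = tens (mulL v (conjF (mulL m) (b p.1))) _
    rw [hB, constL_tens, conjF_mulL_tens hm, mulL_tens hv]
  rw [hsq_eq_tsum B, ENNReal.tsum_prod']
  rw [hsq_eq_tsum b] at h1
  rw [hsq_eq_tsum c] at h2
  simp_rw [h3, norm_tens, mul_pow]
  have h4 : ∀ x y : ℝ, ENNReal.ofReal (x ^ 2 * y ^ 2) =
      ENNReal.ofReal (x ^ 2) * ENNReal.ofReal (y ^ 2) :=
    fun x y => ENNReal.ofReal_mul (by positivity)
  simp_rw [h4, ENNReal.tsum_mul_left, ENNReal.tsum_mul_right]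
  exact ENNReal.mul_lt_top h1 h2

/-- For `g ∈ L¹ ∩ L²` the inverse Fourier transform in `L²` is given by the Fourier integral. -/
theorem fourierInv_coe_ae (g : L2 ℂ) (hg : Integrable g) :
    ∀ᵐ x : ℝ, (Lp.fourierTransformₗᵢ ℝ ℂ).symm g x = 𝓕⁻ (g : ℝ → ℂ) x := by
  have hcont : Continuous (𝓕⁻ (g : ℝ → ℂ)) :=
    VectorFourier.fourierIntegral_continuous Real.continuous_fourierChar (by fun_prop) hg
  have hloc : LocallyIntegrable ((Lp.fourierTransformₗᵢ ℝ ℂ).symm g) volume :=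
    (Lp.memLp _).locallyIntegrable (by norm_num)
  have h0 : ∀ᵐ x : ℝ, (Lp.fourierTransformₗᵢ ℝ ℂ).symm g x - 𝓕⁻ (g : ℝ → ℂ) x = 0 := by
    refine ae_eq_zero_of_integral_contDiff_smul_eq_zero
      (hloc.sub hcont.locallyIntegrable) fun ψ hψ hψc => ?_
    have hg₁ : HasCompactSupport (Complex.ofRealCLM ∘ ψ) := hψc.comp_left rfl
    have hg₂ : ContDiff ℝ (⊤ : ℕ∞) (Complex.ofRealCLM ∘ ψ) := Complex.ofRealCLM.contDiff.comp hψ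
    set Ψ := hg₁.toSchwartzMap hg₂ with hΨ
    have h1 : ∫ x, Ψ x • (Lp.fourierTransformₗᵢ ℝ ℂ).symm g x = ∫ x, (𝓕⁻ Ψ) x • g x := by
      rw [← Lp.toTemperedDistribution_apply, ← Lp.toTemperedDistribution_apply,
        ← TemperedDistribution.fourierInv_apply, Lp.fourierInv_toTemperedDistribution_eq]
      rfl
    have h2 : ∫ x, Ψ x • 𝓕⁻ (g : ℝ → ℂ) x = ∫ x, (𝓕⁻ Ψ) x • g x := by
      rw [SchwartzMap.fourierInv_coe]
      have h := VectorFourier.integral_fourierIntegral_smul_eq_flip (μ := (volume : Measure ℝ))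
        (ν := (volume : Measure ℝ)) (e := Real.fourierChar) (L := -innerₗ ℝ) (f := Ψ)
        (g := (g : ℝ → ℂ)) Real.continuous_fourierChar (by fun_prop) Ψ.integrable hg
      have hflip : (-innerₗ ℝ : ℝ →ₗ[ℝ] ℝ →ₗ[ℝ] ℝ).flip = -innerₗ ℝ := by
        ext
        simp
      rw [hflip] at h
      exact h.symm
    have hi1 : Integrable fun x => ψ x • (Lp.fourierTransformₗᵢ ℝ ℂ).symm g x :=
      hloc.integrable_smul_left_of_hasCompactSupport hψ.continuous hψc
    have hi2 : Integrable fun x => ψ x • 𝓕⁻ (g : ℝ → ℂ) x :=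
      hcont.locallyIntegrable.integrable_smul_left_of_hasCompactSupport hψ.continuous hψc
    simp_rw [smul_sub]
    rw [integral_sub hi1 hi2, sub_eq_zero]
    have hc : ∀ w : ℝ → ℂ, ∫ x, ψ x • w x = ∫ x, Ψ x • w x := fun w => by simp [hΨ]
    rw [hc, hc, h1, h2]
  filter_upwards [h0] with x hx
  exact sub_eq_zero.1 hx

/-- For `v, m ∈ L²(ℝ)` the operator `v 𝓕⁻¹ m 𝓕` in `L²(ℝ)` is Hilbert–Schmidt. -/
theorem hsq_mulL_conjF_lt_top {v m : ℝ → ℂ} (hv : MemLp v ∞ volume) (hm : MemLp m ∞ volume)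
    (hv2 : MemLp v 2 volume) (hm2 : MemLp m 2 volume) :
    hsq (mulL v * conjF (mulL m) : L2 ℂ →L[ℂ] L2 ℂ) < ∞ := by
  -- the value of `𝓕⁻¹ m 𝓕 f` at `x` is the inner product of `𝓕 f` with `k x`
  let k : ℝ → ℝ → ℂ := fun x ξ => starRingEnd ℂ (Real.fourierChar (ξ * x) • m ξ)
  have hk : ∀ x, MemLp (k x) 2 volume := by
    intro x
    refine hm2.congr_norm ?_ (Eventually.of_forall fun ξ => ?_)
    · refine Complex.continuous_conj.comp_aestronglyMeasurable ?_
      refine AEStronglyMeasurable.smul ?_ hm2.1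
      have hc : Continuous fun ξ : ℝ => ξ * x := by fun_prop
      exact (continuous_subtype_val.comp (Real.continuous_fourierChar.comp hc)).aestronglyMeasurable
    · simp [k, Circle.norm_smul]
  have hkn : ∀ x, ‖(hk x).toLp (k x)‖ ^ 2 = ∫ ξ, ‖m ξ‖ ^ 2 := by
    intro x
    rw [norm_sq_eq_integral]
    refine integral_congr_ae ?_
    filter_upwards [(hk x).coeFn_toLp] with ξ h
    rw [h]
    simp [k, Circle.norm_smul]
  have hval : ∀ f : L2 ℂ, ∀ᵐ x : ℝ, (mulL v * conjF (mulL m) : L2 ℂ →L[ℂ] L2 ℂ) f x =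
      v x * inner ℂ ((hk x).toLp (k x)) (Lp.fourierTransformₗᵢ ℝ ℂ f) := by
    intro f
    set u := Lp.fourierTransformₗᵢ ℝ ℂ f with hu
    have hint : Integrable (mulL m u : L2 ℂ) := by
      have h1 : Integrable fun ξ => m ξ • u ξ :=
        memLp_one_iff_integrable.1 ((Lp.memLp u).smul (r := 1) hm2)
      refine h1.congr ?_
      filter_upwards [mulL_coe hm u] with ξ h
      rw [h]
    filter_upwards [mulL_coe hv (conjF (mulL m) f), fourierInv_coe_ae (mulL m u) hint]
      with x h1 h2
    change mulL v (conjF (mulL m) f) x = _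
    rw [h1, conjF_apply, ← hu, h2, smul_eq_mul, Real.fourierInv_eq, L2.inner_def]
    congr 1
    refine integral_congr_ae ?_
    filter_upwards [mulL_coe hm u, (hk x).coeFn_toLp] with ξ h3 h4
    rw [h3, h4]
    simp [k, Circle.smul_def, mul_comm]
    ring
  have hvi : Integrable fun x => ‖v x‖ ^ 2 := hv2.integrable_norm_pow two_ne_zero
  refine lt_of_le_of_lt (iSup₂_le fun s hs => ?_ :
    _ ≤ ENNReal.ofReal (∫ x, ‖v x‖ ^ 2 * ∫ ξ, ‖m ξ‖ ^ 2)) ENNReal.ofReal_lt_top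
  rw [← ENNReal.ofReal_sum_of_nonneg fun _ _ => by positivity]
  refine ENNReal.ofReal_le_ofReal ?_
  simp_rw [norm_sq_eq_integral]
  rw [← integral_finsetSum _ fun e _ => integrable_norm_sq _]
  refine integral_mono_ae (integrable_finsetSum _ fun e _ => integrable_norm_sq _)
    (hvi.mul_const _) ?_
  have hall : ∀ᵐ x : ℝ, ∀ e ∈ s, (mulL v * conjF (mulL m) : L2 ℂ →L[ℂ] L2 ℂ) e x =
      v x * inner ℂ ((hk x).toLp (k x)) (Lp.fourierTransformₗᵢ ℝ ℂ e) :=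
    (ae_ball_iff s.countable_toSet).2 fun e _ => hval e
  filter_upwards [hall] with x hx
  have h1 : ∑ e ∈ s, ‖(mulL v * conjF (mulL m) : L2 ℂ →L[ℂ] L2 ℂ) e x‖ ^ 2 =
      ‖v x‖ ^ 2 * ∑ e ∈ s, ‖inner ℂ (Lp.fourierTransformₗᵢ ℝ ℂ e) ((hk x).toLp (k x))‖ ^ 2 := by
    rw [Finset.mul_sum]
    refine Finset.sum_congr rfl fun e he => ?_
    rw [hx e he, norm_mul, mul_pow, norm_inner_symm]
  rw [h1]
  refine mul_le_mul_of_nonneg_left ?_ (by positivity)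
  -- Bessel's inequality for the orthonormal family `𝓕 e`
  rw [← hkn x]
  have horth : Orthonormal ℂ fun e : s => Lp.fourierTransformₗᵢ ℝ ℂ (e : L2 ℂ) :=
    hs.comp_linearIsometryEquiv (Lp.fourierTransformₗᵢ ℝ ℂ)
  have h2 := horth.sum_inner_products_le (x := (hk x).toLp (k x)) (s := Finset.univ)
  rwa [Finset.sum_coe_sort s fun e => ‖inner ℂ (Lp.fourierTransformₗᵢ ℝ ℂ e)
    ((hk x).toLp (k x))‖ ^ 2] at h2

end Tensor

/-! ### Fourier multipliers in `L²(ℝ²)` -/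

section Symbols

/-- The Fourier multiplier in `L²(ℝ²)` with the symbol `m(τ, ξ)`. -/
def multOp (m : ℝ → ℝ → ℂ) : Space →L[ℂ] Space := conjF (fib fun τ => conjF (mulL (m τ)))

/-- The measurability required of a symbol: `m(τ, ·)` is bounded and measurable for every `τ`, and
`m(τ, ·)`, as a multiplier in `L²(ℝ)`, depends on `τ` in a strongly measurable way. -/
def SymMeas (m : ℝ → ℝ → ℂ) : Prop :=
  (∀ τ, MemLp (m τ) ∞ volume) ∧
    AEStronglyMeasurable (fun τ => (conjF (mulL (m τ)) : L2 ℂ →L[ℂ] L2 ℂ)) volume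

/-- Bounded symbols. -/
def IsSym (m : ℝ → ℝ → ℂ) : Prop := SymMeas m ∧ ∃ C : ℝ, ∀ τ ξ, ‖m τ ξ‖ ≤ C

theorem SymMeas.mul {m m' : ℝ → ℝ → ℂ} (h : SymMeas m) (h' : SymMeas m') :
    SymMeas fun τ ξ => m τ ξ * m' τ ξ := by
  refine ⟨fun τ => memLp_mul_top (h.1 τ) (h'.1 τ), ?_⟩
  have : (fun τ => (conjF (mulL fun ξ => m τ ξ * m' τ ξ) : L2 ℂ →L[ℂ] L2 ℂ)) =
      fun τ => conjF (mulL (m τ)) * conjF (mulL (m' τ)) := by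
    funext τ
    rw [conjF_mul, mulL_mul (h.1 τ) (h'.1 τ)]
  rw [this]
  exact h.2.mul h'.2

theorem SymMeas.add {m m' : ℝ → ℝ → ℂ} (h : SymMeas m) (h' : SymMeas m') :
    SymMeas fun τ ξ => m τ ξ + m' τ ξ := by
  refine ⟨fun τ => (h.1 τ).add (h'.1 τ), ?_⟩
  have : (fun τ => (conjF (mulL fun ξ => m τ ξ + m' τ ξ) : L2 ℂ →L[ℂ] L2 ℂ)) =
      fun τ => conjF (mulL (m τ)) + conjF (mulL (m' τ)) := by
    funext τ
    rw [conjF_add, mulL_add (h.1 τ) (h'.1 τ)]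
  rw [this]
  exact h.2.add h'.2

theorem SymMeas.smul {a : ℝ → ℂ} (ha : AEStronglyMeasurable a volume) {m : ℝ → ℝ → ℂ}
    (h : SymMeas m) : SymMeas fun τ ξ => a τ * m τ ξ := by
  refine ⟨fun τ => (h.1 τ).const_mul (a τ), ?_⟩
  have : (fun τ => (conjF (mulL fun ξ => a τ * m τ ξ) : L2 ℂ →L[ℂ] L2 ℂ)) =
      fun τ => a τ • conjF (mulL (m τ)) := by
    funext τ
    rw [conjF_smul, mulL_smul _ (h.1 τ)]
  rw [this]
  exact ha.smul h.2

theorem SymMeas.of_right {f : ℝ → ℂ} (hf : MemLp f ∞ volume) : SymMeas fun _ ξ => f ξ :=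
  ⟨fun _ => hf, aestronglyMeasurable_const⟩

theorem IsSym.mul {m m' : ℝ → ℝ → ℂ} (h : IsSym m) (h' : IsSym m') :
    IsSym fun τ ξ => m τ ξ * m' τ ξ := by
  obtain ⟨h1, C, hC⟩ := h
  obtain ⟨h1', C', hC'⟩ := h'
  refine ⟨h1.mul h1', C * C', fun τ ξ => ?_⟩
  rw [norm_mul]
  exact mul_le_mul (hC τ ξ) (hC' τ ξ) (norm_nonneg _) ((norm_nonneg _).trans (hC τ ξ))

theorem IsSym.add {m m' : ℝ → ℝ → ℂ} (h : IsSym m) (h' : IsSym m') :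
    IsSym fun τ ξ => m τ ξ + m' τ ξ := by
  obtain ⟨h1, C, hC⟩ := h
  obtain ⟨h1', C', hC'⟩ := h'
  exact ⟨h1.add h1', C + C', fun τ ξ => (norm_add_le _ _).trans (add_le_add (hC τ ξ) (hC' τ ξ))⟩

theorem IsSym.of_right {f : ℝ → ℂ} (hf : Continuous f) {C : ℝ} (hC : ∀ ξ, ‖f ξ‖ ≤ C) :
    IsSym fun _ ξ => f ξ :=
  ⟨.of_right (memLp_top_of_continuous hf hC), C, fun _ => hC⟩

theorem IsSym.of_left {a : ℝ → ℂ} (ha : Continuous a) {C : ℝ} (hC : ∀ τ, ‖a τ‖ ≤ C) :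
    IsSym fun τ _ => a τ := by
  refine ⟨?_, C, fun τ _ => hC τ⟩
  have := SymMeas.smul ha.aestronglyMeasurable (SymMeas.of_right (memLp_top_const (1 : ℂ)))
  simpa using this

theorem norm_conjF_mulL_le {m : ℝ → ℂ} {C : ℝ} (hC : ∀ ξ, ‖m ξ‖ ≤ C) :
    ‖(conjF (mulL m) : L2 ℂ →L[ℂ] L2 ℂ)‖ ≤ C :=
  (norm_conjF_le _).trans (norm_mulL_le ((norm_nonneg _).trans (hC 0)) (Eventually.of_forall hC))

theorem IsSym.memLp {m : ℝ → ℝ → ℂ} (h : IsSym m) :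
    MemLp (fun τ => (conjF (mulL (m τ)) : L2 ℂ →L[ℂ] L2 ℂ)) ∞ volume := by
  obtain ⟨h1, C, hC⟩ := h
  exact memLp_top_of_bound h1.2 C (Eventually.of_forall fun τ => norm_conjF_mulL_le (hC τ))

theorem multOp_mul {m m' : ℝ → ℝ → ℂ} (h : IsSym m) (h' : IsSym m') :
    multOp m * multOp m' = multOp fun τ ξ => m τ ξ * m' τ ξ := by
  rw [multOp, multOp, conjF_mul, fib_mul h.memLp h'.memLp, multOp]
  congr 2
  funext τ
  rw [conjF_mul, mulL_mul (h.1.1 τ) (h'.1.1 τ)]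

theorem multOp_add {m m' : ℝ → ℝ → ℂ} (h : IsSym m) (h' : IsSym m') :
    multOp m + multOp m' = multOp fun τ ξ => m τ ξ + m' τ ξ := by
  rw [multOp, multOp, conjF_add, fib_add h.memLp h'.memLp, multOp]
  congr 2
  funext τ
  rw [conjF_add, mulL_add (h.1.1 τ) (h'.1.1 τ)]

theorem multOp_smul (c : ℂ) {m : ℝ → ℝ → ℂ} (h : IsSym m) :
    c • multOp m = multOp fun τ ξ => c * m τ ξ := by
  rw [multOp, conjF_smul, fib_smul c h.memLp, multOp]
  congr 2
  funext τ
  rw [conjF_smul, mulL_smul c (h.1.1 τ)]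

theorem star_multOp {m : ℝ → ℝ → ℂ} (h : IsSym m) :
    star (multOp m) = multOp fun τ ξ => star (m τ ξ) := by
  rw [multOp, star_conjF, star_fib h.memLp, multOp]
  congr 2
  funext τ
  rw [star_conjF, star_mulL (h.1.1 τ)]

theorem norm_multOp_le {m : ℝ → ℝ → ℂ} {C : ℝ} (hC : ∀ τ ξ, ‖m τ ξ‖ ≤ C) : ‖multOp m‖ ≤ C :=
  (norm_conjF_le _).trans (norm_fib_le ((norm_nonneg _).trans (hC 0 0))
    (Eventually.of_forall fun τ => norm_conjF_mulL_le (hC τ)))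

theorem multOp_one : multOp (fun _ _ => 1) = 1 := by
  rw [multOp, mulL_one, conjF_one, fib_one, conjF_one]

theorem multOp_right (f : ℝ → ℂ) : multOp (fun _ ξ => f ξ) = constL (conjF (mulL f)) :=
  conjF_constL _

theorem multOp_left {a : ℝ → ℂ} : multOp (fun τ _ => a τ) = conjF (mulL a) := by
  rw [multOp, mulL]
  congr 2
  funext τ
  have h : (mulL (fun _ => a τ) : L2 ℂ →L[ℂ] L2 ℂ) = a τ • mulL fun _ => 1 := by
    rw [mulL_smul _ (memLp_top_const 1)]
    simp
  rw [h, mulL_one, ← conjF_smul, conjF_one]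

/-- Constant fiber operators that commute with the multipliers in `x` commute with the multipliers
in `L²(ℝ²)`. -/
theorem commute_constL_conjF_mulL {E : Type*} [NormedAddCommGroup E] [InnerProductSpace ℂ E]
    [CompleteSpace E] {m : ℝ → ℂ} (hm : MemLp m ∞ volume) (T : E →L[ℂ] E) :
    Commute (conjF (mulL m)) (constL T) := by
  rw [Commute, SemiconjBy, ← conjF_constL T, conjF_mul, conjF_mul, mulL_commute_constL hm T]

/-- The symbol of `(-Δ + e)⁻¹`. -/
def resSym (e τ ξ : ℝ) : ℝ := ((2 * Real.pi * τ) ^ 2 + (2 * Real.pi * ξ) ^ 2 + e)⁻¹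

theorem resSym_pos {e : ℝ} (he : 0 < e) (τ ξ : ℝ) : 0 < resSym e τ ξ := by
  unfold resSym
  positivity

theorem resSym_le {e : ℝ} (he : 0 < e) (τ ξ : ℝ) : resSym e τ ξ ≤ e⁻¹ := by
  unfold resSym
  refine inv_anti₀ he ?_
  nlinarith [sq_nonneg (2 * Real.pi * τ), sq_nonneg (2 * Real.pi * ξ)]

theorem resSym_mul {e : ℝ} (he : 0 < e) (τ ξ : ℝ) :
    ((2 * Real.pi * τ) ^ 2 + (2 * Real.pi * ξ) ^ 2 + e) * resSym e τ ξ = 1 := by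
  unfold resSym
  exact mul_inv_cancel₀ (by positivity)

theorem continuous_resSym {e : ℝ} (he : 0 < e) (τ : ℝ) : Continuous (resSym e τ) := by
  unfold resSym
  exact Continuous.inv₀ (by fun_prop) fun ξ => by positivity

theorem symMeas_resSym {e : ℝ} (he : 0 < e) : SymMeas fun τ ξ => (resSym e τ ξ : ℂ) := by
  have hb : ∀ τ ξ, ‖(resSym e τ ξ : ℂ)‖ ≤ e⁻¹ := fun τ ξ => by
    rw [Complex.norm_real, Real.norm_of_nonneg (resSym_pos he τ ξ).le]
    exact resSym_le he τ ξ
  have hmem : ∀ τ, MemLp (fun ξ => (resSym e τ ξ : ℂ)) ∞ volume := fun τ =>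
    memLp_top_of_continuous (Complex.continuous_ofReal.comp (continuous_resSym he τ)) (hb τ)
  refine ⟨hmem, Continuous.aestronglyMeasurable ?_⟩
  rw [continuous_iff_continuousAt]
  intro σ
  rw [ContinuousAt, tendsto_iff_norm_sub_tendsto_zero]
  have hbound : ∀ τ, ‖(conjF (mulL fun ξ => (resSym e τ ξ : ℂ)) : L2 ℂ →L[ℂ] L2 ℂ) -
      conjF (mulL fun ξ => (resSym e σ ξ : ℂ))‖ ≤
      |(2 * Real.pi * σ) ^ 2 - (2 * Real.pi * τ) ^ 2| * (e⁻¹ * e⁻¹) := by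
    intro τ
    have h1 : (conjF (mulL fun ξ => (resSym e τ ξ : ℂ)) : L2 ℂ →L[ℂ] L2 ℂ) -
        conjF (mulL fun ξ => (resSym e σ ξ : ℂ)) =
        conjF (mulL fun ξ => (resSym e τ ξ : ℂ) + (-1) * resSym e σ ξ) := by
      rw [← mulL_add (hmem τ) ((hmem σ).const_mul (-1)), ← mulL_smul _ (hmem σ), conjF_sub]
      congr 1
      module
    rw [h1]
    refine norm_conjF_mulL_le fun ξ => ?_
    have h2 : (resSym e τ ξ : ℂ) + (-1) * resSym e σ ξ =
        ((((2 * Real.pi * σ) ^ 2 - (2 * Real.pi * τ) ^ 2) * (resSym e τ ξ * resSym e σ ξ) : ℝ) :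
          ℂ) := by
      have h3 : resSym e τ ξ + (-1) * resSym e σ ξ =
          ((2 * Real.pi * σ) ^ 2 - (2 * Real.pi * τ) ^ 2) * (resSym e τ ξ * resSym e σ ξ) := by
        linear_combination resSym e σ ξ * resSym_mul he τ ξ - resSym e τ ξ * resSym_mul he σ ξ
      rw [← h3]
      push_cast
      ring
    rw [h2, Complex.norm_real, norm_mul, Real.norm_eq_abs, Real.norm_of_nonneg
      (mul_pos (resSym_pos he τ ξ) (resSym_pos he σ ξ)).le]
    refine mul_le_mul_of_nonneg_left ?_ (abs_nonneg _)
    exact mul_le_mul (resSym_le he τ ξ) (resSym_le he σ ξ) (resSym_pos he σ ξ).le (by positivity)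
  refine squeeze_zero (fun _ => norm_nonneg _) hbound ?_
  have hc : Continuous fun τ : ℝ => |(2 * Real.pi * σ) ^ 2 - (2 * Real.pi * τ) ^ 2| *
      (e⁻¹ * e⁻¹) := by fun_prop
  have := hc.tendsto σ
  simpa using this

/-- The symbols `g(ξ) / (4π²(τ² + ξ²) + e)`, in the form `g(ξ)/(4π²ξ² + e)` times
`1 - 4π²τ² / (4π²(τ² + ξ²) + e)`. -/
theorem symMeas_mul_resSym {e : ℝ} (he : 0 < e) {g : ℝ → ℝ} (hg : Continuous g) {C : ℝ}
    (hC : ∀ ξ, |g ξ| ≤ C * ((2 * Real.pi * ξ) ^ 2 + e)) :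
    SymMeas fun τ ξ => ((g ξ * resSym e τ ξ : ℝ) : ℂ) := by
  have h1 : SymMeas fun _ ξ : ℝ => ((g ξ / ((2 * Real.pi * ξ) ^ 2 + e) : ℝ) : ℂ) := by
    refine SymMeas.of_right (memLp_top_of_continuous (C := C) ?_ fun ξ => ?_)
    · refine Complex.continuous_ofReal.comp (hg.div (by fun_prop) fun ξ => ?_)
      positivity
    · rw [Complex.norm_real, norm_div, Real.norm_eq_abs, Real.norm_of_nonneg (by positivity),
        div_le_iff₀ (by positivity)]
      exact hC ξ
  have h2 : SymMeas fun τ ξ : ℝ => (1 : ℂ) + (-((2 * Real.pi * τ : ℝ) : ℂ) ^ 2) * resSym e τ ξ :=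
    (SymMeas.of_right (memLp_top_const 1)).add (SymMeas.smul
      (a := fun τ : ℝ => -((2 * Real.pi * τ : ℝ) : ℂ) ^ 2)
      (Continuous.aestronglyMeasurable (by fun_prop)) (symMeas_resSym he))
  convert h1.mul h2 using 3 with τ ξ
  have h3 : (g ξ * resSym e τ ξ : ℝ) =
      g ξ / ((2 * Real.pi * ξ) ^ 2 + e) * (1 + (-(2 * Real.pi * τ) ^ 2) * resSym e τ ξ) := by
    have h4 : (2 * Real.pi * ξ) ^ 2 + e ≠ 0 := by positivity
    rw [div_mul_eq_mul_div, eq_div_iff h4]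
    linear_combination g ξ * resSym_mul he τ ξ
  rw [h3]
  push_cast
  ring

end Symbols

/-! ### Graphs of sums of unbounded operators -/

section Graphs

variable {H : Type*} [NormedAddCommGroup H] [InnerProductSpace ℂ H]

theorem mem_graph_add (S T : H →ₗ.[ℂ] H) (u w : H) :
    (u, w) ∈ (S + T).graph ↔ ∃ a b, (u, a) ∈ S.graph ∧ (u, b) ∈ T.graph ∧ w = a + b := by
  constructor
  · intro h
    obtain ⟨⟨y, hy⟩, rfl, rfl⟩ := (LinearPMap.mem_graph_iff _).1 h
    exact ⟨_, _, LinearPMap.mem_graph S ⟨y, hy.1⟩, LinearPMap.mem_graph T ⟨y, hy.2⟩, rfl⟩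
  · rintro ⟨a, b, ha, hb, rfl⟩
    obtain ⟨⟨y, hy⟩, rfl, rfl⟩ := (LinearPMap.mem_graph_iff _).1 ha
    obtain ⟨⟨x, hx⟩, hxy, rfl⟩ := (LinearPMap.mem_graph_iff _).1 hb
    obtain rfl : x = y := hxy
    exact (LinearPMap.mem_graph_iff _).2 ⟨⟨x, hy, hx⟩, rfl, rfl⟩

theorem mem_graph_smul (c : ℂ) (T : H →ₗ.[ℂ] H) (u w : H) :
    (u, w) ∈ (c • T).graph ↔ ∃ a, (u, a) ∈ T.graph ∧ w = c • a := by
  constructor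
  · intro h
    obtain ⟨⟨y, hy⟩, rfl, rfl⟩ := (LinearPMap.mem_graph_iff _).1 h
    exact ⟨_, LinearPMap.mem_graph T ⟨y, hy⟩, rfl⟩
  · rintro ⟨a, ha, rfl⟩
    obtain ⟨⟨y, hy⟩, rfl, rfl⟩ := (LinearPMap.mem_graph_iff _).1 ha
    exact (LinearPMap.mem_graph_iff _).2 ⟨⟨y, hy⟩, rfl, rfl⟩

theorem mem_graph_neg (T : H →ₗ.[ℂ] H) (u w : H) :
    (u, w) ∈ (-T).graph ↔ ∃ a, (u, a) ∈ T.graph ∧ w = -a := by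
  constructor
  · intro h
    obtain ⟨⟨y, hy⟩, rfl, rfl⟩ := (LinearPMap.mem_graph_iff _).1 h
    exact ⟨_, LinearPMap.mem_graph T ⟨y, hy⟩, rfl⟩
  · rintro ⟨a, ha, rfl⟩
    obtain ⟨⟨y, hy⟩, rfl, rfl⟩ := (LinearPMap.mem_graph_iff _).1 ha
    exact (LinearPMap.mem_graph_iff _).2 ⟨⟨y, hy⟩, rfl, rfl⟩

theorem mem_graph_sub (S T : H →ₗ.[ℂ] H) (u w : H) :
    (u, w) ∈ (S - T).graph ↔ ∃ a b, (u, a) ∈ S.graph ∧ (u, b) ∈ T.graph ∧ w = a - b := by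
  rw [sub_eq_add_neg, mem_graph_add]
  constructor
  · rintro ⟨a, b, ha, hb, rfl⟩
    obtain ⟨b', hb', rfl⟩ := (mem_graph_neg _ _ _).1 hb
    exact ⟨a, b', ha, hb', (sub_eq_add_neg _ _).symm⟩
  · rintro ⟨a, b, ha, hb, rfl⟩
    exact ⟨a, -b, ha, (mem_graph_neg _ _ _).2 ⟨b, hb, rfl⟩, sub_eq_add_neg _ _⟩

variable [CompleteSpace H]

theorem mem_graph_adjoint {T : H →ₗ.[ℂ] H} (hT : Dense (T.domain : Set H)) {v w : H}
    (h : ∀ u q, (u, q) ∈ T.graph → inner ℂ w u = inner ℂ v q) : (v, w) ∈ T.adjoint.graph := by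
  have h' : ∀ x : T.domain, inner ℂ w (x : H) = inner ℂ v (T x) := fun x =>
    h _ _ (LinearPMap.mem_graph T x)
  have hv := LinearPMap.mem_adjoint_domain_of_exists (T := T) v ⟨w, h'⟩
  exact (LinearPMap.mem_graph_iff _).2 ⟨⟨v, hv⟩, rfl, LinearPMap.adjoint_apply_eq hT ⟨v, hv⟩ h'⟩

theorem inner_eq_of_mem_graph_adjoint {T : H →ₗ.[ℂ] H} (hT : Dense (T.domain : Set H)) {u q v w : H}
    (hu : (u, q) ∈ T.graph) (hv : (v, w) ∈ T.adjoint.graph) : inner ℂ w u = inner ℂ v q := by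
  obtain ⟨y, rfl, rfl⟩ := (LinearPMap.mem_graph_iff _).1 hu
  obtain ⟨x, rfl, rfl⟩ := (LinearPMap.mem_graph_iff _).1 hv
  exact LinearPMap.adjoint_isFormalAdjoint hT x y

omit [CompleteSpace H] in
theorem exists_inner_self_eq (v : H) : ∃ r : ℝ, 0 ≤ r ∧ inner ℂ v v = (r : ℂ) :=
  ⟨‖v‖ ^ 2, by positivity, by rw [inner_self_eq_norm_sq_to_K]; push_cast; rfl⟩

/-- `T* T ≥ 0`. -/
theorem nonnegForm_adjoint_pcomp {T : H →ₗ.[ℂ] H} (hT : Dense (T.domain : Set H)) :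
    NonnegForm (pcomp T.adjoint T) := by
  intro u w h
  obtain ⟨v, huv, hvw⟩ := (mem_graph_pcomp _ _ _ _).1 h
  obtain ⟨r, hr, hrv⟩ := exists_inner_self_eq v
  refine ⟨r, hr, ?_⟩
  rw [← inner_conj_symm, inner_eq_of_mem_graph_adjoint hT huv hvw, hrv, Complex.conj_ofReal]

/-- `T T* ≥ 0`. -/
theorem nonnegForm_pcomp_adjoint {T : H →ₗ.[ℂ] H} (hT : Dense (T.domain : Set H)) :
    NonnegForm (pcomp T T.adjoint) := by
  intro u w h
  obtain ⟨v, huv, hvw⟩ := (mem_graph_pcomp _ _ _ _).1 h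
  obtain ⟨r, hr, hrv⟩ := exists_inner_self_eq v
  exact ⟨r, hr, by rw [← inner_eq_of_mem_graph_adjoint hT hvw huv, hrv]⟩

end Graphs

/-! ### The operators `d/dt` and `𝑨₋` and the Sobolev space `W^{2,2}(ℝ²)` -/

section Generators

theorem mem_graph_Aminus_iff_derivOp (u w : L2 ℂ) :
    (u, w) ∈ Aminus.graph ↔ (u, Complex.I • w) ∈ (derivOp ℂ).graph := by
  rw [Aminus, mem_graph_smul]
  constructor
  · rintro ⟨a, ha, rfl⟩
    rwa [smul_smul, mul_neg, Complex.I_mul_I, neg_neg, one_smul]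
  · intro h
    refine ⟨_, h, ?_⟩
    rw [smul_smul, neg_mul, Complex.I_mul_I, neg_neg, one_smul]

/-- The graph of `𝑨₋` in terms of the bounded operator `(1 + d/dx)⁻¹` on the fibers, as
`i 𝑨₋ = d/dx`. -/
theorem mem_graph_boldAminus_iff (g h : Space) : (g, h) ∈ boldAminus.graph ↔
    constL (derivRes ℂ) (g + Complex.I • h) = g := by
  rw [boldAminus, mem_graph_fiberOp]
  constructor
  · intro H
    refine Lp.ext ?_
    filter_upwards [H, constL_coe (derivRes ℂ) (g + Complex.I • h),
      Lp.coeFn_add g (Complex.I • h), Lp.coeFn_smul Complex.I h] with t h1 h2 h3 h4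
    rw [h2, h3, Pi.add_apply, h4, Pi.smul_apply]
    exact (mem_graph_derivOp_iff _ _).1 ((mem_graph_Aminus_iff_derivOp _ _).1 h1)
  · intro H
    filter_upwards [constL_coe (derivRes ℂ) (g + Complex.I • h),
      Lp.coeFn_add g (Complex.I • h), Lp.coeFn_smul Complex.I h] with t h2 h3 h4
    rw [H, h3, Pi.add_apply, h4, Pi.smul_apply] at h2
    exact (mem_graph_Aminus_iff_derivOp _ _).2 ((mem_graph_derivOp_iff _ _).2 h2.symm)

theorem mem_graph_ddt_iff (g h : Space) : (g, h) ∈ ddt.graph ↔ derivRes (L2 ℂ) (g + h) = g :=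
  mem_graph_derivOp_iff g h

theorem inner_ddt {g h u v : Space} (hg : (g, h) ∈ ddt.graph) (hu : (u, v) ∈ ddt.graph) :
    inner ℂ g v = -inner ℂ h u := inner_derivOp hg hu

theorem inner_boldAminus {g h u v : Space} (hg : (g, h) ∈ boldAminus.graph)
    (hu : (u, v) ∈ boldAminus.graph) : inner ℂ g v = inner ℂ h u := by
  rw [boldAminus, mem_graph_fiberOp] at hg hu
  rw [L2.inner_def, L2.inner_def]
  refine integral_congr_ae ?_
  filter_upwards [hg, hu] with t h1 h2
  have := inner_derivOp ((mem_graph_Aminus_iff_derivOp _ _).1 h1)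
    ((mem_graph_Aminus_iff_derivOp _ _).1 h2)
  rw [inner_smul_left, inner_smul_right, Complex.conj_I, neg_mul, neg_neg] at this
  exact mul_left_cancel₀ Complex.I_ne_zero this

theorem isSym_resolvent_left :
    IsSym fun τ _ : ℝ => ((1 + 2 * Real.pi * Complex.I * τ : ℂ)⁻¹) :=
  .of_left continuous_resolvent_symbol norm_resolvent_symbol_le

theorem isSym_resolvent_right :
    IsSym fun _ ξ : ℝ => ((1 + 2 * Real.pi * Complex.I * ξ : ℂ)⁻¹) :=
  .of_right continuous_resolvent_symbol norm_resolvent_symbol_le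

theorem multOp_mem_graph_ddt {m m' : ℝ → ℝ → ℂ} (hm : IsSym m) (hm' : IsSym m')
    (h : ∀ τ ξ : ℝ, m' τ ξ = 2 * Real.pi * Complex.I * τ * m τ ξ) (f : Space) :
    (multOp m f, multOp m' f) ∈ ddt.graph := by
  rw [mem_graph_ddt_iff, derivRes, ← multOp_left]
  change (multOp _ * (multOp m + multOp m')) f = _
  rw [multOp_add hm hm', multOp_mul isSym_resolvent_left (hm.add hm')]
  congr 2
  funext τ ξ
  rw [h, inv_mul_eq_iff_eq_mul₀ (one_add_two_pi_I_ne_zero τ)]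
  ring

theorem multOp_mem_graph_boldAminus {m m' : ℝ → ℝ → ℂ} (hm : IsSym m) (hm' : IsSym m')
    (h : ∀ τ ξ : ℝ, m' τ ξ = 2 * Real.pi * ξ * m τ ξ) (f : Space) :
    (multOp m f, multOp m' f) ∈ boldAminus.graph := by
  rw [mem_graph_boldAminus_iff, derivRes, ← multOp_right]
  change (multOp _ * (multOp m + Complex.I • multOp m')) f = _
  have hI : IsSym fun τ ξ => Complex.I * m' τ ξ :=
    ⟨SymMeas.smul aestronglyMeasurable_const hm'.1, by
      obtain ⟨C, hC⟩ := hm'.2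
      exact ⟨C, fun τ ξ => by rw [norm_mul, Complex.norm_I, one_mul]; exact hC τ ξ⟩⟩
  rw [multOp_smul _ hm', multOp_add hm hI, multOp_mul isSym_resolvent_right (hm.add hI)]
  congr 2
  funext τ ξ
  rw [h, inv_mul_eq_iff_eq_mul₀ (one_add_two_pi_I_ne_zero ξ)]
  ring

/-- `u ∈ W^{2,2}(ℝ²)`, with the first derivatives `a = du/dt`, `b = 𝑨₋ u` and the second
derivatives `a' = d²u/dt²`, `b' = 𝑨₋² u` and `g = (d/dt) 𝑨₋ u = 𝑨₋ (d/dt) u`. -/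
structure IsW22 (u a b a' b' g : Space) : Prop where
  ddt_u : (u, a) ∈ ddt.graph
  ddt_a : (a, a') ∈ ddt.graph
  bA_u : (u, b) ∈ boldAminus.graph
  bA_b : (b, b') ∈ boldAminus.graph
  ddt_b : (b, g) ∈ ddt.graph
  bA_a : (a, g) ∈ boldAminus.graph

variable (e : ℝ)

/-- `(𝑯₀ + e)⁻¹`. -/
def resH0 : Space →L[ℂ] Space := multOp fun τ ξ => (resSym e τ ξ : ℂ)

/-- `𝑨₋ (𝑯₀ + e)⁻¹`. -/
def bAResH0 : Space →L[ℂ] Space := multOp fun τ ξ => ((2 * Real.pi * ξ * resSym e τ ξ : ℝ) : ℂ)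

variable {e}

theorem abs_symbol_le {e x y s : ℝ} (he : 0 < e) (hs : (x ^ 2 + y ^ 2 + e ^ 2) * s = 1)
    (hs0 : 0 < s) : |y * s| ≤ 1 / (2 * e) := by
  rw [abs_mul, abs_of_pos hs0, le_div_iff₀ (by positivity)]
  have h1 : |y| * (2 * e) ≤ x ^ 2 + y ^ 2 + e ^ 2 := by
    nlinarith [sq_nonneg (|y| - e), sq_abs y, sq_nonneg x]
  nlinarith [mul_le_mul_of_nonneg_right h1 hs0.le]

theorem isSym_resH0 (he : 0 < e) : IsSym fun τ ξ => (resSym e τ ξ : ℂ) :=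
  ⟨symMeas_resSym he, e⁻¹, fun τ ξ => by
    rw [Complex.norm_real, Real.norm_of_nonneg (resSym_pos he τ ξ).le]
    exact resSym_le he τ ξ⟩

theorem norm_bAResH0_symbol_le (he : 0 < e) (τ ξ : ℝ) :
    ‖((2 * Real.pi * ξ * resSym (e ^ 2) τ ξ : ℝ) : ℂ)‖ ≤ 1 / (2 * e) := by
  rw [Complex.norm_real, Real.norm_eq_abs]
  exact abs_symbol_le he (resSym_mul (by positivity) τ ξ) (resSym_pos (by positivity) τ ξ)

theorem isSym_bAResH0 (he : 0 < e) :
    IsSym fun τ ξ => ((2 * Real.pi * ξ * resSym (e ^ 2) τ ξ : ℝ) : ℂ) := by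
  refine ⟨symMeas_mul_resSym (by positivity) (by fun_prop) (C := 1 / (2 * e)) fun ξ => ?_, _,
    norm_bAResH0_symbol_le he⟩
  rw [div_mul_eq_mul_div, one_mul, le_div_iff₀ (by positivity)]
  nlinarith [sq_nonneg (|2 * Real.pi * ξ| - e), sq_abs (2 * Real.pi * ξ)]

theorem norm_resH0_le (he : 0 < e) : ‖resH0 (e ^ 2)‖ ≤ 1 / e ^ 2 :=
  norm_multOp_le fun τ ξ => by
    have : 0 < e ^ 2 := by positivity
    rw [Complex.norm_real, Real.norm_of_nonneg (resSym_pos this τ ξ).le, one_div]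
    exact resSym_le this τ ξ

theorem norm_bAResH0_le (he : 0 < e) : ‖bAResH0 (e ^ 2)‖ ≤ 1 / (2 * e) :=
  norm_multOp_le (norm_bAResH0_symbol_le he)

theorem star_resH0 (he : 0 < e) : star (resH0 (e ^ 2)) = resH0 (e ^ 2) := by
  rw [resH0, star_multOp (isSym_resH0 (by positivity))]
  simp

/-- `(𝑯₀ + e²)⁻¹` maps `L²(ℝ²)` into `W^{2,2}(ℝ²)`, and it is a right inverse of `𝑯₀ + e²`. -/
theorem exists_isW22_resH0 (he : 0 < e) (f : Space) :
    ∃ a a' b' g, IsW22 (resH0 (e ^ 2) f) a (bAResH0 (e ^ 2) f) a' b' g ∧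
      -a' + b' + ((e ^ 2 : ℝ) : ℂ) • resH0 (e ^ 2) f = f := by
  have he2 : 0 < e ^ 2 := by positivity
  set s := resSym (e ^ 2) with hs
  have hsm : ∀ τ ξ, ((2 * Real.pi * τ) ^ 2 + (2 * Real.pi * ξ) ^ 2 + e ^ 2) * s τ ξ = 1 :=
    fun τ ξ => resSym_mul he2 τ ξ
  have hs0 : ∀ τ ξ, 0 < s τ ξ := resSym_pos he2
  have hcast : ∀ r : ℝ, ‖(r : ℂ)‖ = |r| := fun r => by
    rw [Complex.norm_real, Real.norm_eq_abs]
  -- real symbols `x s`, `x² s`, `y² s`, `x y s` with `x = 2πτ`, `y = 2πξ`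
  have hxm : IsSym fun τ ξ => ((2 * Real.pi * τ : ℝ) : ℂ) * (s τ ξ : ℂ) := by
    refine ⟨SymMeas.smul (Continuous.aestronglyMeasurable (by fun_prop)) (symMeas_resSym he2),
      1 / (2 * e), fun τ ξ => ?_⟩
    beta_reduce
    rw [← Complex.ofReal_mul, hcast]
    refine abs_symbol_le he (x := 2 * Real.pi * ξ) ?_ (hs0 τ ξ)
    rw [← hsm τ ξ]
    ring
  have hxx : IsSym fun τ ξ => (((2 * Real.pi * τ) ^ 2 : ℝ) : ℂ) * (s τ ξ : ℂ) := by
    refine ⟨SymMeas.smul (Continuous.aestronglyMeasurable (by fun_prop)) (symMeas_resSym he2),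
      1, fun τ ξ => ?_⟩
    beta_reduce
    rw [← Complex.ofReal_mul, hcast, abs_of_nonneg (mul_nonneg (sq_nonneg _) (hs0 τ ξ).le),
      ← hsm τ ξ]
    exact mul_le_mul_of_nonneg_right (by nlinarith [sq_nonneg (2 * Real.pi * ξ)]) (hs0 τ ξ).le
  have hyy : IsSym fun τ ξ => (((2 * Real.pi * ξ) ^ 2 * s τ ξ : ℝ) : ℂ) := by
    refine ⟨symMeas_mul_resSym he2 (by fun_prop) (C := 1) fun ξ => ?_, 1, fun τ ξ => ?_⟩
    · rw [abs_of_nonneg (sq_nonneg _)]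
      linarith
    · rw [hcast, abs_of_nonneg (mul_nonneg (sq_nonneg _) (hs0 τ ξ).le), ← hsm τ ξ]
      exact mul_le_mul_of_nonneg_right (by nlinarith [sq_nonneg (2 * Real.pi * τ)]) (hs0 τ ξ).le
  have hxy : IsSym fun τ ξ => ((2 * Real.pi * τ : ℝ) : ℂ) *
      ((2 * Real.pi * ξ * s τ ξ : ℝ) : ℂ) := by
    refine ⟨SymMeas.smul (Continuous.aestronglyMeasurable (by fun_prop)) (isSym_bAResH0 he).1,
      1, fun τ ξ => ?_⟩
    beta_reduce
    rw [← Complex.ofReal_mul, hcast, ← mul_assoc, abs_mul, abs_of_pos (hs0 τ ξ), ← hsm τ ξ]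
    refine mul_le_mul_of_nonneg_right (abs_le.2 ⟨?_, ?_⟩) (hs0 τ ξ).le
    · nlinarith [sq_nonneg (2 * Real.pi * τ + 2 * Real.pi * ξ), sq_nonneg (2 * Real.pi * τ),
        sq_nonneg (2 * Real.pi * ξ)]
    · nlinarith [sq_nonneg (2 * Real.pi * τ - 2 * Real.pi * ξ), sq_nonneg (2 * Real.pi * τ),
        sq_nonneg (2 * Real.pi * ξ)]
  have hsmul : ∀ (c : ℂ) {m : ℝ → ℝ → ℂ}, IsSym m → IsSym fun τ ξ => c * m τ ξ :=
    fun c m hm => ⟨SymMeas.smul aestronglyMeasurable_const hm.1, by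
      obtain ⟨C, hC⟩ := hm.2
      exact ⟨‖c‖ * C, fun τ ξ => by
        rw [norm_mul]; exact mul_le_mul_of_nonneg_left (hC τ ξ) (norm_nonneg _)⟩⟩
  refine ⟨_, _, _, _, ⟨multOp_mem_graph_ddt (isSym_resH0 he2) (hsmul Complex.I hxm) ?_ f,
    multOp_mem_graph_ddt (hsmul Complex.I hxm) (hsmul (-1) hxx) ?_ f,
    multOp_mem_graph_boldAminus (isSym_resH0 he2) (isSym_bAResH0 he) ?_ f,
    multOp_mem_graph_boldAminus (isSym_bAResH0 he) hyy ?_ f,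
    multOp_mem_graph_ddt (isSym_bAResH0 he) (hsmul Complex.I hxy) ?_ f,
    multOp_mem_graph_boldAminus (hsmul Complex.I hxm) (hsmul Complex.I hxy) ?_ f⟩, ?_⟩
  · intro τ ξ; push_cast; ring
  · intro τ ξ
    push_cast
    linear_combination (-4 * Real.pi ^ 2 * τ ^ 2 * s τ ξ : ℂ) * Complex.I_mul_I
  · intro τ ξ; push_cast; ring
  · intro τ ξ; push_cast; ring
  · intro τ ξ; push_cast; ring
  · intro τ ξ; push_cast; ring
  · have h1 : -multOp (fun τ ξ => -1 * ((((2 * Real.pi * τ) ^ 2 : ℝ) : ℂ) * (s τ ξ : ℂ))) +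
        multOp (fun τ ξ => (((2 * Real.pi * ξ) ^ 2 * s τ ξ : ℝ) : ℂ)) +
        ((e ^ 2 : ℝ) : ℂ) • resH0 (e ^ 2) = 1 := by
      have h2 : -multOp (fun τ ξ => -1 * ((((2 * Real.pi * τ) ^ 2 : ℝ) : ℂ) * (s τ ξ : ℂ))) =
          multOp (fun τ ξ => (((2 * Real.pi * τ) ^ 2 : ℝ) : ℂ) * (s τ ξ : ℂ)) := by
        rw [← multOp_smul _ hxx, neg_one_smul, neg_neg]
      rw [h2, resH0, multOp_smul _ (isSym_resH0 he2), multOp_add hxx hyy,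
        multOp_add (hxx.add hyy) (hsmul _ (isSym_resH0 he2)), ← multOp_one]
      congr 1
      funext τ ξ
      have := congrArg (fun r : ℝ => (r : ℂ)) (hsm τ ξ)
      push_cast at this ⊢
      rw [← hs]
      linear_combination this
    exact DFunLike.congr_fun h1 f

/-- `⟨u, 𝑯₀ u⟩ = ‖du/dt‖² + ‖𝑨₋ u‖²`. -/
theorem norm_sq_of_second_derivatives {u a b a' b' : Space} (h1 : (u, a) ∈ ddt.graph)
    (h2 : (a, a') ∈ ddt.graph) (h3 : (u, b) ∈ boldAminus.graph)
    (h4 : (b, b') ∈ boldAminus.graph) :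
    inner ℂ u (-a' + b') = ((‖a‖ ^ 2 + ‖b‖ ^ 2 : ℝ) : ℂ) := by
  rw [inner_add_right, inner_neg_right, inner_ddt h1 h2, neg_neg, inner_boldAminus h3 h4,
    inner_self_eq_norm_sq_to_K, inner_self_eq_norm_sq_to_K]
  push_cast
  rfl

/-- The domain of `𝑯₀` is `W^{2,2}(ℝ²)`: the mixed second derivatives exist as well. Indeed
`u = (𝑯₀ + 1)⁻¹ (𝑯₀ + 1) u`, as `𝑯₀ + 1` is injective. -/
theorem exists_isW22 {u a b a' b' : Space} (h1 : (u, a) ∈ ddt.graph)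
    (h2 : (a, a') ∈ ddt.graph) (h3 : (u, b) ∈ boldAminus.graph)
    (h4 : (b, b') ∈ boldAminus.graph) : ∃ g, IsW22 u a b a' b' g := by
  set f := -a' + b' + ((1 ^ 2 : ℝ) : ℂ) • u with hf
  obtain ⟨p, p', q', g, hW, hid⟩ := exists_isW22_resH0 one_pos f
  have k1 := ddt.graph.sub_mem h1 hW.ddt_u
  have k2 := ddt.graph.sub_mem h2 hW.ddt_a
  have k3 := boldAminus.graph.sub_mem h3 hW.bA_u
  have k4 := boldAminus.graph.sub_mem h4 hW.bA_b
  have key := norm_sq_of_second_derivatives k1 k2 k3 k4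
  -- `v = u - (𝑯₀ + 1)⁻¹ f` satisfies `𝑯₀ v = -v`
  have h5 : -(a' - p') + (b' - q') = -(u - resH0 (1 ^ 2) f) := by
    have h6 : ((1 ^ 2 : ℝ) : ℂ) = 1 := by simp
    rw [h6, one_smul] at hf hid
    rw [hf] at hid ⊢
    linear_combination (norm := module) -hid
  have h0 : u - resH0 (1 ^ 2) f = 0 := by
    rw [h5, inner_neg_right, inner_self_eq_norm_sq_to_K] at key
    have h7 : -(‖u - resH0 (1 ^ 2) f‖ ^ 2) = ‖a - p‖ ^ 2 + ‖b - bAResH0 (1 ^ 2) f‖ ^ 2 :=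
      Complex.ofReal_injective (by push_cast at key ⊢; exact key)
    have : ‖u - resH0 (1 ^ 2) f‖ ^ 2 = 0 := by
      nlinarith [sq_nonneg ‖u - resH0 (1 ^ 2) f‖, sq_nonneg ‖a - p‖,
        sq_nonneg ‖b - bAResH0 (1 ^ 2) f‖]
    exact norm_eq_zero.1 (pow_eq_zero_iff two_ne_zero |>.1 this)
  have e1 : a - p = 0 := ddt.graph_fst_eq_zero_snd k1 h0
  have e2 : b - bAResH0 (1 ^ 2) f = 0 := boldAminus.graph_fst_eq_zero_snd k3 h0
  refine ⟨g, h1, h2, h3, h4, ?_, ?_⟩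
  · rw [sub_eq_zero.1 e2]
    exact hW.ddt_b
  · rw [sub_eq_zero.1 e1]
    exact hW.bA_a

/-- `⟨du/dt, 𝑨₋ u⟩` is purely imaginary for `u ∈ W^{2,2}(ℝ²)`. -/
theorem IsW22.inner_add_inner {u a b a' b' g : Space} (h : IsW22 u a b a' b' g) :
    inner ℂ a b + inner ℂ b a = 0 := by
  rw [← inner_boldAminus h.bA_u h.bA_a, inner_ddt h.ddt_u h.ddt_b]
  ring

/-- The range of `(𝑯₀ + e²)⁻¹` is dense, since this operator is self-adjoint and injective. -/
theorem dense_of_resH0_mem {D : Submodule ℂ Space} (he : 0 < e)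
    (hD : ∀ f, resH0 (e ^ 2) f ∈ D) : Dense (D : Set Space) := by
  rw [Submodule.dense_iff_topologicalClosure_eq_top, Submodule.topologicalClosure_eq_top_iff,
    Submodule.eq_bot_iff]
  intro y hy
  have h1 : resH0 (e ^ 2) y = 0 := by
    rw [← inner_self_eq_zero (𝕜 := ℂ)]
    have h2 := (Submodule.mem_orthogonal _ _).1 hy _ (hD (resH0 (e ^ 2) y))
    rw [← ContinuousLinearMap.adjoint_inner_left, ← ContinuousLinearMap.star_eq_adjoint,
      star_resH0 he]
    exact h2
  obtain ⟨a, a', b', g, hW, hid⟩ := exists_isW22_resH0 he y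
  have ha := ddt.graph_fst_eq_zero_snd hW.ddt_u h1
  have hb := boldAminus.graph_fst_eq_zero_snd hW.bA_u h1
  rw [← hid, ddt.graph_fst_eq_zero_snd hW.ddt_a ha, boldAminus.graph_fst_eq_zero_snd hW.bA_b hb, h1]
  simp

end Generators

/-! ### The bounded perturbations -/

section Perturbations

/-- The symbols `m` of the operators `m(-i d/dx / 2π)` by which `φ` is cut off: `m = 1` for `𝑩`, and
`m(ξ) = χ_n(2πξ)` for `𝑩_n`. -/
structure IsCutoff (m : ℝ → ℝ) : Prop where
  cont : Continuous m
  abs_le : ∀ ξ, |m ξ| ≤ 1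

theorem isCutoff_one : IsCutoff fun _ => 1 := ⟨continuous_const, fun _ => by simp⟩

/-- The Fourier multiplier in `L²(ℝ)` with the real symbol `m`. -/
def cut (m : ℝ → ℝ) : L2 ℂ →L[ℂ] L2 ℂ := conjF (mulL fun ξ => (m ξ : ℂ))

/-- The bounded operator generated by the family `η(t) m φ m`, where `m` stands for the operator
`cut m`. For `η = θ`, `θ'` it is `𝑩`, `𝑩'` if `m = 1`, and `𝑩_n`, `𝑩_n'` if `m` is the symbol of
`χ_n(A₋)`. -/
def pert (η φ m : ℝ → ℝ) : Space →L[ℂ] Space :=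
  mulL (fun t => (η t : ℂ)) * constL (cut m * mulL (fun x => (φ x : ℂ)) * cut m)

variable {m : ℝ → ℝ}

theorem IsCutoff.norm_le (hm : IsCutoff m) (ξ : ℝ) : ‖(m ξ : ℂ)‖ ≤ 1 := by
  rw [Complex.norm_real]
  exact hm.abs_le ξ

theorem IsCutoff.memLp (hm : IsCutoff m) : MemLp (fun ξ => (m ξ : ℂ)) ∞ volume :=
  memLp_top_of_continuous (Complex.continuous_ofReal.comp hm.cont) hm.norm_le

theorem IsCutoff.isSym (hm : IsCutoff m) : IsSym fun _ ξ => (m ξ : ℂ) :=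
  IsSym.of_right (Complex.continuous_ofReal.comp hm.cont) hm.norm_le

theorem cut_one : cut (fun _ => 1) = 1 := by
  rw [cut, ← conjF_one, ← mulL_one]
  simp

theorem star_mulL_ofReal {E : Type*} [NormedAddCommGroup E] [InnerProductSpace ℂ E]
    [CompleteSpace E] {η : ℝ → ℝ} (hη : MemLp η ∞ volume) :
    star (mulL (fun t => (η t : ℂ)) : L2 E →L[ℂ] L2 E) = mulL fun t => (η t : ℂ) := by
  rw [star_mulL (memLp_ofReal hη)]
  simp

theorem star_cut (hm : IsCutoff m) : star (cut m) = cut m := by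
  rw [cut, star_conjF, star_mulL hm.memLp]
  simp

theorem norm_cut_le (hm : IsCutoff m) : ‖cut m‖ ≤ 1 := norm_conjF_mulL_le hm.norm_le

theorem star_pert {η φ : ℝ → ℝ} (hη : MemLp η ∞ volume) (hφ : MemLp φ ∞ volume)
    (hm : IsCutoff m) : star (pert η φ m) = pert η φ m := by
  rw [pert, star_mul, star_constL, star_mul, star_mul, star_cut hm, star_mulL_ofReal hφ,
    star_mulL_ofReal hη, (mulL_commute_constL (memLp_ofReal hη) _).eq, mul_assoc]

theorem norm_pert_le {η φ : ℝ → ℝ} {C C' : ℝ} (hC : 0 ≤ C) (hC' : 0 ≤ C')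
    (hη : ∀ᵐ t, ‖η t‖ ≤ C) (hφ : ∀ᵐ x, ‖φ x‖ ≤ C') (hm : IsCutoff m) :
    ‖pert η φ m‖ ≤ C * C' := by
  have h1 : ‖(mulL (fun x => (φ x : ℂ)) : L2 ℂ →L[ℂ] L2 ℂ)‖ ≤ C' :=
    norm_mulL_le hC' (hφ.mono fun x hx => by rwa [Complex.norm_real])
  have h2 : ‖(mulL (fun x => (η x : ℂ)) : Space →L[ℂ] Space)‖ ≤ C :=
    norm_mulL_le hC (hη.mono fun x hx => by rwa [Complex.norm_real])
  have h3 : ‖cut m * mulL (fun x => (φ x : ℂ)) * cut m‖ ≤ 1 * C' * 1 :=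
    (norm_mul_le _ _).trans (mul_le_mul ((norm_mul_le _ _).trans
      (mul_le_mul (norm_cut_le hm) h1 (norm_nonneg _) zero_le_one)) (norm_cut_le hm)
      (norm_nonneg _) (by linarith))
  rw [one_mul, mul_one] at h3
  exact (norm_mul_le _ _).trans (mul_le_mul h2 ((norm_constL_le _).trans h3) (norm_nonneg _) hC)

theorem cut_mem_graph_Aminus (hm : IsCutoff m) {u w : L2 ℂ} (h : (u, w) ∈ Aminus.graph) :
    (cut m u, cut m w) ∈ Aminus.graph := by
  rw [mem_graph_Aminus_iff_derivOp, mem_graph_derivOp_iff] at h ⊢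
  have hc : derivRes ℂ * cut m = cut m * derivRes ℂ := by
    rw [derivRes, cut, conjF_mul, conjF_mul, mulL_mul memLp_resolvent_symbol hm.memLp,
      mulL_mul hm.memLp memLp_resolvent_symbol]
    simp_rw [mul_comm]
  rw [← map_smul, ← map_add]
  change (derivRes ℂ * cut m) _ = _
  rw [hc]
  exact congrArg (cut m) h

theorem mulL_mem_graph_Aminus {φ : ℝ → ℝ} (hac : ∀ a b : ℝ, AbsolutelyContinuousOnInterval φ a b)
    (hb : MemLp φ ∞ volume) (hd : MemLp (deriv φ) ∞ volume) {u w : L2 ℂ}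
    (h : (u, w) ∈ Aminus.graph) :
    (mulL (fun x => (φ x : ℂ)) u, mulL (fun x => (φ x : ℂ)) w -
      Complex.I • mulL (fun x => ((deriv φ x : ℝ) : ℂ)) u) ∈ Aminus.graph := by
  rw [mem_graph_Aminus_iff_derivOp] at h ⊢
  have := mul_mem_graph_derivOp hac hb hd h
  rw [map_smul] at this
  rwa [smul_sub, smul_smul, Complex.I_mul_I, neg_one_smul, sub_neg_eq_add, add_comm]

/-- The fiberwise form of the product rule `𝑨₋ P = P 𝑨₋ - i P'`. -/
theorem constL_mem_graph_boldAminus {P P' : L2 ℂ →L[ℂ] L2 ℂ}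
    (h : ∀ u w, (u, w) ∈ Aminus.graph → (P u, P w - Complex.I • P' u) ∈ Aminus.graph)
    {u b : Space} (hu : (u, b) ∈ boldAminus.graph) :
    (constL P u, constL P b - Complex.I • constL P' u) ∈ boldAminus.graph := by
  rw [boldAminus, mem_graph_fiberOp] at hu ⊢
  filter_upwards [hu, constL_coe P u, constL_coe P b, constL_coe P' u,
    Lp.coeFn_sub (constL P b) (Complex.I • constL P' u),
    Lp.coeFn_smul Complex.I (constL P' u)] with t h1 h2 h3 h4 h5 h6
  rw [h2, h5, Pi.sub_apply, h6, Pi.smul_apply, h3, h4]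
  exact h _ _ h1

theorem mulL_mem_graph_boldAminus {η : ℝ → ℂ} (hη : MemLp η ∞ volume) {u b : Space}
    (hu : (u, b) ∈ boldAminus.graph) : (mulL η u, mulL η b) ∈ boldAminus.graph := by
  rw [mem_graph_boldAminus_iff] at hu ⊢
  rw [← map_smul, ← map_add]
  change (constL (derivRes ℂ) * (mulL η : Space →L[ℂ] Space)) _ = _
  rw [← (mulL_commute_constL hη (derivRes ℂ)).eq]
  exact congrArg (mulL η) hu

theorem constL_mem_graph_ddt (P : L2 ℂ →L[ℂ] L2 ℂ) {u a : Space} (hu : (u, a) ∈ ddt.graph) :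
    (constL P u, constL P a) ∈ ddt.graph := by
  rw [mem_graph_ddt_iff] at hu ⊢
  rw [← map_add]
  change (derivRes (L2 ℂ) * constL P) _ = _
  rw [derivRes, (commute_constL_conjF_mulL memLp_resolvent_symbol P).eq]
  exact congrArg (constL P) hu

/-- `𝑨₋ 𝑩 = 𝑩 𝑨₋ - i 𝑪`, where `𝑪` is generated by `η(t) m φ' m`. -/
theorem pert_mem_graph_boldAminus {η φ : ℝ → ℝ} (hη : MemLp η ∞ volume)
    (hac : ∀ a b : ℝ, AbsolutelyContinuousOnInterval φ a b)
    (hb : MemLp φ ∞ volume) (hd : MemLp (deriv φ) ∞ volume) (hm : IsCutoff m) {u b : Space}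
    (hu : (u, b) ∈ boldAminus.graph) :
    (pert η φ m u, pert η φ m b - Complex.I • pert η (deriv φ) m u) ∈ boldAminus.graph := by
  have h := mulL_mem_graph_boldAminus (memLp_ofReal hη) (constL_mem_graph_boldAminus
    (P := cut m * mulL (fun x => (φ x : ℂ)) * cut m)
    (P' := cut m * mulL (fun x => ((deriv φ x : ℝ) : ℂ)) * cut m) (fun u w huw => by
      have := cut_mem_graph_Aminus hm
        (mulL_mem_graph_Aminus hac hb hd (cut_mem_graph_Aminus hm huw))
      rwa [map_sub, map_smul] at this) hu)
  rwa [map_sub, map_smul] at h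

/-- `(d/dt) 𝑩 = 𝑩 (d/dt) + 𝑩'`. -/
theorem pert_mem_graph_ddt {η φ : ℝ → ℝ} (hac : ∀ a b : ℝ, AbsolutelyContinuousOnInterval η a b)
    (hb : MemLp η ∞ volume) (hd : MemLp (deriv η) ∞ volume) {u a : Space}
    (hu : (u, a) ∈ ddt.graph) :
    (pert η φ m u, pert η φ m a + pert (deriv η) φ m u) ∈ ddt.graph := by
  have := mul_mem_graph_derivOp hac hb hd (constL_mem_graph_ddt
    (cut m * mulL (fun x => (φ x : ℂ)) * cut m) hu)
  rwa [add_comm] at this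

theorem mem_graph_boldFamily_iff {η : ℝ → ℝ} (hη : MemLp η ∞ volume) {T : L2 ℂ →ₗ.[ℂ] L2 ℂ}
    {P : L2 ℂ →L[ℂ] L2 ℂ} (hT : ∀ u w, (u, w) ∈ T.graph ↔ w = P u) (g h : Space) :
    (g, h) ∈ (boldFamily η T).graph ↔ h = mulL (fun t => (η t : ℂ)) (constL P g) := by
  rw [boldFamily, mem_graph_fiberOp]
  constructor
  · intro H
    refine (mulL_eq_of_ae (memLp_ofReal hη) ?_).symm
    filter_upwards [H, constL_coe P g] with t h1 h2
    obtain ⟨a, ha, h3⟩ := (mem_graph_smul _ _ _ _).1 h1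
    rw [h3, (hT _ _).1 ha, h2]
  · rintro rfl
    filter_upwards [constL_coe P g, mulL_coe (memLp_ofReal hη) (constL P g)] with t h1 h2
    rw [h2, h1]
    exact (mem_graph_smul _ _ _ _).2 ⟨_, (hT _ _).2 rfl, rfl⟩

theorem mem_graph_mulOp_iff {φ : ℝ → ℝ} (hφ : MemLp φ ∞ volume) (u w : L2 ℂ) :
    (u, w) ∈ (mulOp (fun x => (φ x : ℂ)) : L2 ℂ →ₗ.[ℂ] L2 ℂ).graph ↔
      w = mulL (fun x => (φ x : ℂ)) u := by
  rw [mem_graph_mulOp]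
  constructor
  · exact fun H => (mulL_eq_of_ae (memLp_ofReal hφ) H).symm
  · rintro rfl
    exact mulL_coe (memLp_ofReal hφ) u

theorem mem_graph_toPMap_top {H : Type*} [NormedAddCommGroup H] [InnerProductSpace ℂ H]
    (f : H →ₗ[ℂ] H) (u w : H) : (u, w) ∈ (f.toPMap ⊤).graph ↔ w = f u := by
  rw [LinearPMap.mem_graph_iff]
  constructor
  · rintro ⟨y, rfl, rfl⟩
    rfl
  · rintro rfl
    exact ⟨⟨u, trivial⟩, rfl, rfl⟩

theorem mem_graph_funAminus_iff {f : ℝ → ℝ} (hm : IsCutoff fun ξ => f (2 * Real.pi * ξ))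
    (u w : L2 ℂ) : (u, w) ∈ (funAminus f).graph ↔ w = cut (fun ξ => f (2 * Real.pi * ξ)) u := by
  have hm' : MemLp (fun ξ => f (2 * Real.pi * ξ)) ∞ volume :=
    memLp_top_of_continuous hm.cont hm.abs_le
  rw [funAminus, mem_graph_pcomp]
  constructor
  · rintro ⟨v, h1, h2⟩
    obtain ⟨v', h3, h4⟩ := (mem_graph_pcomp _ _ _ _).1 h1
    rw [mem_graph_toPMap_top] at h2 h3
    rw [mem_graph_mulOp_iff hm'] at h4
    rw [h2, h4, h3, cut, conjF_apply]
    rfl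
  · rintro rfl
    refine ⟨_, (mem_graph_pcomp _ _ _ _).2 ⟨_, (mem_graph_toPMap_top _ _ _).2 rfl,
      (mem_graph_mulOp_iff hm' _ _).2 rfl⟩, ?_⟩
    rw [mem_graph_toPMap_top, cut, conjF_apply]
    rfl

/-- The symbol `ξ ↦ χ_n(2πξ)` of `χ_n(A₋)`. -/
def chiSym (n : ℕ) (ξ : ℝ) : ℝ := chi n (2 * Real.pi * ξ)

theorem isCutoff_chiSym (n : ℕ) : IsCutoff (chiSym n) := by
  -- `χ_0 = 0`, by division by zero at the origin
  rcases Nat.eq_zero_or_pos n with rfl | hn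
  · have : chiSym 0 = fun _ => 0 := by
      funext ξ
      simp [chiSym, chi]
    rw [this]
    exact ⟨continuous_const, fun _ => by simp⟩
  · have hn' : (0 : ℝ) < n := Nat.cast_pos.2 hn
    refine ⟨?_, fun ξ => ?_⟩
    · unfold chiSym chi
      refine Continuous.div (by fun_prop) (by fun_prop) fun ξ => ?_
      positivity
    · unfold chiSym chi
      rw [abs_of_nonneg (by positivity), div_le_one (by positivity)]
      exact Real.le_sqrt_of_sq_le (by nlinarith [sq_nonneg (2 * Real.pi * ξ)])

theorem mem_graph_boldFamily_Bplus_iff {η φ : ℝ → ℝ} (hη : MemLp η ∞ volume)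
    (hφ : MemLp φ ∞ volume) (g h : Space) :
    (g, h) ∈ (boldFamily η (Bplus φ)).graph ↔ h = pert η φ (fun _ => 1) g := by
  rw [Bplus, mem_graph_boldFamily_iff hη (mem_graph_mulOp_iff hφ), pert, cut_one, one_mul, mul_one]
  rfl

theorem mem_graph_boldFamily_BplusN_iff {η φ : ℝ → ℝ} (hη : MemLp η ∞ volume)
    (hφ : MemLp φ ∞ volume) (n : ℕ) (g h : Space) :
    (g, h) ∈ (boldFamily η (BplusN φ n)).graph ↔ h = pert η φ (chiSym n) g := by
  rw [mem_graph_boldFamily_iff hη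
    (P := cut (chiSym n) * mulL (fun x => (φ x : ℂ)) * cut (chiSym n)), pert]
  · rfl
  · intro u w
    have hf := mem_graph_funAminus_iff (f := chi n) (isCutoff_chiSym n)
    rw [BplusN, mem_graph_pcomp]
    constructor
    · rintro ⟨v, h1, h2⟩
      obtain ⟨v', h3, h4⟩ := (mem_graph_pcomp _ _ _ _).1 h1
      rw [(hf _ _).1 h2, (mem_graph_mulOp_iff hφ _ _).1 h4, (hf _ _).1 h3]
      rfl
    · rintro rfl
      exact ⟨_, (mem_graph_pcomp _ _ _ _).2 ⟨_, (hf _ _).2 rfl,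
        (mem_graph_mulOp_iff hφ _ _).2 rfl⟩, (hf _ _).2 rfl⟩

end Perturbations

/-! ### The operators `𝑯_j` and `𝑯_{j,n}` as perturbations of `𝑯₀` -/

section Schroedinger

/-- The relatively bounded perturbation `2 𝑩 𝑨₋ - i 𝑪 + 𝑩² + σ 𝑩'`, multiplied by `(𝑯₀ + e²)⁻¹`,
where `𝑩`, `𝑩'` and `𝑪 = i [𝑨₋, 𝑩]` are the bounded operators generated by `θ(t) m φ m`,
`θ'(t) m φ m` and `θ(t) m φ' m`. -/
def relPert (φ θ m : ℝ → ℝ) (e : ℝ) (σ : ℂ) : Space →L[ℂ] Space :=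
  (2 : ℂ) • (pert θ φ m * bAResH0 (e ^ 2)) - Complex.I • (pert θ (deriv φ) m * resH0 (e ^ 2)) +
    pert θ φ m * pert θ φ m * resH0 (e ^ 2) + σ • (pert (deriv θ) φ m * resH0 (e ^ 2))

/-- `T` is a nonnegative operator that acts on `W^{2,2}(ℝ²)` as
`𝑯₀ + 𝑩 𝑨₋ + 𝑨₋ 𝑩 + 𝑩² + σ 𝑩'`. -/
structure IsSchroedinger (φ θ m : ℝ → ℝ) (σ : ℂ) (T : Space →ₗ.[ℂ] Space) : Prop where
  nonneg : NonnegForm T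
  mem_graph : ∀ u a b a' b' g, IsW22 u a b a' b' g →
    (u, -a' + b' + (2 : ℂ) • pert θ φ m b - Complex.I • pert θ (deriv φ) m u +
      pert θ φ m (pert θ φ m u) + σ • pert (deriv θ) φ m u) ∈ T.graph

variable {φ θ m : ℝ → ℝ} {σ : ℂ} {T : Space →ₗ.[ℂ] Space}

/-- `(T + e²) (𝑯₀ + e²)⁻¹ = 1 + K`, with `K = relPert φ θ m e σ`. -/
theorem IsSchroedinger.mem_graph_resH0 (h : IsSchroedinger φ θ m σ T) {e : ℝ} (he : 0 < e)
    (f : Space) : (resH0 (e ^ 2) f,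
      f + relPert φ θ m e σ f - ((e ^ 2 : ℝ) : ℂ) • resH0 (e ^ 2) f) ∈ T.graph := by
  obtain ⟨a, a', b', g, hW, hid⟩ := exists_isW22_resH0 he f
  convert h.mem_graph _ _ _ _ _ _ hW using 2
  change f + ((2 : ℂ) • pert θ φ m (bAResH0 (e ^ 2) f) -
    Complex.I • pert θ (deriv φ) m (resH0 (e ^ 2) f) +
    pert θ φ m (pert θ φ m (resH0 (e ^ 2) f)) + σ • pert (deriv θ) φ m (resH0 (e ^ 2) f)) -
    ((e ^ 2 : ℝ) : ℂ) • resH0 (e ^ 2) f = _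
  linear_combination (norm := module) -hid

/-- The perturbation is small relative to `𝑯₀ + e²` for `e = 4 (M + 1)`, where `M` bounds `𝑩`, `𝑩'`
and `𝑪`. -/
theorem norm_relPert_le {M : ℝ} (hM : 0 ≤ M) (h1 : ‖pert θ φ m‖ ≤ M)
    (h2 : ‖pert θ (deriv φ) m‖ ≤ M) (h3 : ‖pert (deriv θ) φ m‖ ≤ M) (hσ : ‖σ‖ ≤ 1) :
    ‖relPert φ θ m (4 * (M + 1)) σ‖ ≤ 1 / 2 := by
  set e := 4 * (M + 1) with he
  have he0 : 0 < e := by positivity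
  have k1 : ‖(2 : ℂ) • (pert θ φ m * bAResH0 (e ^ 2))‖ ≤ 2 * (M * (1 / (2 * e))) := by
    rw [norm_smul, Complex.norm_ofNat]
    exact mul_le_mul_of_nonneg_left ((norm_mul_le _ _).trans
      (mul_le_mul h1 (norm_bAResH0_le he0) (norm_nonneg _) hM)) zero_le_two
  have k2 : ‖Complex.I • (pert θ (deriv φ) m * resH0 (e ^ 2))‖ ≤ M * (1 / e ^ 2) := by
    rw [norm_smul, Complex.norm_I, one_mul]
    exact (norm_mul_le _ _).trans (mul_le_mul h2 (norm_resH0_le he0) (norm_nonneg _) hM)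
  have k3 : ‖pert θ φ m * pert θ φ m * resH0 (e ^ 2)‖ ≤ M * M * (1 / e ^ 2) :=
    (norm_mul_le _ _).trans (mul_le_mul ((norm_mul_le _ _).trans
      (mul_le_mul h1 h1 (norm_nonneg _) hM)) (norm_resH0_le he0) (norm_nonneg _) (by positivity))
  have k4 : ‖σ • (pert (deriv θ) φ m * resH0 (e ^ 2))‖ ≤ 1 * (M * (1 / e ^ 2)) := by
    rw [norm_smul]
    exact mul_le_mul hσ ((norm_mul_le _ _).trans
      (mul_le_mul h3 (norm_resH0_le he0) (norm_nonneg _) hM)) (norm_nonneg _) zero_le_one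
  have k5 : ‖relPert φ θ m e σ‖ ≤ 2 * (M * (1 / (2 * e))) + M * (1 / e ^ 2) +
      M * M * (1 / e ^ 2) + 1 * (M * (1 / e ^ 2)) :=
    (norm_add_le _ _).trans (add_le_add ((norm_add_le _ _).trans
      (add_le_add ((norm_sub_le _ _).trans (add_le_add k1 k2)) k3)) k4)
  refine k5.trans ?_
  have k6 : 2 * (M * (1 / (2 * e))) + M * (1 / e ^ 2) + M * M * (1 / e ^ 2) +
      1 * (M * (1 / e ^ 2)) = (M * e + 2 * M + M * M) / e ^ 2 := by
    field_simp
    ring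
  rw [k6, div_le_iff₀ (by positivity), he]
  nlinarith

section Products

variable (h : Admissible φ θ)
include h

theorem mem_graph_DA_iff (u q : Space) : (u, q) ∈ (DA φ θ).graph ↔
    ∃ a b, (u, a) ∈ ddt.graph ∧ (u, b) ∈ boldAminus.graph ∧
      q = a + b + pert θ φ (fun _ => 1) u := by
  rw [DA, boldA, mem_graph_add]
  constructor
  · rintro ⟨a, c, ha, hc, rfl⟩
    obtain ⟨b, d, hb, hd, rfl⟩ := (mem_graph_add _ _ _ _).1 hc
    rw [mem_graph_boldFamily_Bplus_iff h.theta_bdd h.phi_bdd] at hd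
    exact ⟨a, b, ha, hb, by rw [hd, add_assoc]⟩
  · rintro ⟨a, b, ha, hb, rfl⟩
    exact ⟨a, _, ha, (mem_graph_add _ _ _ _).2 ⟨b, _, hb,
      (mem_graph_boldFamily_Bplus_iff h.theta_bdd h.phi_bdd _ _).2 rfl, rfl⟩, by rw [add_assoc]⟩

theorem dense_domain_DA : Dense ((DA φ θ).domain : Set Space) := by
  refine dense_of_resH0_mem one_pos fun f => ?_
  obtain ⟨a, a', b', g, hW, -⟩ := exists_isW22_resH0 one_pos f
  exact LinearPMap.mem_domain_of_mem_graph
    ((mem_graph_DA_iff h _ _).2 ⟨_, _, hW.ddt_u, hW.bA_u, rfl⟩)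

theorem inner_pert_left {η : ℝ → ℝ} (hη : MemLp η ∞ volume) (hm : IsCutoff m) (u v : Space) :
    inner ℂ (pert η φ m u) v = inner ℂ u (pert η φ m v) := by
  rw [← ContinuousLinearMap.adjoint_inner_right, ← ContinuousLinearMap.star_eq_adjoint,
    star_pert hη h.phi_bdd hm]

/-- The adjoint of `d/dt + 𝑨` extends `-d/dt + 𝑨`. -/
theorem mem_graph_adjoint_DA {v p q : Space} (hp : (v, p) ∈ ddt.graph)
    (hq : (v, q) ∈ boldAminus.graph) :
    (v, -p + q + pert θ φ (fun _ => 1) v) ∈ (DA φ θ).adjoint.graph := by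
  refine mem_graph_adjoint (dense_domain_DA h) fun u w hu => ?_
  obtain ⟨a, b, ha, hb, rfl⟩ := (mem_graph_DA_iff h _ _).1 hu
  rw [inner_add_left, inner_add_left, inner_neg_left, inner_add_right, inner_add_right,
    inner_ddt hp ha, inner_boldAminus hq hb, inner_pert_left h h.theta_bdd isCutoff_one]

/-- The product rules for `𝑩 u` when `u ∈ W^{1,2}(ℝ²)`. -/
theorem pert_ddt {u a : Space} (hu : (u, a) ∈ ddt.graph) :
    (pert θ φ m u, pert θ φ m a + pert (deriv θ) φ m u) ∈ ddt.graph :=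
  pert_mem_graph_ddt h.theta_ac h.theta_bdd h.theta_deriv_bdd hu

theorem pert_boldAminus (hm : IsCutoff m) {u b : Space} (hu : (u, b) ∈ boldAminus.graph) :
    (pert θ φ m u, pert θ φ m b - Complex.I • pert θ (deriv φ) m u) ∈ boldAminus.graph :=
  pert_mem_graph_boldAminus h.theta_bdd h.phi_ac h.phi_bdd h.phi_deriv_bdd hm hu

theorem isSchroedinger_H1 : IsSchroedinger φ θ (fun _ => 1) (-1) (H1 φ θ) := by
  refine ⟨nonnegForm_adjoint_pcomp (dense_domain_DA h), fun u a b a' b' g hW => ?_⟩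
  rw [H1, mem_graph_pcomp]
  refine ⟨_, (mem_graph_DA_iff h _ _).2 ⟨a, b, hW.ddt_u, hW.bA_u, rfl⟩, ?_⟩
  have k1 : (a + b + pert θ φ (fun _ => 1) u,
      a' + g + (pert θ φ (fun _ => 1) a + pert (deriv θ) φ (fun _ => 1) u)) ∈ ddt.graph :=
    ddt.graph.add_mem (ddt.graph.add_mem hW.ddt_a hW.ddt_b) (pert_ddt h hW.ddt_u)
  have k2 : (a + b + pert θ φ (fun _ => 1) u,
      g + b' + (pert θ φ (fun _ => 1) b - Complex.I • pert θ (deriv φ) (fun _ => 1) u)) ∈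
      boldAminus.graph :=
    boldAminus.graph.add_mem (boldAminus.graph.add_mem hW.bA_a hW.bA_b)
      (pert_boldAminus h isCutoff_one hW.bA_u)
  convert mem_graph_adjoint_DA h k1 k2 using 2
  simp only [map_add]
  module

theorem isSchroedinger_H2 : IsSchroedinger φ θ (fun _ => 1) 1 (H2 φ θ) := by
  refine ⟨nonnegForm_pcomp_adjoint (dense_domain_DA h), fun u a b a' b' g hW => ?_⟩
  rw [H2, mem_graph_pcomp]
  refine ⟨_, mem_graph_adjoint_DA h hW.ddt_u hW.bA_u, ?_⟩
  have k1 : (-a + b + pert θ φ (fun _ => 1) u,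
      -a' + g + (pert θ φ (fun _ => 1) a + pert (deriv θ) φ (fun _ => 1) u)) ∈ ddt.graph :=
    ddt.graph.add_mem (ddt.graph.add_mem (ddt.graph.neg_mem hW.ddt_a) hW.ddt_b)
      (pert_ddt h hW.ddt_u)
  have k2 : (-a + b + pert θ φ (fun _ => 1) u,
      -g + b' + (pert θ φ (fun _ => 1) b - Complex.I • pert θ (deriv φ) (fun _ => 1) u)) ∈
      boldAminus.graph :=
    boldAminus.graph.add_mem (boldAminus.graph.add_mem (boldAminus.graph.neg_mem hW.bA_a) hW.bA_b)
      (pert_boldAminus h isCutoff_one hW.bA_u)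
  refine (mem_graph_DA_iff h _ _).2 ⟨_, _, k1, k2, ?_⟩
  simp only [map_add, map_neg]
  module

/-- The form of `𝑯₀ + 𝑩 𝑨₋ + 𝑨₋ 𝑩 + 𝑩² - s 𝑩'`, for `s = ±1`, is the square
`‖(s d/dt + 𝑨₋ + 𝑩) u‖²`. -/
theorem inner_schroedinger (hm : IsCutoff m) {s : ℝ} (hs : s ^ 2 = 1) {u a b a' b' g : Space}
    (hW : IsW22 u a b a' b' g) :
    inner ℂ u (-a' + b' + pert θ φ m b + (pert θ φ m b - Complex.I • pert θ (deriv φ) m u) +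
      pert θ φ m (pert θ φ m u) - (s : ℂ) • pert (deriv θ) φ m u) =
    inner ℂ ((s : ℂ) • a + b + pert θ φ m u) ((s : ℂ) • a + b + pert θ φ m u) := by
  have k1 := inner_ddt hW.ddt_u hW.ddt_a
  have k2 := inner_boldAminus hW.bA_u hW.bA_b
  have k3 := inner_boldAminus hW.bA_u (pert_boldAminus h hm hW.bA_u)
  have k4 := inner_ddt hW.ddt_u (pert_ddt (m := m) h hW.ddt_u)
  have k5 := hW.inner_add_inner
  have k6 := inner_pert_left h h.theta_bdd hm u b
  have k7 := inner_pert_left h h.theta_bdd hm u (pert θ φ m u)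
  have k8 := inner_pert_left h h.theta_bdd hm u a
  have hs' : (s : ℂ) ^ 2 = 1 := by exact_mod_cast hs
  simp only [inner_add_left, inner_add_right, inner_sub_right, inner_neg_right, inner_smul_left,
    inner_smul_right, Complex.conj_ofReal] at *
  linear_combination -k1 + k2 + k3 - s * k4 - s * k5 - k6 - k7 - s * k8 +
    (-inner ℂ a a) * hs'

/-- The graph of `𝑯₀ + 𝑩_n 𝑨₋ + 𝑨₋ 𝑩_n + 𝑩_n²`. The domain is that of `𝑯₀`, because the bounded
operator `𝑩_n` preserves the domain of `𝑨₋`. -/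
theorem mem_graph_HnCommon_iff (n : ℕ) (u w : Space) : (u, w) ∈ (HnCommon φ θ n).graph ↔
    ∃ a b a' b', ((u, a) ∈ ddt.graph ∧ (a, a') ∈ ddt.graph ∧ (u, b) ∈ boldAminus.graph ∧
      (b, b') ∈ boldAminus.graph) ∧
      w = -a' + b' + pert θ φ (chiSym n) b + (pert θ φ (chiSym n) b -
        Complex.I • pert θ (deriv φ) (chiSym n) u) +
        pert θ φ (chiSym n) (pert θ φ (chiSym n) u) := by
  have hB := mem_graph_boldFamily_BplusN_iff h.theta_bdd h.phi_bdd n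
  have hc := isCutoff_chiSym n
  rw [HnCommon, H0, boldBn]
  constructor
  · intro H
    obtain ⟨w1, w2, H1, H2, rfl⟩ := (mem_graph_add _ _ _ _).1 H
    obtain ⟨w3, w4, H3, H4, rfl⟩ := (mem_graph_add _ _ _ _).1 H1
    obtain ⟨w5, w6, H5, H6, rfl⟩ := (mem_graph_add _ _ _ _).1 H3
    obtain ⟨w7, w8, H7, H8, rfl⟩ := (mem_graph_add _ _ _ _).1 H5
    obtain ⟨a', H9, rfl⟩ := (mem_graph_neg _ _ _).1 H7
    obtain ⟨a, ha, ha'⟩ := (mem_graph_pcomp _ _ _ _).1 H9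
    obtain ⟨b, hb, hb'⟩ := (mem_graph_pcomp _ _ _ _).1 H8
    obtain ⟨v, hv, hv'⟩ := (mem_graph_pcomp _ _ _ _).1 H2
    obtain ⟨x, hx, hx'⟩ := (mem_graph_pcomp _ _ _ _).1 H4
    obtain ⟨y, hy, hy'⟩ := (mem_graph_pcomp _ _ _ _).1 H6
    rw [hB] at hv hv' hx hy'
    subst hv hv' hx hy'
    refine ⟨a, b, a', w8, ⟨ha, ha', hb, hb'⟩, ?_⟩
    rw [boldAminus.mem_graph_snd_inj hy hb rfl,
      boldAminus.mem_graph_snd_inj hx' (pert_boldAminus h hc hb) rfl]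
  · rintro ⟨a, b, a', b', ⟨ha, ha', hb, hb'⟩, rfl⟩
    refine (mem_graph_add _ _ _ _).2 ⟨_, _, (mem_graph_add _ _ _ _).2 ⟨_, _,
      (mem_graph_add _ _ _ _).2 ⟨_, _, (mem_graph_add _ _ _ _).2 ⟨_, _,
      (mem_graph_neg _ _ _).2 ⟨_, (mem_graph_pcomp _ _ _ _).2 ⟨a, ha, ha'⟩, rfl⟩,
      (mem_graph_pcomp _ _ _ _).2 ⟨b, hb, hb'⟩, rfl⟩,
      (mem_graph_pcomp _ _ _ _).2 ⟨b, hb, (hB _ _).2 rfl⟩, rfl⟩,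
      (mem_graph_pcomp _ _ _ _).2 ⟨_, (hB _ _).2 rfl, pert_boldAminus h hc hb⟩, rfl⟩,
      (mem_graph_pcomp _ _ _ _).2 ⟨_, (hB _ _).2 rfl, (hB _ _).2 rfl⟩, rfl⟩

theorem isSchroedinger_H1n (n : ℕ) : IsSchroedinger φ θ (chiSym n) (-1) (H1n φ θ n) := by
  have hB' := mem_graph_boldFamily_BplusN_iff h.theta_deriv_bdd h.phi_bdd n
  constructor
  · intro u w H
    obtain ⟨w1, w2, H1, H2, rfl⟩ := (mem_graph_sub _ _ _ _).1 H
    rw [boldBn', hB'] at H2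
    obtain ⟨a, b, a', b', ⟨ha, ha', hb, hb'⟩, rfl⟩ := (mem_graph_HnCommon_iff h n _ _).1 H1
    obtain ⟨g, hW⟩ := exists_isW22 ha ha' hb hb'
    have key := inner_schroedinger h (isCutoff_chiSym n) (s := 1) (by norm_num) hW
    rw [Complex.ofReal_one, one_smul, ← H2] at key
    rw [key]
    exact exists_inner_self_eq _
  · intro u a b a' b' g hW
    rw [H1n, mem_graph_sub]
    refine ⟨_, _, (mem_graph_HnCommon_iff h n _ _).2
      ⟨a, b, a', b', ⟨hW.ddt_u, hW.ddt_a, hW.bA_u, hW.bA_b⟩, rfl⟩, (hB' _ _).2 rfl, ?_⟩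
    module

theorem isSchroedinger_H2n (n : ℕ) : IsSchroedinger φ θ (chiSym n) 1 (H2n φ θ n) := by
  have hB' := mem_graph_boldFamily_BplusN_iff h.theta_deriv_bdd h.phi_bdd n
  constructor
  · intro u w H
    obtain ⟨w1, w2, H1, H2, rfl⟩ := (mem_graph_add _ _ _ _).1 H
    rw [boldBn', hB'] at H2
    obtain ⟨a, b, a', b', ⟨ha, ha', hb, hb'⟩, rfl⟩ := (mem_graph_HnCommon_iff h n _ _).1 H1
    obtain ⟨g, hW⟩ := exists_isW22 ha ha' hb hb'
    have key := inner_schroedinger h (isCutoff_chiSym n) (s := -1) (by norm_num) hW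
    rw [Complex.ofReal_neg, Complex.ofReal_one, neg_one_smul, neg_one_smul, sub_neg_eq_add, ← H2]
      at key
    rw [key]
    exact exists_inner_self_eq _
  · intro u a b a' b' g hW
    rw [H2n, mem_graph_add]
    refine ⟨_, _, (mem_graph_HnCommon_iff h n _ _).2
      ⟨a, b, a', b', ⟨hW.ddt_u, hW.ddt_a, hW.bA_u, hW.bA_b⟩, rfl⟩, (hB' _ _).2 rfl, ?_⟩
    module

end Products

end Schroedinger

/-! ### The Hilbert–Schmidt factorization -/

section Factorization

/-- The weight `(1 + ξ²)^{-1/2}`. -/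
def weight (ξ : ℝ) : ℂ := ((Real.sqrt (1 + ξ ^ 2))⁻¹ : ℝ)

/-- `|η|^{1/2}`. -/
def rootAbs (η : ℝ → ℝ) (t : ℝ) : ℝ := Real.sqrt |η t|

/-- The sign of `η` (`0` where `η` vanishes, by division by zero). -/
def phase (η : ℝ → ℝ) (t : ℝ) : ℝ := η t / |η t|

theorem rootAbs_mul_phase (η : ℝ → ℝ) (t : ℝ) :
    rootAbs η t * phase η t * rootAbs η t = η t := by
  rw [rootAbs, phase, mul_right_comm, Real.mul_self_sqrt (abs_nonneg _)]
  rcases eq_or_ne (η t) 0 with h | h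
  · simp [h]
  · rw [mul_div_cancel₀ _ (abs_ne_zero.2 h)]

theorem memLp_phase {η : ℝ → ℝ} (hη : AEStronglyMeasurable η volume) :
    MemLp (phase η) ∞ volume := by
  refine memLp_top_of_bound (C := 1) ?_ (Eventually.of_forall fun t => ?_)
  · exact (hη.aemeasurable.div
      (measurable_norm.comp_aemeasurable hη.aemeasurable)).aestronglyMeasurable
  · rw [phase, norm_div, Real.norm_eq_abs, Real.norm_eq_abs, abs_abs]
    exact div_self_le_one _

theorem aestronglyMeasurable_rootAbs {η : ℝ → ℝ} (hη : AEStronglyMeasurable η volume) :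
    AEStronglyMeasurable (rootAbs η) volume :=
  Real.continuous_sqrt.comp_aestronglyMeasurable hη.norm

theorem memLp_top_rootAbs {η : ℝ → ℝ} (hη : MemLp η ∞ volume) : MemLp (rootAbs η) ∞ volume := by
  obtain ⟨C, hC, hb⟩ := exists_ae_bound hη
  refine memLp_top_of_bound (aestronglyMeasurable_rootAbs hη.1) (Real.sqrt C) ?_
  filter_upwards [hb] with t ht
  rw [rootAbs, Real.norm_of_nonneg (Real.sqrt_nonneg _)]
  exact Real.sqrt_le_sqrt ht

theorem memLp_two_rootAbs {η : ℝ → ℝ} (hη : MemLp η 1 volume) : MemLp (rootAbs η) 2 volume := by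
  rw [memLp_two_iff_integrable_sq (aestronglyMeasurable_rootAbs hη.1)]
  refine (memLp_one_iff_integrable.1 hη).norm.congr (Eventually.of_forall fun t => ?_)
  exact (Real.sq_sqrt (abs_nonneg _)).symm

theorem continuous_weight : Continuous weight := by
  unfold weight
  refine Complex.continuous_ofReal.comp (Continuous.inv₀ (by fun_prop) fun ξ => ?_)
  positivity

theorem norm_weight_le (ξ : ℝ) : ‖weight ξ‖ ≤ 1 := by
  rw [weight, Complex.norm_real, Real.norm_of_nonneg (by positivity)]
  refine inv_le_one_of_one_le₀ (Real.le_sqrt_of_sq_le ?_)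
  nlinarith [sq_nonneg ξ]

theorem memLp_weight : MemLp weight ∞ volume :=
  memLp_top_of_continuous continuous_weight norm_weight_le

theorem memLp_two_weight : MemLp weight 2 volume := by
  rw [memLp_two_iff_integrable_sq_norm continuous_weight.aestronglyMeasurable]
  refine integrable_inv_one_add_sq.congr (Eventually.of_forall fun ξ => ?_)
  change (1 + ξ ^ 2)⁻¹ = ‖weight ξ‖ ^ 2
  rw [weight, Complex.norm_real, Real.norm_of_nonneg (by positivity), inv_pow,
    Real.sq_sqrt (by positivity)]

theorem star_weight (ξ : ℝ) : star (weight ξ) = weight ξ := Complex.conj_ofReal _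

/-- The Fourier multiplier `(1 + ξ²)^{-1/2}` in `L²(ℝ; E)`. -/
def weightOp (E : Type*) [NormedAddCommGroup E] [InnerProductSpace ℂ E] [CompleteSpace E] :
    L2 E →L[ℂ] L2 E := conjF (mulL weight)

theorem star_weightOp (E : Type*) [NormedAddCommGroup E] [InnerProductSpace ℂ E]
    [CompleteSpace E] : star (weightOp E) = weightOp E := by
  rw [weightOp, star_conjF, star_mulL memLp_weight]
  simp_rw [star_weight]

/-- `(𝑯₀ + e)⁻¹` divided by the weights `(1 + τ²)^{-1/2}` and `(1 + ξ²)^{-1/2}`. -/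
def quotRes (e : ℝ) : Space →L[ℂ] Space := multOp fun τ ξ =>
  (Real.sqrt (1 + τ ^ 2) : ℂ) * ((Real.sqrt (1 + ξ ^ 2) * resSym e τ ξ : ℝ) : ℂ)

theorem one_le_two_mul_pi_sq : 1 ≤ (2 * Real.pi) ^ 2 := by
  nlinarith [Real.pi_gt_three]

theorem sqrt_one_add_sq_le (x : ℝ) : Real.sqrt (1 + x ^ 2) ≤ 1 + x ^ 2 := by
  rw [Real.sqrt_le_left (by positivity)]
  nlinarith [sq_nonneg x]

theorem isSym_quotRes {e : ℝ} (he : 1 ≤ e) : IsSym fun τ ξ =>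
    (Real.sqrt (1 + τ ^ 2) : ℂ) * ((Real.sqrt (1 + ξ ^ 2) * resSym e τ ξ : ℝ) : ℂ) := by
  have he0 : 0 < e := by linarith
  have hpi : ∀ x : ℝ, x ^ 2 ≤ (2 * Real.pi * x) ^ 2 := fun x => by
    rw [mul_pow]
    nlinarith [one_le_two_mul_pi_sq, sq_nonneg x]
  refine ⟨SymMeas.smul (a := fun τ => (Real.sqrt (1 + τ ^ 2) : ℂ))
    (Continuous.aestronglyMeasurable (by fun_prop))
    (symMeas_mul_resSym he0 (by fun_prop) (C := 1) fun ξ => ?_), 1, fun τ ξ => ?_⟩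
  · rw [abs_of_nonneg (Real.sqrt_nonneg _)]
    linarith [sqrt_one_add_sq_le ξ, hpi ξ]
  · beta_reduce
    rw [← Complex.ofReal_mul, Complex.norm_real, ← mul_assoc,
      Real.norm_of_nonneg (mul_nonneg (by positivity) (resSym_pos he0 τ ξ).le)]
    refine le_trans ?_ (resSym_mul he0 τ ξ).le
    refine mul_le_mul_of_nonneg_right ?_ (resSym_pos he0 τ ξ).le
    have h1 := Real.sq_sqrt (show 0 ≤ 1 + τ ^ 2 by positivity)
    have h2 := Real.sq_sqrt (show 0 ≤ 1 + ξ ^ 2 by positivity)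
    nlinarith [hpi τ, hpi ξ, sq_nonneg (Real.sqrt (1 + τ ^ 2) - Real.sqrt (1 + ξ ^ 2))]

theorem isSym_weight_left : IsSym fun τ _ => weight τ := .of_left continuous_weight norm_weight_le

theorem isSym_weight_right : IsSym fun _ ξ => weight ξ := .of_right continuous_weight norm_weight_le

theorem resH0_eq {e : ℝ} (he : 1 ≤ e) :
    resH0 e = weightOp (L2 ℂ) * constL (weightOp ℂ) * quotRes e := by
  rw [weightOp, weightOp, ← multOp_left, ← multOp_right, quotRes,
    multOp_mul isSym_weight_left isSym_weight_right,
    multOp_mul (isSym_weight_left.mul isSym_weight_right) (isSym_quotRes he), resH0]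
  congr 1
  funext τ ξ
  have h : ∀ x : ℝ, weight x * (Real.sqrt (1 + x ^ 2) : ℂ) = 1 := fun x => by
    rw [weight, ← Complex.ofReal_mul, inv_mul_cancel₀ (by positivity), Complex.ofReal_one]
  push_cast
  linear_combination (-(resSym e τ ξ : ℂ)) * h τ -
    (resSym e τ ξ : ℂ) * weight τ * (Real.sqrt (1 + τ ^ 2) : ℂ) * h ξ

/-- The Hilbert–Schmidt operator `|η|^{1/2} |φ|^{1/2} (1 + τ²)^{-1/2} (1 + ξ²)^{-1/2}`. -/
def hsFactor (η φ : ℝ → ℝ) : Space →L[ℂ] Space :=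
  mulL (fun t => (rootAbs η t : ℂ)) * weightOp (L2 ℂ) *
    constL (mulL (fun x => (rootAbs φ x : ℂ)) * weightOp ℂ)

/-- The sign of `η(t) φ(x)`. -/
def phaseOp (η φ : ℝ → ℝ) : Space →L[ℂ] Space :=
  mulL (fun t => (phase η t : ℂ)) * constL (mulL fun x => (phase φ x : ℂ))

theorem hsq_hsFactor_lt_top {η φ : ℝ → ℝ} (hη : MemLp η ∞ volume) (hη1 : MemLp η 1 volume)
    (hφ : MemLp φ ∞ volume) (hφ1 : MemLp φ 1 volume) : hsq (hsFactor η φ) < ∞ := by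
  have h : ∀ {ψ : ℝ → ℝ}, MemLp ψ ∞ volume → MemLp ψ 1 volume →
      hsq (mulL (fun x => (rootAbs ψ x : ℂ)) * conjF (mulL weight) : L2 ℂ →L[ℂ] L2 ℂ) < ∞ :=
    fun h1 h2 => hsq_mulL_conjF_lt_top (memLp_ofReal (memLp_top_rootAbs h1)) memLp_weight
      (memLp_two_rootAbs h2).ofReal memLp_two_weight
  exact hsq_tensor_lt_top (memLp_ofReal (memLp_top_rootAbs hη)) memLp_weight (h hη hη1) (h hφ hφ1)

theorem mulL_rootAbs_mul_phase {E : Type*} [NormedAddCommGroup E] [InnerProductSpace ℂ E]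
    [CompleteSpace E] {η : ℝ → ℝ} (hη : MemLp η ∞ volume) :
    (mulL (fun t => (rootAbs η t : ℂ)) * mulL (fun t => (phase η t : ℂ)) *
      mulL (fun t => (rootAbs η t : ℂ)) : L2 E →L[ℂ] L2 E) = mulL fun t => (η t : ℂ) := by
  have h1 := memLp_ofReal (memLp_top_rootAbs hη)
  have h2 := memLp_ofReal (memLp_phase hη.1)
  rw [mulL_mul h1 h2, mulL_mul (memLp_mul_top h1 h2) h1]
  congr 1
  funext t
  rw [← Complex.ofReal_mul, ← Complex.ofReal_mul, rootAbs_mul_phase]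

/-- The two Hilbert–Schmidt factors, with the sign between them, combine to `η(t) φ(x)` with the
weights on both sides. -/
theorem star_hsFactor_mul {η φ : ℝ → ℝ} (hη : MemLp η ∞ volume) (hφ : MemLp φ ∞ volume) :
    star (hsFactor η φ) * phaseOp η φ * hsFactor η φ =
      weightOp (L2 ℂ) * constL (weightOp ℂ) *
        (mulL (fun t => (η t : ℂ)) * constL (mulL fun x => (φ x : ℂ))) *
        (weightOp (L2 ℂ) * constL (weightOp ℂ)) := by
  have hη' := memLp_ofReal (memLp_top_rootAbs hη)
  rw [hsFactor, phaseOp, star_mul, star_mul, star_constL, star_mul, star_weightOp, star_weightOp,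
    star_mulL_ofReal (memLp_top_rootAbs hη), star_mulL_ofReal (memLp_top_rootAbs hφ),
    ← mulL_rootAbs_mul_phase (E := L2 ℂ) hη, ← mulL_rootAbs_mul_phase (E := ℂ) hφ]
  simp only [← constL_mul]
  set P := weightOp (L2 ℂ) with hP
  set R : Space →L[ℂ] Space := constL (weightOp ℂ) with hR
  set v : Space →L[ℂ] Space := mulL fun t => (rootAbs η t : ℂ) with hv
  set s : Space →L[ℂ] Space := mulL fun t => (phase η t : ℂ) with hs
  set w : Space →L[ℂ] Space := constL (mulL fun x => (rootAbs φ x : ℂ)) with hw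
  set r : Space →L[ℂ] Space := constL (mulL fun x => (phase φ x : ℂ)) with hr
  have c1 : P * w = w * P := commute_constL_conjF_mulL memLp_weight _
  have c2 : P * R = R * P := commute_constL_conjF_mulL memLp_weight _
  have c3 : v * w = w * v := mulL_commute_constL hη' _
  have c4 : v * r = r * v := mulL_commute_constL hη' _
  have c5 : s * w = w * s := mulL_commute_constL (memLp_ofReal (memLp_phase hη.1)) _
  calc R * w * (P * v) * (s * r) * (v * P * (w * R))
      = R * (w * P) * v * s * (r * v) * (P * w) * R := by simp only [mul_assoc]
    _ = R * (w * P) * v * s * (v * r) * (w * P) * R := by rw [c1, c4]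
    _ = R * (P * w) * v * s * (v * r) * (w * P) * R := by rw [c1]
    _ = R * P * (w * v) * s * v * r * w * P * R := by simp only [mul_assoc]
    _ = P * R * (w * v) * s * v * r * w * P * R := by rw [c2]
    _ = P * R * (v * (w * s)) * v * r * w * P * R := by rw [← c3]; simp only [mul_assoc]
    _ = P * R * v * s * (w * v) * r * w * P * R := by rw [← c5]; simp only [mul_assoc]
    _ = P * R * (v * s * v * (w * r * w)) * (P * R) := by rw [← c3]; simp only [mul_assoc]

/-- The bounded factor of `m (𝑯₀ + e)⁻¹` that remains once the weights `(1 + τ²)^{-1/2}` and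
`(1 + ξ²)^{-1/2}` are split off. -/
def linkOp (m : ℝ → ℝ) (e : ℝ) : Space →L[ℂ] Space := constL (cut m) * quotRes e

/-- `(𝑯₀ + e²)⁻¹ 𝑩' (𝑯₀ + e²)⁻¹` as a product of two Hilbert–Schmidt operators. -/
theorem resH0_mul_pert_mul_resH0 {η φ m : ℝ → ℝ} (hη : MemLp η ∞ volume)
    (hφ : MemLp φ ∞ volume) (hm : IsCutoff m) {e : ℝ} (he : 1 ≤ e) :
    resH0 (e ^ 2) * pert η φ m * resH0 (e ^ 2) =
      star (hsFactor η φ * linkOp m (e ^ 2)) * phaseOp η φ *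
        (hsFactor η φ * linkOp m (e ^ 2)) := by
  have he2 : 1 ≤ e ^ 2 := one_le_pow₀ he
  set W := hsFactor η φ with hW
  set P := weightOp (L2 ℂ) with hP
  set R : Space →L[ℂ] Space := constL (weightOp ℂ) with hR
  set Y := quotRes (e ^ 2) with hY
  set c : Space →L[ℂ] Space := constL (cut m) with hc
  set t : Space →L[ℂ] Space := mulL fun t => (η t : ℂ) with ht
  set f : Space →L[ℂ] Space := constL (mulL fun x => (φ x : ℂ)) with hf
  have h1 : resH0 (e ^ 2) = P * R * Y := resH0_eq he2
  have hPR : P * R = R * P := commute_constL_conjF_mulL memLp_weight _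
  have h2 : resH0 (e ^ 2) = star Y * (P * R) := by
    rw [← star_resH0 (by linarith : 0 < e), h1, star_mul, star_mul, hP, hR, star_constL,
      star_weightOp, star_weightOp, hPR]
  have hcPR : c * (P * R) = P * R * c := by
    rw [hc, hP, hR, weightOp, weightOp, cut, ← multOp_left, ← multOp_right, ← multOp_right,
      multOp_mul isSym_weight_left isSym_weight_right,
      multOp_mul hm.isSym (isSym_weight_left.mul isSym_weight_right),
      multOp_mul (isSym_weight_left.mul isSym_weight_right) hm.isSym]
    simp_rw [mul_comm]
  have hct : t * c = c * t := mulL_commute_constL (memLp_ofReal hη) _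
  have hcs : star c = c := by rw [hc, star_constL, star_cut hm]
  have hB : pert η φ m = t * c * f * c := by
    rw [pert, ← constL_mul, ← constL_mul]
    simp only [mul_assoc, hc, ht, hf]
  have hWW : star W * phaseOp η φ * W = P * R * (t * f) * (P * R) := star_hsFactor_mul hη hφ
  calc resH0 (e ^ 2) * pert η φ m * resH0 (e ^ 2)
      = star Y * (P * R) * (t * c * f * c) * (P * R * Y) := by
        rw [hB]
        conv_lhs => lhs; lhs; rw [h2]
        conv_lhs => rhs; rw [h1]
    _ = star Y * ((P * R) * c) * t * f * (c * (P * R)) * Y := by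
        rw [hct]; simp only [mul_assoc]
    _ = star Y * (c * (P * R)) * t * f * (c * (P * R)) * Y := by rw [hcPR]
    _ = star Y * (c * (P * R)) * t * f * ((P * R) * c) * Y := by
      exact congrArg (fun x => star Y * (c * (P * R)) * t * f * x * Y) hcPR
    _ = star Y * c * (P * R * (t * f) * (P * R)) * c * Y := by
        simp only [mul_assoc]
    _ = star Y * star c * (star W * phaseOp η φ * W) * c * Y := by rw [hWW, hcs]
    _ = star (W * (c * Y)) * phaseOp η φ * (W * (c * Y)) := by
        rw [star_mul W, star_mul c]
        simp only [mul_assoc]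

end Factorization

/-! ### Differences of resolvents -/

section ResolventDifference

theorem IsResolventAt.resolvent_eq {H : Type*} [NormedAddCommGroup H] [InnerProductSpace ℂ H]
    {T : H →ₗ.[ℂ] H} {z : ℂ} {R : H →L[ℂ] H} (h : IsResolventAt T z R) : resolvent T z = R := by
  have h' : ∃ R : H →L[ℂ] H, IsResolventAt T z R := ⟨R, h⟩
  rw [resolvent, dif_pos h']
  exact h'.choose_spec.unique h

/-- The distance of `z` from `[0, ∞)` is positive. -/
theorem exists_pos_le_norm_sub {z : ℂ} (hz : ∀ r : ℝ, 0 ≤ r → z ≠ (r : ℂ)) :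
    ∃ d : ℝ, 0 < d ∧ ∀ r : ℝ, 0 ≤ r → d ≤ ‖(r : ℂ) - z‖ := by
  have hc : IsClosed ((fun r : ℝ => (r : ℂ)) '' Set.Ici 0) :=
    Complex.isometry_ofReal.isClosedEmbedding.isClosedMap _ isClosed_Ici
  have hzs : z ∉ (fun r : ℝ => (r : ℂ)) '' Set.Ici 0 := by
    rintro ⟨r, hr, rfl⟩
    exact hz r hr rfl
  refine ⟨_, (hc.notMem_iff_infDist_pos ⟨_, 0, Set.mem_Ici.2 le_rfl, rfl⟩).1 hzs, fun r hr => ?_⟩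
  rw [norm_sub_rev, ← dist_eq_norm]
  exact Metric.infDist_le_dist_of_mem ⟨r, hr, rfl⟩

/-- The bounded operator `(T - z) (𝑯₀ + e²)⁻¹`, where `T = 𝑯₀ + 𝑩 𝑨₋ + 𝑨₋ 𝑩 + 𝑩² + σ 𝑩'`. -/
def resFactor (φ θ m : ℝ → ℝ) (e : ℝ) (σ z : ℂ) : Space →L[ℂ] Space :=
  1 + relPert φ θ m e σ - (z + ((e ^ 2 : ℝ) : ℂ)) • resH0 (e ^ 2)

/-- `G` is the inverse of `resFactor φ θ m e σ z`, with norm at most `C`. -/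
structure IsInvFactor (φ θ m : ℝ → ℝ) (e : ℝ) (σ z : ℂ) (C : ℝ) (G : Space →L[ℂ] Space) :
    Prop where
  mul_left : resFactor φ θ m e σ z * G = 1
  mul_right : G * resFactor φ θ m e σ z = 1
  norm_le : ‖G‖ ≤ C

variable {φ θ m : ℝ → ℝ} {T T₁ T₂ : Space →ₗ.[ℂ] Space} {e d : ℝ} {σ z : ℂ}

theorem IsSchroedinger.exists_invFactor (h : IsSchroedinger φ θ m σ T) (he : 0 < e)
    (hK : ‖relPert φ θ m e σ‖ ≤ 1 / 2) (hd : 0 < d)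
    (hdz : ∀ r : ℝ, 0 ≤ r → d ≤ ‖(r : ℂ) - z‖) :
    ∃ G, IsResolventAt T z (resH0 (e ^ 2) * G) ∧
      IsInvFactor φ θ m e σ z (2 * (1 + ‖z + ((e ^ 2 : ℝ) : ℂ)‖ / d)) G := by
  obtain ⟨G, h1, h2, h3, h4⟩ := h.nonneg.exists_resolvent (by positivity) hK
    (h.mem_graph_resH0 he) hd hdz
  exact ⟨G, h1, h2, h3, h4⟩

theorem relPert_sub : relPert φ θ m e (-1) - relPert φ θ m e 1 =
    (-2 : ℂ) • (pert (deriv θ) φ m * resH0 (e ^ 2)) := by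
  rw [relPert, relPert]
  module

/-- The difference of the resolvents as a product of two Hilbert–Schmidt operators and a bounded
operator: by the second resolvent identity it is `-2 (T₁ - z)⁻¹ 𝑩' (T₂ - z)⁻¹`. -/
theorem resolvent_sub_eq (h : Admissible φ θ) (hm : IsCutoff m) (he : 1 ≤ e)
    (h1 : IsSchroedinger φ θ m (-1) T₁) {C C' C'' : ℝ} {G₁ G₁' G₂ : Space →L[ℂ] Space}
    (hG₁ : IsInvFactor φ θ m e (-1) z C G₁)
    (hG₁' : IsInvFactor φ θ m e (-1) (star z) C' G₁') (hG₂ : IsInvFactor φ θ m e 1 z C'' G₂) :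
    resH0 (e ^ 2) * G₂ - resH0 (e ^ 2) * G₁ =
      star (hsFactor (deriv θ) φ * (linkOp m (e ^ 2) * G₁')) *
        ((-2 : ℂ) • phaseOp (deriv θ) φ) * (hsFactor (deriv θ) φ * (linkOp m (e ^ 2) * G₂)) := by
  have he0 : 0 < e := by linarith
  have hstar : star G₁' * resH0 (e ^ 2) = resH0 (e ^ 2) * G₁ := by
    refine star_inverse_mul (h1.nonneg.star_mul_eq (h1.mem_graph_resH0 he0) (star_resH0 he0))
      (star_resH0 he0) hG₁.mul_left ?_
    have := hG₁'.mul_left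
    rw [resFactor] at this
    rwa [star_add, show star ((e ^ 2 : ℝ) : ℂ) = ((e ^ 2 : ℝ) : ℂ) from Complex.conj_ofReal _]
  have hQ : resFactor φ θ m e (-1) z - resFactor φ θ m e 1 z =
      (-2 : ℂ) • (pert (deriv θ) φ m * resH0 (e ^ 2)) := by
    rw [resFactor, resFactor, ← relPert_sub]
    module
  have hG : G₂ - G₁ = G₁ * ((-2 : ℂ) • (pert (deriv θ) φ m * resH0 (e ^ 2))) * G₂ := by
    rw [← hQ, mul_sub, sub_mul, hG₁.mul_right, one_mul, mul_assoc, hG₂.mul_left, mul_one]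
  have hS := resH0_mul_pert_mul_resH0 h.theta_deriv_bdd h.phi_bdd hm he
  calc resH0 (e ^ 2) * G₂ - resH0 (e ^ 2) * G₁
      = (-2 : ℂ) • (resH0 (e ^ 2) * G₁ * (pert (deriv θ) φ m * resH0 (e ^ 2)) * G₂) := by
        rw [← mul_sub, hG]
        simp only [mul_smul_comm, smul_mul_assoc, mul_assoc]
    _ = (-2 : ℂ) • (star G₁' * (resH0 (e ^ 2) * pert (deriv θ) φ m * resH0 (e ^ 2)) * G₂) := by
        rw [← hstar]
        simp only [mul_assoc]
    _ = _ := by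
        rw [hS]
        simp only [star_mul, mul_smul_comm, smul_mul_assoc, mul_assoc]

theorem norm_linkOp_le (hm : IsCutoff m) (e : ℝ) : ‖linkOp m e‖ ≤ ‖quotRes e‖ := by
  refine (norm_mul_le _ _).trans ?_
  exact mul_le_of_le_one_left (norm_nonneg _) ((norm_constL_le _).trans (norm_cut_le hm))

theorem norm_linkOp_mul_le (hm : IsCutoff m) {C : ℝ} {G : Space →L[ℂ] Space}
    (hG : IsInvFactor φ θ m e σ z C G) : ‖linkOp m (e ^ 2) * G‖ ≤ ‖quotRes (e ^ 2)‖ * C :=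
  (norm_mul_le _ _).trans
    (mul_le_mul (norm_linkOp_le hm _) hG.norm_le (norm_nonneg _) (norm_nonneg _))

theorem traceNorm_lt_top (h : Admissible φ θ) (X Y V : Space →L[ℂ] Space) :
    traceNorm (star (hsFactor (deriv θ) φ * X) * V * (hsFactor (deriv θ) φ * Y)) < ∞ := by
  have hW := hsq_hsFactor_lt_top h.theta_deriv_bdd h.theta_deriv_int h.phi_bdd h.phi_int
  exact (traceNorm_star_mul_le (hsq_mul_lt_top hW X) (hsq_mul_lt_top hW Y)).trans_lt
    ENNReal.ofReal_lt_top

end ResolventDifference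

/-! ### Strong convergence of the cut-off operators -/

section Convergence

variable {H : Type*} [NormedAddCommGroup H] [InnerProductSpace ℂ H]

/-- Convergence of a sequence of operators in the strong operator topology. -/
def StrongTendsto (A : ℕ → H →L[ℂ] H) (A' : H →L[ℂ] H) : Prop :=
  ∀ f, Tendsto (fun n => A n f) atTop (𝓝 (A' f))

theorem StrongTendsto.const (A : H →L[ℂ] H) : StrongTendsto (fun _ => A) A :=
  fun _ => tendsto_const_nhds

theorem StrongTendsto.add {A B : ℕ → H →L[ℂ] H} {A' B' : H →L[ℂ] H} (hA : StrongTendsto A A')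
    (hB : StrongTendsto B B') : StrongTendsto (fun n => A n + B n) (A' + B') :=
  fun f => (hA f).add (hB f)

theorem StrongTendsto.sub {A B : ℕ → H →L[ℂ] H} {A' B' : H →L[ℂ] H} (hA : StrongTendsto A A')
    (hB : StrongTendsto B B') : StrongTendsto (fun n => A n - B n) (A' - B') :=
  fun f => (hA f).sub (hB f)

theorem StrongTendsto.smul (c : ℂ) {A : ℕ → H →L[ℂ] H} {A' : H →L[ℂ] H}
    (hA : StrongTendsto A A') : StrongTendsto (fun n => c • A n) (c • A') :=
  fun f => (hA f).const_smul c

theorem StrongTendsto.const_mul (B : H →L[ℂ] H) {A : ℕ → H →L[ℂ] H} {A' : H →L[ℂ] H}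
    (hA : StrongTendsto A A') : StrongTendsto (fun n => B * A n) (B * A') :=
  fun f => (B.continuous.tendsto _).comp (hA f)

theorem StrongTendsto.mul {A B : ℕ → H →L[ℂ] H} {A' B' : H →L[ℂ] H} {C : ℝ}
    (hA : StrongTendsto A A') (hB : StrongTendsto B B') (hC : ∀ n, ‖A n‖ ≤ C) :
    StrongTendsto (fun n => A n * B n) (A' * B') := tendsto_mul_of_strong hA hB hC

variable {φ θ : ℝ → ℝ}

theorem tendsto_chiSym (ξ : ℝ) : Tendsto (fun n => chiSym n ξ) atTop (𝓝 1) := by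
  have h1 : Tendsto (fun n : ℕ => (Real.sqrt ((2 * Real.pi * ξ / n) ^ 2 + 1))⁻¹) atTop (𝓝 1) := by
    have h2 := ((tendsto_const_div_atTop_nhds_zero_nat (2 * Real.pi * ξ)).pow 2).add_const 1
    have h3 := (Real.continuous_sqrt.tendsto _).comp h2
    have h4 := h3.inv₀ (by simp)
    simpa using h4
  refine h1.congr' ?_
  filter_upwards [eventually_gt_atTop 0] with n hn
  have hn' : (0 : ℝ) < n := Nat.cast_pos.2 hn
  have h5 : (2 * Real.pi * ξ) ^ 2 + (n : ℝ) ^ 2 =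
      (n : ℝ) ^ 2 * ((2 * Real.pi * ξ / n) ^ 2 + 1) := by
    field_simp
  rw [chiSym, chi, h5, Real.sqrt_mul (by positivity), Real.sqrt_sq hn'.le, ← div_div,
    div_self hn'.ne', one_div]

theorem strongTendsto_cut : StrongTendsto (fun n => cut (chiSym n)) (cut fun _ => 1) :=
  fun f => tendsto_conjF (tendsto_mulL (fun n => (isCutoff_chiSym n).memLp) isCutoff_one.memLp
    (fun n => (isCutoff_chiSym n).norm_le) isCutoff_one.norm_le
    (fun ξ => (Complex.continuous_ofReal.tendsto _).comp (tendsto_chiSym ξ))) f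

theorem strongTendsto_constL_cut :
    StrongTendsto (fun n => (constL (cut (chiSym n)) : Space →L[ℂ] Space))
      (constL (cut fun _ => 1)) :=
  fun f => tendsto_constL (fun n => norm_cut_le (isCutoff_chiSym n)) (norm_cut_le isCutoff_one)
    strongTendsto_cut f

theorem strongTendsto_pert (η ψ : ℝ → ℝ) :
    StrongTendsto (fun n => pert η ψ (chiSym n)) (pert η ψ fun _ => 1) := by
  have hc : ∀ n, ‖(constL (cut (chiSym n)) : Space →L[ℂ] Space)‖ ≤ 1 := fun n =>
    (norm_constL_le _).trans (norm_cut_le (isCutoff_chiSym n))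
  have h := (strongTendsto_constL_cut.mul (strongTendsto_constL_cut.const_mul
    (constL (mulL fun x => (ψ x : ℂ)))) hc).const_mul (mulL fun t => (η t : ℂ))
  simp only [pert, ← constL_mul, mul_assoc]
  exact h

theorem strongTendsto_star_linkOp (e : ℝ) :
    StrongTendsto (fun n => star (linkOp (chiSym n) e)) (star (linkOp (fun _ => 1) e)) := by
  have h : ∀ {m}, IsCutoff m → star (linkOp m e) = star (quotRes e) * constL (cut m) := by
    intro m hm
    rw [linkOp, star_mul, star_constL, star_cut hm]
  rw [h isCutoff_one, funext fun n => h (isCutoff_chiSym n)]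
  exact strongTendsto_constL_cut.const_mul _

variable (h : Admissible φ θ) {m : ℝ → ℝ} {M e : ℝ} {σ z : ℂ}
include h

/-- The bounds of `𝑩`, `𝑩'` and `𝑪` are uniform in the cutoff. -/
theorem exists_norm_pert_le : ∃ M : ℝ, 0 ≤ M ∧ ∀ m, IsCutoff m →
    ‖pert θ φ m‖ ≤ M ∧ ‖pert θ (deriv φ) m‖ ≤ M ∧ ‖pert (deriv θ) φ m‖ ≤ M := by
  obtain ⟨C1, hC1, h1⟩ := exists_ae_bound h.phi_bdd
  obtain ⟨C2, hC2, h2⟩ := exists_ae_bound h.phi_deriv_bdd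
  obtain ⟨C3, hC3, h3⟩ := exists_ae_bound h.theta_bdd
  obtain ⟨C4, hC4, h4⟩ := exists_ae_bound h.theta_deriv_bdd
  have p1 := mul_nonneg hC3 hC1
  have p2 := mul_nonneg hC3 hC2
  have p3 := mul_nonneg hC4 hC1
  refine ⟨C3 * C1 + C3 * C2 + C4 * C1, by positivity, fun m hm => ⟨?_, ?_, ?_⟩⟩
  · exact (norm_pert_le hC3 hC1 h3 h1 hm).trans (by linarith)
  · exact (norm_pert_le hC3 hC2 h3 h2 hm).trans (by linarith)
  · exact (norm_pert_le hC4 hC1 h4 h1 hm).trans (by linarith)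

theorem star_resFactor (hm : IsCutoff m) (he : 0 < e) : star (resFactor φ θ m e σ z) =
    1 + ((2 : ℂ) • (star (bAResH0 (e ^ 2)) * pert θ φ m) +
      Complex.I • (resH0 (e ^ 2) * pert θ (deriv φ) m) +
      resH0 (e ^ 2) * (pert θ φ m * pert θ φ m) +
      star σ • (resH0 (e ^ 2) * pert (deriv θ) φ m)) -
      star (z + ((e ^ 2 : ℝ) : ℂ)) • resH0 (e ^ 2) := by
  have hI : star Complex.I = -Complex.I := Complex.conj_I
  have h2 : star (2 : ℂ) = 2 := Complex.conj_ofNat 2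
  rw [resFactor, relPert]
  simp only [star_add, star_sub, star_smul, star_mul, star_one,
    star_pert h.theta_bdd h.phi_bdd hm, star_pert h.theta_bdd h.phi_deriv_bdd hm,
    star_pert h.theta_deriv_bdd h.phi_bdd hm, star_resH0 he, hI, h2]
  module

theorem strongTendsto_star_resFactor (he : 0 < e) :
    StrongTendsto (fun n => star (resFactor φ θ (chiSym n) e σ z))
      (star (resFactor φ θ (fun _ => 1) e σ z)) := by
  obtain ⟨M, hM, hb⟩ := exists_norm_pert_le h
  rw [star_resFactor h isCutoff_one he, funext fun n => star_resFactor h (isCutoff_chiSym n) he]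
  have hB := strongTendsto_pert θ φ
  have hB2 := hB.mul hB fun n => (hb _ (isCutoff_chiSym n)).1
  exact ((StrongTendsto.const 1).add (((((hB.const_mul _).smul 2).add
    (((strongTendsto_pert θ (deriv φ)).const_mul _).smul Complex.I)).add
    (hB2.const_mul _)).add (((strongTendsto_pert (deriv θ) φ).const_mul _).smul (star σ)))).sub
    (StrongTendsto.const _)

theorem strongTendsto_star_linkOp_mul (he : 0 < e) {C : ℝ} {G : ℕ → Space →L[ℂ] Space}
    {G' : Space →L[ℂ] Space} (hG : ∀ n, IsInvFactor φ θ (chiSym n) e σ z C (G n))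
    (hG' : IsInvFactor φ θ (fun _ => 1) e σ z C G') :
    StrongTendsto (fun n => star (linkOp (chiSym n) (e ^ 2) * G n))
      (star (linkOp (fun _ => 1) (e ^ 2) * G')) := by
  have h1 : StrongTendsto (fun n => star (G n)) (star G') :=
    tendsto_star_inverse (fun n => (hG n).mul_left) hG'.mul_right
      (fun n => (hG n).norm_le) (strongTendsto_star_resFactor h he)
  rw [star_mul, funext fun n => star_mul (linkOp (chiSym n) (e ^ 2)) (G n)]
  exact h1.mul (strongTendsto_star_linkOp _) fun n => (norm_star _).le.trans (hG n).norm_le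

end Convergence

end DiracModel

end

theorem mainTheorem3 (φ θ : ℝ → ℝ) (h : DiracModel.Admissible φ θ) (z : ℂ)
    (hz : ∀ r : ℝ, 0 ≤ r → z ≠ (r : ℂ)) :
    (z ∈ DiracModel.resolventSet (DiracModel.H1 φ θ) ∧
      z ∈ DiracModel.resolventSet (DiracModel.H2 φ θ) ∧
      DiracModel.IsTraceClass
        (DiracModel.resolvent (DiracModel.H2 φ θ) z -
          DiracModel.resolvent (DiracModel.H1 φ θ) z)) ∧
    (∀ n : ℕ, 1 ≤ n →
      z ∈ DiracModel.resolventSet (DiracModel.H1n φ θ n) ∧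
      z ∈ DiracModel.resolventSet (DiracModel.H2n φ θ n) ∧
      DiracModel.IsTraceClass
        (DiracModel.resolvent (DiracModel.H2n φ θ n) z -
          DiracModel.resolvent (DiracModel.H1n φ θ n) z)) ∧
    Tendsto (fun n : ℕ => DiracModel.traceNorm
      ((DiracModel.resolvent (DiracModel.H2n φ θ n) z -
          DiracModel.resolvent (DiracModel.H1n φ θ n) z) -
        (DiracModel.resolvent (DiracModel.H2 φ θ) z -
          DiracModel.resolvent (DiracModel.H1 φ θ) z))) atTop (𝓝 0) := by
  open DiracModel in
  obtain ⟨d, hd, hdz⟩ := exists_pos_le_norm_sub hz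
  have hdz' : ∀ r : ℝ, 0 ≤ r → d ≤ ‖(r : ℂ) - star z‖ := by
    intro r hr
    have h1 : (r : ℂ) - star z = star ((r : ℂ) - z) := by
      rw [star_sub, show star (r : ℂ) = r from Complex.conj_ofReal r]
    rw [h1, norm_star]
    exact hdz r hr
  obtain ⟨M, hM, hb⟩ := exists_norm_pert_le h
  -- the constant `e` makes the perturbation small relative to `𝑯₀ + e²`, uniformly in the cutoff
  set e := 4 * (M + 1) with he
  have he1 : 1 ≤ e := by linarith
  have he0 : 0 < e := by linarith
  have hK : ∀ m σ, IsCutoff m → ‖σ‖ ≤ 1 → ‖relPert φ θ m e σ‖ ≤ 1 / 2 := fun m σ hm hσ =>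
    norm_relPert_le hM (hb m hm).1 (hb m hm).2.1 (hb m hm).2.2 hσ
  have hσ1 : ‖(1 : ℂ)‖ ≤ 1 := by simp
  have hσ2 : ‖(-1 : ℂ)‖ ≤ 1 := by simp
  have hc := isCutoff_chiSym
  obtain ⟨G₁, hR₁, hG₁⟩ := (isSchroedinger_H1 h).exists_invFactor he0
    (hK _ _ isCutoff_one hσ2) hd hdz
  obtain ⟨G₁', -, hG₁'⟩ := (isSchroedinger_H1 h).exists_invFactor he0
    (hK _ _ isCutoff_one hσ2) hd hdz'
  obtain ⟨G₂, hR₂, hG₂⟩ := (isSchroedinger_H2 h).exists_invFactor he0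
    (hK _ _ isCutoff_one hσ1) hd hdz
  choose F₁ hS₁ hF₁ using fun n => (isSchroedinger_H1n h n).exists_invFactor he0
    (hK _ _ (hc n) hσ2) hd hdz
  choose F₁' _ hF₁' using fun n => (isSchroedinger_H1n h n).exists_invFactor he0
    (hK _ _ (hc n) hσ2) hd hdz'
  choose F₂ hS₂ hF₂ using fun n => (isSchroedinger_H2n h n).exists_invFactor he0
    (hK _ _ (hc n) hσ1) hd hdz
  have hD := resolvent_sub_eq h isCutoff_one he1 (isSchroedinger_H1 h) hG₁ hG₁' hG₂
  have hDn := fun n => resolvent_sub_eq h (hc n) he1 (isSchroedinger_H1n h n) (hF₁ n) (hF₁' n)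
    (hF₂ n)
  refine ⟨⟨⟨_, hR₁⟩, ⟨_, hR₂⟩, ?_⟩, fun n _ => ⟨⟨_, hS₁ n⟩, ⟨_, hS₂ n⟩, ?_⟩, ?_⟩
  · rw [hR₂.resolvent_eq, hR₁.resolvent_eq, hD]
    exact traceNorm_lt_top h _ _ _
  · rw [(hS₂ n).resolvent_eq, (hS₁ n).resolvent_eq, hDn]
    exact traceNorm_lt_top h _ _ _
  · simp only [hR₂.resolvent_eq, hR₁.resolvent_eq, hD, fun n => (hS₂ n).resolvent_eq,
      fun n => (hS₁ n).resolvent_eq, hDn]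
    have hW := hsq_hsFactor_lt_top h.theta_deriv_bdd h.theta_deriv_int h.phi_bdd h.phi_int
    exact tendsto_traceNorm hW
      (fun n => (norm_linkOp_mul_le (hc n) (hF₁' n)).trans (le_max_left _ _))
      ((norm_linkOp_mul_le isCutoff_one hG₁').trans (le_max_left _ _))
      (fun n => (norm_linkOp_mul_le (hc n) (hF₂ n)).trans (le_max_right _ _))
      ((norm_linkOp_mul_le isCutoff_one hG₂).trans (le_max_right _ _))
      (strongTendsto_star_linkOp_mul h he0 hF₁' hG₁')
      (strongTendsto_star_linkOp_mul h he0 hF₂ hG₂)
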